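/- Let $2\le m\le n$ be integers. A Hermitian matrix $W\in \mathcal M_m(\mathbb C)\otimes\mathcal M_n(\mathbb C)$ is an $m\times n$ entanglement witness (EW) if $\langle a,b|W|a,b\rangle\ge 0$ for all product vectors $|a,b\rangle=|a\rangle\otimes|b\rangle\in\mathbb C^m\otimes\mathbb C^n$ and $W$ has at least one negative eigenvalue. Let $\Gamma=T\otimes I$ denote the partial transpose. An EW $W$ is decomposable (a DEW) if $W=P+Q^\Gamma$ with $P,Q\ge 0$ positive semidefinite, and normalized if $\operatorname{tr}W=1$. Let $\lambda_1\ge\dots\ge\lambda_{mn}$ be the eigenvalues of $W$ with multiplicity, and let $\mathcal N(W)$ be the absolute value of the sum of the negative eigenvalues of $W$. A state is separable if it is a finite convex combination of operators $|v\rangle\langle v|\otimes|w\rangle\langle w|$ with $v,w$ unit vectors; a pure state (the projector onto a unit vector) is entangled if it is not separable. Below, infima, suprema and existence are taken over all normalized $m\times n$ DEWs $W$. (i) The set of values of $\operatorname{tr}(W^2)$ is exactly $(\frac1{mn-1},1]$: the infimum $\frac1{mn-1}$ is not attained, the supremum $1$ is attained. (ii) $W$ is a normalized DEW with $\operatorname{tr}(W^2)=1$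 if and only if $W=|\psi\rangle\langle\psi|^\Gamma$ for a pure entangled state $|\psi\rangle$. (iii) The set of values of $\lambda_{mn}(W)$ is exactly $[-\frac12,0)$: the infimum $-\frac12$ is attained, the supremum $0$ is not attained. (iv) $W$ is a normalized DEW with $\lambda_{mn}(W)=-\frac12$ if and only if $W=|\psi\rangle\langle\psi|^\Gamma$ for a pure state $|\psi\rangle$ that has exactly two nonzero Schmidt coefficients, both equal to $\frac{\sqrt2}2$. (v) The set of values of $\lambda_1(W)$ is exactly $(\frac1{mn-1},1)$: neither the infimum $\frac1{mn-1}$ nor the supremum $1$ is attained. (vi) The set of values of $\mathcal N(W)$ is exactly $(0,\frac{m-1}2]$: the infimum $0$ is not attained, the supremum $\frac{m-1}2$ is attained. (vii) For $1\le j\le\lfloor n/m\rfloor$ let $|\Phi_j\rangle=\frac1{\sqrt m}\sum_{i=1}^m|i,i+(j-1)m\rangle$. Then $W$ is a normalized DEW with $\mathcal N(W)=\frac{m-1}2$ if and only if there are unitary matrices $U\in\mathcal M_m(\mathbb C)$, $V\in\mathcal M_n(\mathbb C)$, an integer $1\le k\le\lfloor n/m\rfloor$ and numbers $p_1,\dots,p_k\ge0$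 with $\sum_j p_j=1$ such that $(U\otimes V)W(U\otimes V)^\dagger=\sum_{j=1}^k p_j|\Phi_j\rangle\langle\Phi_j|^\Gamma$. (viii) Let $m=2$. The infimum of $\sum_{i=3}^{2n}\lambda_i$ is $-\frac1{2+2\sqrt2}$, and it is attained by the normalized DEW $|\psi\rangle\langle\psi|^\Gamma$ with $|\psi\rangle=x_1|1,1\rangle+x_2|2,2\rangle$ for all real $x_1,x_2$ such that $x_1^2+x_2^2=1$ and $x_1^2+x_1x_2=1+\frac1{2+2\sqrt2}$; such $x_1,x_2$ exist, with $|x_1-0.92388|<10^{-6}$ and $|x_2-0.382683|<10^{-6}$. For every $4\le k\le 2n$ the infimum of $\sum_{i=k}^{2n}\lambda_i$ is $-\frac12$, and it is attained by the partial transpose of every maximally entangled pure state of $\mathbb C^2\otimes\mathbb C^n$ (both Schmidt coefficients equal to $\frac1{\sqrt2}$). (ix) Let $m\ge3$. The infimum of $\lambda_{mn}+\lambda_{mn-1}$ is $-\frac{\sqrt2}2$, and it is attained by the partial transpose of every pure state whose nonzero Schmidt coefficients are $\frac{\sqrt2}2,\frac12,\frac12$. The infimum of $\lambda_{mn}+\lambda_{mn-1}+\lambda_{mn-2}$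 is $-1$, and it is attained by the partial transpose of every two-qutrit maximally entangled state, i.e. every pure state of $\mathbb C^m\otimes\mathbb C^n$ whose nonzero Schmidt coefficients are $\frac1{\sqrt3},\frac1{\sqrt3},\frac1{\sqrt3}$. -/

import Mathlib

open scoped ComplexOrder Kronecker Matrix

/-- Operators on `ℂ^m ⊗ ℂ^n`, written in the standard product basis. -/
abbrev BipartiteMatrix (m n : ℕ) : Type := Matrix (Fin m × Fin n) (Fin m × Fin n) ℂ

/-- Vectors of `ℂ^m ⊗ ℂ^n`, written in the standard product basis. -/
abbrev BipartiteVec (m n : ℕ) : Type := Fin m × Fin n → ℂ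

/-- The product vector `|a⟩ ⊗ |b⟩`. -/
def tensorVec {m n : ℕ} (a : Fin m → ℂ) (b : Fin n → ℂ) : BipartiteVec m n :=
  fun p => a p.1 * b p.2

/-- The standard basis vector `|i,k⟩` of `ℂ^m ⊗ ℂ^n`, with `1 ≤ i ≤ m` and `1 ≤ k ≤ n`
(labels start at one; the zero vector for other labels). -/
def basisKet {m n : ℕ} (i k : ℕ) : BipartiteVec m n :=
  fun p => if (p.1 : ℕ) + 1 = i ∧ (p.2 : ℕ) + 1 = k then 1 else 0

/-- The rank-one operator `|v⟩⟨v|`. -/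
def ketbra {ι : Type*} (v : ι → ℂ) : Matrix ι ι ℂ := Matrix.vecMulVec v (star v)

/-- The partial transpose `(T ⊗ I)(M)` with respect to the first tensor factor. -/
def partialTranspose {m n : ℕ} (M : BipartiteMatrix m n) : BipartiteMatrix m n :=
  Matrix.of fun p q => M (q.1, p.2) (p.1, q.2)

/-- The `k`-th largest eigenvalue `λ_k` of a Hermitian matrix, counted with multiplicity, for
`1 ≤ k ≤ N` with `N` the order of the matrix, so that `λ_1 ≥ ⋯ ≥ λ_N`.
The value is `0` for other `k` or if the matrix is not Hermitian. -/
noncomputable def eigval {ι : Type*} [Fintype ι] [DecidableEq ι] (M : Matrix ι ι ℂ) (k : ℕ) : ℝ :=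
  open scoped Classical in
  if h : M.IsHermitian ∧ 1 ≤ k ∧ k ≤ Fintype.card ι then
    h.1.eigenvalues₀ ⟨k - 1, by omega⟩
  else 0

/-- The negativity: the absolute value of the sum of the negative eigenvalues. -/
noncomputable def negativity {ι : Type*} [Fintype ι] [DecidableEq ι] (M : Matrix ι ι ℂ) : ℝ :=
  |∑ k ∈ (Finset.Icc 1 (Fintype.card ι)).filter (fun k => eigval M k < 0), eigval M k|

/-- Block-positive matrices: Hermitian with `⟨a,b|W|a,b⟩ ≥ 0` on all product vectors. -/
def IsBlockPositive {m n : ℕ} (W : BipartiteMatrix m n) : Prop :=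
  W.IsHermitian ∧ ∀ (a : Fin m → ℂ) (b : Fin n → ℂ),
    0 ≤ star (tensorVec a b) ⬝ᵥ (W *ᵥ tensorVec a b)

/-- Entanglement witnesses: block-positive matrices with at least one negative eigenvalue. -/
def IsEW {m n : ℕ} (W : BipartiteMatrix m n) : Prop :=
  IsBlockPositive W ∧ ∃ k : ℕ, eigval W k < 0

/-- Decomposable matrices: `W = P + Q^Γ` with `P, Q` positive semidefinite. -/
def IsDecomposable {m n : ℕ} (W : BipartiteMatrix m n) : Prop :=
  ∃ P Q : BipartiteMatrix m n, P.PosSemidef ∧ Q.PosSemidef ∧ W = P + partialTranspose Q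

/-- The set of normalized (unit-trace) `m × n` decomposable entanglement witnesses. -/
def normalizedDEW (m n : ℕ) : Set (BipartiteMatrix m n) :=
  {W | IsEW W ∧ IsDecomposable W ∧ W.trace = 1}

/-- Separable states: finite convex combinations of pure product states. -/
def IsSeparableState {m n : ℕ} (ρ : BipartiteMatrix m n) : Prop :=
  ∃ (r : ℕ) (p : Fin r → ℝ) (v : Fin r → Fin m → ℂ) (w : Fin r → Fin n → ℂ),
    (∀ i, 0 ≤ p i) ∧ ∑ i, p i = 1 ∧
    (∀ i, ‖WithLp.toLp 2 (v i)‖ = 1) ∧ (∀ i, ‖WithLp.toLp 2 (w i)‖ = 1) ∧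
    ρ = ∑ i, (p i : ℂ) • (ketbra (v i) ⊗ₖ ketbra (w i))

/-- Pure entangled states: unit vectors `ψ` such that `|ψ⟩⟨ψ|` is not separable. -/
def IsPureEntangled {m n : ℕ} (ψ : BipartiteVec m n) : Prop :=
  ‖WithLp.toLp 2 ψ‖ = 1 ∧ ¬ IsSeparableState (ketbra ψ)

/-- `ψ` is a unit vector whose nonzero Schmidt coefficients are `s 0, …, s (r - 1)`
(with multiplicity, in any order): `ψ = ∑ j, s j • |b_j⟩ ⊗ |c_j⟩` with all `s j > 0` and
`b`, `c` orthonormal. -/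
def HasSchmidtCoeffs {m n r : ℕ} (ψ : BipartiteVec m n) (s : Fin r → ℝ) : Prop :=
  ‖WithLp.toLp 2 ψ‖ = 1 ∧ (∀ j, 0 < s j) ∧
  ∃ (b : Fin r → Fin m → ℂ) (c : Fin r → Fin n → ℂ),
    Orthonormal ℂ (fun j => WithLp.toLp 2 (b j)) ∧
    Orthonormal ℂ (fun j => WithLp.toLp 2 (c j)) ∧
    ψ = ∑ j, (s j : ℂ) • tensorVec (b j) (c j)

/-- The maximally entangled state `Φ_j = (1/√m) ∑_{i=1}^m |i, i+(j-1)m⟩`, for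
`1 ≤ j ≤ ⌊n/m⌋`. -/
noncomputable def maxEntangledPhi (m n j : ℕ) : BipartiteVec m n :=
  ((1 / √(m : ℝ) : ℝ) : ℂ) • ∑ i ∈ Finset.Icc 1 m, basisKet i (i + (j - 1) * m)

/-! Everything reduces to pure states. If `W = P + Q^Γ` has trace one and `Q` is written as its
spectral sum, then the value of `W` summed over an orthonormal family is a nonnegative term from `P`
plus an average, of total weight at most one, of the same sums for `|ψ⟩⟨ψ|^Γ`. A nonnegative bound
on the negative part that holds for all pure states therefore holds for `W` (`neg_sum_qform_le`).
Sums of extreme eigenvalues, and the negativity, are sums of the form over orthonormal eigenvectors,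
and any other orthonormal family bounds them from the opposite side (`sum_last_eigval_le`,
`le_sum_first_eigval`, `neg_sum_qform_le_negativity`).

For `ψ = ∑ s_j b_j ⊗ c_j` the matrix `|ψ⟩⟨ψ|^Γ` is diagonal in an explicit family
(`qform_partialTranspose_ketbra_eq`): it has value `s_i²` on `b_i^* ⊗ c_i`, and `±s_i s_j` on the
symmetric and antisymmetric combinations of `b_i^* ⊗ c_j` and `b_j^* ⊗ c_i`. By Bessel's inequality,
the negative part seen by `k` orthonormal vectors is at most `∑ s_i s_j w_ij` with weights in
`[0,1]` of total at most `k`. Maximizing this under `∑ s_j² = 1` gives `1/2`, `√2/2`, `1` and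
`(m-1)/2`. For `m = 2` the two largest eigenvalues are bounded from above instead.

The bound on `tr W²` is Cauchy–Schwarz for the trace inner product, which `Γ` preserves
(`trace_sq_of_decomposable`). The lower ends in (i) and (v) come from `λ_mn < 0`, which makes the
other `mn - 1` eigenvalues add up to more than one. Explicit states, one segment of witnesses and
the intermediate value theorem fill the ranges.

In the equality cases `P = 0` and every eigenvector of `Q` with nonzero eigenvalue attains the
pure-state bound (`eq_of_neg_sum_qform_eq`). Since `⟨v|(|ψ⟩⟨ψ|)^Γ|v⟩` is symmetric in `v` and `ψ`,
the vectors attaining the bound can be studied for fixed `v`. For `λ_mn = -1/2` they are unique up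
to a scalar. For maximal negativity they span a subspace on which every coefficient matrix has
orthogonal rows of equal norm; polarization makes the rows of different eigenvectors orthogonal as
well, so one unitary of the second factor carries all of them to the states `Φ_j`. -/

open Matrix

/-! ### Quadratic forms, ordered eigenvalues and Ky Fan type inequalities. -/

section Spectral

variable {ι κ : Type*} [Fintype ι]

theorem inner_toLp_eq (x y : ι → ℂ) :
    inner ℂ (WithLp.toLp 2 x) (WithLp.toLp 2 y) = star x ⬝ᵥ y := by
  rw [EuclideanSpace.inner_toLp_toLp, dotProduct_comm]

theorem star_dotProduct_self (x : ι → ℂ) :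
    star x ⬝ᵥ x = ((‖WithLp.toLp 2 x‖ ^ 2 : ℝ) : ℂ) := by
  rw [← inner_toLp_eq, inner_self_eq_norm_sq_to_K]
  push_cast; rfl

theorem star_dotProduct_comm (x y : ι → ℂ) : star x ⬝ᵥ y = star (star y ⬝ᵥ x) := by
  rw [star_dotProduct]

theorem norm_star_dotProduct_comm (x y : ι → ℂ) : ‖star x ⬝ᵥ y‖ = ‖star y ⬝ᵥ x‖ := by
  rw [star_dotProduct_comm, norm_star]

theorem orthonormal_toLp_iff [DecidableEq κ] {v : κ → ι → ℂ} :
    Orthonormal ℂ (fun i => WithLp.toLp 2 (v i)) ↔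
      ∀ i j, star (v i) ⬝ᵥ v j = if i = j then 1 else 0 := by
  rw [orthonormal_iff_ite]
  simp only [inner_toLp_eq]

variable [Fintype κ] in
theorem Orthonormal.sum_norm_sq_dotProduct_le {v : κ → ι → ℂ}
    (hv : Orthonormal ℂ (fun i => WithLp.toLp 2 (v i))) (x : ι → ℂ) :
    ∑ i, ‖star (v i) ⬝ᵥ x‖ ^ 2 ≤ ‖WithLp.toLp 2 x‖ ^ 2 := by
  simpa only [inner_toLp_eq] using
    hv.sum_inner_products_le (WithLp.toLp 2 x) (s := Finset.univ)

/-- The real quadratic form of a matrix. -/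
noncomputable def qform (W : Matrix ι ι ℂ) (v : ι → ℂ) : ℝ := (star v ⬝ᵥ W *ᵥ v).re

theorem qform_add (W X : Matrix ι ι ℂ) (v : ι → ℂ) :
    qform (W + X) v = qform W v + qform X v := by
  simp [qform, add_mulVec]

theorem qform_sum {σ : Type*} (s : Finset σ) (W : σ → Matrix ι ι ℂ) (v : ι → ℂ) :
    qform (∑ i ∈ s, W i) v = ∑ i ∈ s, qform (W i) v := by
  simp [qform, sum_mulVec, dotProduct_sum]

theorem qform_smul (r : ℝ) (W : Matrix ι ι ℂ) (v : ι → ℂ) :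
    qform ((r : ℂ) • W) v = r * qform W v := by
  simp [qform, smul_mulVec]

theorem qform_sub (W X : Matrix ι ι ℂ) (v : ι → ℂ) :
    qform (W - X) v = qform W v - qform X v := by
  simp [qform, sub_mulVec]

theorem qform_one [DecidableEq ι] (v : ι → ℂ) :
    qform (1 : Matrix ι ι ℂ) v = ‖WithLp.toLp 2 v‖ ^ 2 := by
  rw [qform, one_mulVec, star_dotProduct_self, Complex.ofReal_re]

theorem ketbra_mulVec (u v : ι → ℂ) : ketbra u *ᵥ v = (star u ⬝ᵥ v) • u := by
  rw [ketbra, vecMulVec_mulVec]; ext; simp [mul_comm]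

theorem qform_ketbra (u v : ι → ℂ) : qform (ketbra u) v = ‖star u ⬝ᵥ v‖ ^ 2 := by
  rw [qform, ketbra_mulVec, dotProduct_smul, smul_eq_mul, star_dotProduct_comm v u,
    Complex.star_def, Complex.mul_conj, Complex.ofReal_re, Complex.normSq_eq_norm_sq]

theorem trace_ketbra (u : ι → ℂ) :
    (ketbra u).trace = ((‖WithLp.toLp 2 u‖ ^ 2 : ℝ) : ℂ) := by
  rw [ketbra, trace_vecMulVec, dotProduct_comm, star_dotProduct_self]

theorem ketbra_isHermitian {ι : Type*} (u : ι → ℂ) : (ketbra u).IsHermitian := by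
  ext i j; simp [ketbra, vecMulVec_apply, mul_comm]

theorem ketbra_mul_ketbra (u v : ι → ℂ) :
    ketbra u * ketbra v = (star u ⬝ᵥ v) • vecMulVec u (star v) := by
  rw [ketbra, ketbra, vecMulVec_mul_vecMulVec]; ext; simp [vecMulVec_apply]; ring

theorem ketbra_mul_self {u : ι → ℂ} (hu : ‖WithLp.toLp 2 u‖ = 1) :
    ketbra u * ketbra u = ketbra u := by
  rw [ketbra_mul_ketbra, star_dotProduct_self, hu]; simp [ketbra]

theorem ketbra_posSemidef (u : ι → ℂ) : (ketbra u).PosSemidef :=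
  posSemidef_vecMulVec_self_star u

theorem Matrix.PosSemidef.qform_nonneg {W : Matrix ι ι ℂ} (hW : W.PosSemidef) (v : ι → ℂ) :
    0 ≤ qform W v :=
  (Complex.nonneg_iff.1 (hW.dotProduct_mulVec_nonneg v)).1

theorem Matrix.IsHermitian.dotProduct_eq_qform {W : Matrix ι ι ℂ} (hW : W.IsHermitian)
    (v : ι → ℂ) : star v ⬝ᵥ W *ᵥ v = (qform W v : ℂ) := by
  refine Complex.ext rfl ?_
  simpa using hW.im_star_dotProduct_mulVec_self v

theorem Matrix.IsHermitian.posSemidef_of_qform {W : Matrix ι ι ℂ} (hW : W.IsHermitian)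
    (h : ∀ v, 0 ≤ qform W v) : W.PosSemidef :=
  .of_dotProduct_mulVec_nonneg hW fun v => by
    rw [hW.dotProduct_eq_qform]; exact_mod_cast h v

theorem Orthonormal.comp_subset {σ : Type*} {b : σ → ι → ℂ} {S T : Finset σ}
    (hb : Orthonormal ℂ (fun k : S => WithLp.toLp 2 (b k))) (hT : T ⊆ S) :
    Orthonormal ℂ (fun k : T => WithLp.toLp 2 (b k)) :=
  hb.comp (fun k : T => (⟨k, hT k.2⟩ : S)) fun k l h => by
    ext; simpa using h

theorem Orthonormal.norm_eq_one_of_mem {σ : Type*} {b : σ → ι → ℂ} {S : Finset σ}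
    (hb : Orthonormal ℂ (fun k : S => WithLp.toLp 2 (b k))) {k : σ} (hk : k ∈ S) :
    ‖WithLp.toLp 2 (b k)‖ = 1 := hb.1 ⟨k, hk⟩

theorem Orthonormal.dotProduct_of_mem {σ : Type*} [DecidableEq σ] {b : σ → ι → ℂ} {S : Finset σ}
    (hb : Orthonormal ℂ (fun k : S => WithLp.toLp 2 (b k))) {k l : σ} (hk : k ∈ S) (hl : l ∈ S) :
    star (b k) ⬝ᵥ b l = if k = l then 1 else 0 := by
  simpa using orthonormal_toLp_iff.1 hb ⟨k, hk⟩ ⟨l, hl⟩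

/-- A sum of values of the quadratic form over a spectral resolution. -/
theorem qform_of_eq_sum {σ : Type*} {S : Finset σ} {W : Matrix ι ι ℂ} {l : σ → ℝ} {b : σ → ι → ℂ}
    (h : W = ∑ k ∈ S, (l k : ℂ) • ketbra (b k)) (v : ι → ℂ) :
    qform W v = ∑ k ∈ S, l k * ‖star (b k) ⬝ᵥ v‖ ^ 2 := by
  rw [h, qform_sum]
  simp only [qform_smul, qform_ketbra]

theorem qform_eigenvector {σ : Type*} {S : Finset σ} {W : Matrix ι ι ℂ} {l : σ → ℝ}
    {b : σ → ι → ℂ} (hb : Orthonormal ℂ (fun k : S => WithLp.toLp 2 (b k)))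
    (h : W = ∑ k ∈ S, (l k : ℂ) • ketbra (b k)) {k : σ} (hk : k ∈ S) :
    qform W (b k) = l k := by
  classical
  rw [qform_of_eq_sum h, Finset.sum_eq_single k]
  · rw [hb.dotProduct_of_mem hk hk]; simp
  · intro j hj hjk
    rw [hb.dotProduct_of_mem hj hk]; simp [hjk]
  · exact fun h => absurd hk h

theorem trace_of_eq_sum {σ : Type*} {S : Finset σ} {W : Matrix ι ι ℂ} {l : σ → ℝ}
    {b : σ → ι → ℂ} (hb : Orthonormal ℂ (fun k : S => WithLp.toLp 2 (b k)))
    (h : W = ∑ k ∈ S, (l k : ℂ) • ketbra (b k)) : W.trace = ((∑ k ∈ S, l k : ℝ) : ℂ) := by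
  rw [h, trace_sum]
  push_cast
  refine Finset.sum_congr rfl fun k hk => ?_
  rw [trace_smul, trace_ketbra, hb.norm_eq_one_of_mem hk]; simp

variable [Fintype κ] [DecidableEq ι]

theorem eigval_antitone {W : Matrix ι ι ℂ} (hW : W.IsHermitian) {k l : ℕ} (hk : 1 ≤ k)
    (hkl : k ≤ l) (hl : l ≤ Fintype.card ι) : eigval W l ≤ eigval W k := by
  rw [eigval, eigval, dif_pos ⟨hW, hk.trans hkl, hl⟩, dif_pos ⟨hW, hk, hkl.trans hl⟩]
  exact hW.eigenvalues₀_antitone (Fin.mk_le_mk.2 (by omega))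

theorem eigval_eq_zero_of_notMem {W : Matrix ι ι ℂ} {k : ℕ}
    (hk : k ∉ Finset.Icc 1 (Fintype.card ι)) : eigval W k = 0 := by
  rw [eigval, dif_neg]
  rintro ⟨-, h⟩
  exact hk (Finset.mem_Icc.2 h)

/-- The spectral theorem, with eigenvectors numbered as the eigenvalues `eigval`. -/
theorem Matrix.IsHermitian.exists_eigenvectors {W : Matrix ι ι ℂ} (hW : W.IsHermitian) {N : ℕ}
    (hN : Fintype.card ι = N) :
    ∃ b : ℕ → ι → ℂ,
      Orthonormal ℂ (fun k : Finset.Icc 1 N => WithLp.toLp 2 (b k)) ∧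
      (∀ x, ∑ k ∈ Finset.Icc 1 N, ‖star (b k) ⬝ᵥ x‖ ^ 2 = ‖WithLp.toLp 2 x‖ ^ 2) ∧
      (∀ x, ∑ k ∈ Finset.Icc 1 N, (star (b k) ⬝ᵥ x) • b k = x) ∧
      W = ∑ k ∈ Finset.Icc 1 N, (eigval W k : ℂ) • ketbra (b k) := by
  classical
  let e : Finset.Icc 1 N ≃ ι :=
    { toFun := fun k => Fintype.equivOfCardEq (Fintype.card_fin _)
        (⟨k - 1, by have := Finset.mem_Icc.1 k.2; omega⟩ : Fin (Fintype.card ι))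
      invFun := fun i =>
        ⟨((Fintype.equivOfCardEq (Fintype.card_fin (Fintype.card ι))).symm i : ℕ) + 1, by
          have := ((Fintype.equivOfCardEq (Fintype.card_fin (Fintype.card ι))).symm i).2
          exact Finset.mem_Icc.2 ⟨by omega, by omega⟩⟩
      left_inv := fun k => by
        have := Finset.mem_Icc.1 k.2
        ext; simp; omega
      right_inv := fun i => by simp }
  let B := hW.eigenvectorBasis.reindex e.symm
  let b : ℕ → ι → ℂ := fun k => if h : k ∈ Finset.Icc 1 N then (B ⟨k, h⟩).ofLp else 0
  have hb : ∀ k : Finset.Icc 1 N, b k = (B k).ofLp := fun k => dif_pos k.2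
  have hrec : ∀ x, ∑ k ∈ Finset.Icc 1 N, (star (b k) ⬝ᵥ x) • b k = x := by
    intro x
    have := congrArg WithLp.ofLp (B.sum_repr' (WithLp.toLp 2 x))
    rw [← Finset.sum_coe_sort]
    simp only [hb, ← inner_toLp_eq, WithLp.toLp_ofLp]
    simpa using this
  refine ⟨b, ?_, ?_, hrec, ?_⟩
  · simp only [hb, WithLp.toLp_ofLp]
    exact B.orthonormal
  · intro x
    rw [← Finset.sum_coe_sort]
    simp only [hb, ← inner_toLp_eq, WithLp.toLp_ofLp]
    exact B.sum_sq_norm_inner_right (WithLp.toLp 2 x)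
  · have hev : ∀ k ∈ Finset.Icc 1 N, W *ᵥ b k = (eigval W k : ℂ) • b k := by
      intro k hk
      have hk' := Finset.mem_Icc.1 hk
      rw [hb ⟨k, hk⟩, eigval, dif_pos ⟨hW, hk'.1, by omega⟩]
      have := hW.mulVec_eigenvectorBasis (e ⟨k, hk⟩)
      simp only [B, OrthonormalBasis.reindex_apply, Equiv.symm_symm]
      rw [this, IsHermitian.eigenvalues]
      simp [e]
    refine ext_of_mulVec_single fun i => ?_
    rw [← hrec (Pi.single i 1), mulVec_sum, sum_mulVec]
    refine Finset.sum_congr rfl fun k hk => ?_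
    rw [mulVec_smul, hev k hk, hrec, smul_mulVec, ketbra_mulVec, smul_comm]

theorem trace_sq_of_eq_sum {σ : Type*} {S : Finset σ} {W : Matrix ι ι ℂ} {l : σ → ℝ}
    {b : σ → ι → ℂ} (hb : Orthonormal ℂ (fun k : S => WithLp.toLp 2 (b k)))
    (h : W = ∑ k ∈ S, (l k : ℂ) • ketbra (b k)) :
    (W ^ 2).trace = ((∑ k ∈ S, l k ^ 2 : ℝ) : ℂ) := by
  classical
  have h2 : W ^ 2 = ∑ k ∈ S, ((l k ^ 2 : ℝ) : ℂ) • ketbra (b k) := by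
    rw [sq]
    nth_rewrite 1 [h]
    rw [h, Finset.sum_mul_sum]
    refine Finset.sum_congr rfl fun k hk => ?_
    rw [Finset.sum_eq_single k]
    · rw [smul_mul_smul_comm, ketbra_mul_self (hb.norm_eq_one_of_mem hk)]
      push_cast; rw [sq]
    · intro j hj hjk
      rw [smul_mul_smul_comm, ketbra_mul_ketbra, hb.dotProduct_of_mem hk hj, if_neg hjk.symm]
      simp
    · exact fun h => absurd hk h
  exact trace_of_eq_sum hb h2

theorem Matrix.IsHermitian.sum_eigval {W : Matrix ι ι ℂ} (hW : W.IsHermitian) {N : ℕ}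
    (hN : Fintype.card ι = N) : W.trace = ((∑ k ∈ Finset.Icc 1 N, eigval W k : ℝ) : ℂ) := by
  obtain ⟨b, hb, -, -, h⟩ := hW.exists_eigenvectors hN
  exact trace_of_eq_sum hb h

theorem Matrix.IsHermitian.sum_eigval_sq {W : Matrix ι ι ℂ} (hW : W.IsHermitian) {N : ℕ}
    (hN : Fintype.card ι = N) :
    (W ^ 2).trace.re = ∑ k ∈ Finset.Icc 1 N, eigval W k ^ 2 := by
  obtain ⟨b, hb, -, -, h⟩ := hW.exists_eigenvectors hN
  rw [trace_sq_of_eq_sum hb h, Complex.ofReal_re]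

theorem Matrix.PosSemidef.eigval_nonneg {W : Matrix ι ι ℂ} (hW : W.PosSemidef) (k : ℕ) :
    0 ≤ eigval W k := by
  obtain ⟨b, hb, -, -, h⟩ := hW.1.exists_eigenvectors rfl
  by_cases hk : k ∈ Finset.Icc 1 (Fintype.card ι)
  · rw [← qform_eigenvector hb h hk]
    exact hW.qform_nonneg _
  · rw [eigval_eq_zero_of_notMem hk]

/-- Bathtub principle: `(f - t)(1 - w) ≤ 0` on `T` and `(f - t) w ≥ 0` off `T`, and adding these
gives the claim up to `t (|T| - ∑ w)`. The hypothesis on that product covers three uses: equal total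
weight, a threshold `t = 0`, and an inequality between total weights matched to the sign of `t`. -/
theorem sum_le_sum_mul_of_threshold {σ : Type*} [DecidableEq σ] {S T : Finset σ} (hT : T ⊆ S)
    {f w : σ → ℝ} (t : ℝ) (hft : ∀ k ∈ T, f k ≤ t) (htf : ∀ k ∈ S \ T, t ≤ f k)
    (hw0 : ∀ k ∈ S, 0 ≤ w k) (hw1 : ∀ k ∈ S, w k ≤ 1)
    (hw : t * (T.card - ∑ k ∈ S, w k) ≤ 0) :
    ∑ k ∈ T, f k ≤ ∑ k ∈ S, f k * w k := by
  have h1 : ∑ k ∈ T, (f k - t) * (1 - w k) ≤ 0 := Finset.sum_nonpos fun k hk =>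
    mul_nonpos_of_nonpos_of_nonneg (by linarith [hft k hk]) (by linarith [hw1 k (hT hk)])
  have h2 : 0 ≤ ∑ k ∈ S \ T, (f k - t) * w k := Finset.sum_nonneg fun k hk =>
    mul_nonneg (by linarith [htf k hk]) (hw0 k (Finset.sdiff_subset hk))
  have h3 := Finset.sum_sdiff (f := fun k => f k * w k) hT
  have h4 := Finset.sum_sdiff (f := fun k => w k) hT
  have e1 : ∑ k ∈ T, (f k - t) * (1 - w k) =
      ∑ k ∈ T, f k - ∑ k ∈ T, f k * w k - t * T.card + t * ∑ k ∈ T, w k := by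
    rw [Finset.mul_sum, ← nsmul_eq_mul', ← Finset.sum_const, ← Finset.sum_sub_distrib,
      ← Finset.sum_sub_distrib, ← Finset.sum_add_distrib]
    exact Finset.sum_congr rfl fun _ _ => by ring
  have e2 : ∑ k ∈ S \ T, (f k - t) * w k =
      ∑ k ∈ S \ T, f k * w k - t * ∑ k ∈ S \ T, w k := by
    rw [Finset.mul_sum, ← Finset.sum_sub_distrib]
    exact Finset.sum_congr rfl fun _ _ => by ring
  rw [← h3]
  rw [← h4] at hw
  linarith

/-- The values of a quadratic form on an orthonormal family, as weighted sums of eigenvalues. -/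
theorem Matrix.IsHermitian.exists_weights {W : Matrix ι ι ℂ} (hW : W.IsHermitian) {N : ℕ}
    (hN : Fintype.card ι = N) {v : κ → ι → ℂ}
    (hv : Orthonormal ℂ (fun i => WithLp.toLp 2 (v i))) :
    ∃ w : ℕ → ℝ, (∀ k ∈ Finset.Icc 1 N, 0 ≤ w k) ∧ (∀ k ∈ Finset.Icc 1 N, w k ≤ 1) ∧
      ∑ k ∈ Finset.Icc 1 N, w k = Fintype.card κ ∧
      ∑ i, qform W (v i) = ∑ k ∈ Finset.Icc 1 N, eigval W k * w k := by
  obtain ⟨b, hb, hp, -, h⟩ := hW.exists_eigenvectors hN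
  refine ⟨fun k => ∑ i, ‖star (b k) ⬝ᵥ v i‖ ^ 2, fun k _ => by positivity, fun k hk => ?_, ?_, ?_⟩
  · have := hv.sum_norm_sq_dotProduct_le (b k)
    simp only [norm_star_dotProduct_comm _ (b k), hb.norm_eq_one_of_mem hk] at this
    simpa using this
  · rw [Finset.sum_comm]
    simp only [hp]
    simp [hv.1]
  · simp only [qform_of_eq_sum h, Finset.mul_sum]
    exact Finset.sum_comm

/-- One half of Ky Fan's minimum principle: the weights of an orthonormal family on the eigenvectors
lie in `[0,1]` and add up to its size, so nothing beats full weight on the smallest eigenvalues. -/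
theorem Matrix.IsHermitian.sum_last_eigval_le {W : Matrix ι ι ℂ} (hW : W.IsHermitian) {N : ℕ}
    (hN : Fintype.card ι = N) {v : κ → ι → ℂ}
    (hv : Orthonormal ℂ (fun i => WithLp.toLp 2 (v i))) {k : ℕ} (hk : 1 ≤ k)
    (hkN : k + Fintype.card κ = N + 1) :
    ∑ i ∈ Finset.Icc k N, eigval W i ≤ ∑ i, qform W (v i) := by
  obtain ⟨w, h0, h1, hs, h⟩ := hW.exists_weights hN hv
  rw [h]
  -- For `k = N + 1` the family is empty and `eigval W k` is only a default value, unusable as a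
  -- threshold.
  rcases Nat.lt_or_ge N k with hlt | hle
  · have : (Fintype.card κ) = 0 := by omega
    rw [this] at hs
    have hz := (Finset.sum_eq_zero_iff_of_nonneg h0).1 (by simpa using hs)
    rw [Finset.Icc_eq_empty (by omega), Finset.sum_empty]
    exact (Finset.sum_eq_zero fun j hj => by rw [hz j hj, mul_zero]).ge
  refine sum_le_sum_mul_of_threshold (Finset.Icc_subset_Icc hk le_rfl) (eigval W k) ?_ ?_ h0 h1 ?_
  · intro j hj
    have := Finset.mem_Icc.1 hj
    exact eigval_antitone hW hk this.1 (by omega)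
  · intro j hj
    simp only [Finset.mem_sdiff, Finset.mem_Icc] at hj
    exact eigval_antitone hW hj.1.1 (by omega) (by omega)
  · rw [hs, Nat.card_Icc, show N + 1 - k = Fintype.card κ by omega, sub_self, mul_zero]

theorem Matrix.IsHermitian.le_sum_first_eigval {W : Matrix ι ι ℂ} (hW : W.IsHermitian) {N : ℕ}
    (hN : Fintype.card ι = N) {v : κ → ι → ℂ}
    (hv : Orthonormal ℂ (fun i => WithLp.toLp 2 (v i))) :
    ∑ i, qform W (v i) ≤ ∑ i ∈ Finset.Icc 1 (Fintype.card κ), eigval W i := by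
  obtain ⟨w, h0, h1, hs, h⟩ := hW.exists_weights hN hv
  have hc : Fintype.card κ ≤ N := by
    have := Finset.sum_le_card_nsmul _ _ _ h1
    rw [hs] at this
    simpa using this
  rw [h]
  have := sum_le_sum_mul_of_threshold (S := Finset.Icc 1 N) (T := Finset.Icc 1 (Fintype.card κ))
    (f := fun k => - eigval W k) (Finset.Icc_subset_Icc le_rfl hc)
    -- The `max` keeps the threshold a genuine eigenvalue when the family is empty; index `0` would
    -- give the default value `0`.
    (- eigval W (max 1 (Fintype.card κ))) ?_ ?_ h0 h1 ?_
  · simp only [Finset.sum_neg_distrib, neg_mul] at this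
    linarith
  · intro j hj
    have := Finset.mem_Icc.1 hj
    exact neg_le_neg (eigval_antitone hW this.1 (by omega) (by omega))
  · intro j hj
    simp only [Finset.mem_sdiff, Finset.mem_Icc] at hj
    exact neg_le_neg (eigval_antitone hW (by omega) (by omega) (by omega))
  · rw [hs, Nat.card_Icc]; simp

/-- With threshold `0` the bathtub principle needs no constraint on the size of the family. Hence
the negativity can be bounded below by test vectors, without computing the spectrum. -/
theorem Matrix.IsHermitian.neg_sum_qform_le_negativity {W : Matrix ι ι ℂ} (hW : W.IsHermitian)
    {v : κ → ι → ℂ} (hv : Orthonormal ℂ (fun i => WithLp.toLp 2 (v i))) :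
    -∑ i, qform W (v i) ≤ negativity W := by
  obtain ⟨w, h0, h1, hs, h⟩ := hW.exists_weights rfl hv
  rw [h, negativity]
  have := sum_le_sum_mul_of_threshold (S := Finset.Icc 1 (Fintype.card ι))
    (T := (Finset.Icc 1 (Fintype.card ι)).filter (fun k => eigval W k < 0))
    (f := fun k => eigval W k) (Finset.filter_subset _ _) 0 ?_ ?_ h0 h1 (by simp)
  · exact (neg_le_neg this).trans (neg_le_abs _)
  · exact fun k hk => (Finset.mem_filter.1 hk).2.le
  · intro k hk
    simp only [Finset.mem_sdiff, Finset.mem_filter, not_and, not_lt] at hk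
    exact hk.2 hk.1

theorem negativity_eq (W : Matrix ι ι ℂ) :
    negativity W =
      -∑ k ∈ (Finset.Icc 1 (Fintype.card ι)).filter (fun k => eigval W k < 0), eigval W k :=
  abs_of_nonpos (Finset.sum_nonpos fun _ hk => (Finset.mem_filter.1 hk).2.le)

/-- Sums of eigenvalues as sums of values of the quadratic form on orthonormal vectors. -/
theorem Matrix.IsHermitian.exists_orthonormal_sum_eigval {W : Matrix ι ι ℂ} (hW : W.IsHermitian)
    {T : Finset ℕ} (hT : T ⊆ Finset.Icc 1 (Fintype.card ι)) :
    ∃ v : T → ι → ℂ, Orthonormal ℂ (fun i => WithLp.toLp 2 (v i)) ∧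
      ∑ k ∈ T, eigval W k = ∑ i, qform W (v i) := by
  obtain ⟨b, hb, -, -, h⟩ := hW.exists_eigenvectors rfl
  refine ⟨fun k => b k, hb.comp_subset hT, ?_⟩
  rw [Finset.sum_coe_sort T (fun k => qform W (b k))]
  exact Finset.sum_congr rfl fun k hk => (qform_eigenvector hb h (hT hk)).symm

theorem Matrix.IsHermitian.exists_eigval_eq_qform {W : Matrix ι ι ℂ} (hW : W.IsHermitian) {k : ℕ}
    (hk : k ∈ Finset.Icc 1 (Fintype.card ι)) :
    ∃ v : ι → ℂ, ‖WithLp.toLp 2 v‖ = 1 ∧ eigval W k = qform W v := by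
  obtain ⟨b, hb, -, -, h⟩ := hW.exists_eigenvectors rfl
  exact ⟨b k, hb.norm_eq_one_of_mem hk, (qform_eigenvector hb h hk).symm⟩

theorem Matrix.IsHermitian.eigval_last_le {W : Matrix ι ι ℂ} (hW : W.IsHermitian) {N : ℕ}
    (hN : Fintype.card ι = N) {v : ι → ℂ} (hv : ‖WithLp.toLp 2 v‖ = 1) :
    eigval W N ≤ qform W v := by
  have hN0 : N ≠ 0 := by
    rintro rfl
    have := Fintype.card_eq_zero_iff.1 hN
    rw [Subsingleton.elim v 0] at hv
    simp at hv
  have := hW.sum_last_eigval_le hN (v := fun _ : Fin 1 => v)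
    ⟨fun _ => hv, fun i j h => absurd (Subsingleton.elim i j) h⟩ (k := N)
    (Nat.one_le_iff_ne_zero.2 hN0) (by simp)
  simpa using this

theorem Matrix.IsHermitian.le_eigval_one {W : Matrix ι ι ℂ} (hW : W.IsHermitian)
    {v : ι → ℂ} (hv : ‖WithLp.toLp 2 v‖ = 1) : qform W v ≤ eigval W 1 := by
  have := hW.le_sum_first_eigval rfl (v := fun _ : Fin 1 => v)
    ⟨fun _ => hv, fun i j h => absurd (Subsingleton.elim i j) h⟩
  simpa using this

end Spectral

/-! ### Algebra of the partial transpose and block positivity. -/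

section PartialTranspose

variable {m n : ℕ}

theorem partialTranspose_add (X Y : BipartiteMatrix m n) :
    partialTranspose (X + Y) = partialTranspose X + partialTranspose Y := rfl

theorem partialTranspose_sub (X Y : BipartiteMatrix m n) :
    partialTranspose (X - Y) = partialTranspose X - partialTranspose Y := rfl

theorem partialTranspose_smul (z : ℂ) (X : BipartiteMatrix m n) :
    partialTranspose (z • X) = z • partialTranspose X := rfl

theorem partialTranspose_zero : partialTranspose (0 : BipartiteMatrix m n) = 0 := rfl

theorem partialTranspose_sum {σ : Type*} (s : Finset σ) (X : σ → BipartiteMatrix m n) :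
    partialTranspose (∑ i ∈ s, X i) = ∑ i ∈ s, partialTranspose (X i) := by
  ext p q
  simp [partialTranspose, Matrix.sum_apply]

theorem partialTranspose_partialTranspose (X : BipartiteMatrix m n) :
    partialTranspose (partialTranspose X) = X := rfl

theorem partialTranspose_one : partialTranspose (1 : BipartiteMatrix m n) = 1 := by
  ext ⟨i, k⟩ ⟨j, l⟩
  simp [partialTranspose, one_apply, eq_comm]

theorem trace_partialTranspose (X : BipartiteMatrix m n) :
    (partialTranspose X).trace = X.trace := rfl

theorem Matrix.IsHermitian.partialTranspose {X : BipartiteMatrix m n} (hX : X.IsHermitian) :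
    (partialTranspose X).IsHermitian := by
  ext p q
  simpa [_root_.partialTranspose] using hX.apply (q.1, p.2) (p.1, q.2)

/-- Partial transposition merely permutes matrix entries, hence is an isometry for the trace inner
product. -/
theorem trace_partialTranspose_mul (X Y : BipartiteMatrix m n) :
    (partialTranspose X * partialTranspose Y).trace = (X * Y).trace := by
  simp only [trace, diag, mul_apply, partialTranspose, of_apply, Fintype.sum_prod_type]
  calc _ = ∑ i, ∑ j, ∑ k, ∑ l, X (j, k) (i, l) * Y (i, l) (j, k) :=
        Finset.sum_congr rfl fun i _ => Finset.sum_comm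
    _ = ∑ j, ∑ i, ∑ k, ∑ l, X (j, k) (i, l) * Y (i, l) (j, k) := Finset.sum_comm
    _ = _ := Finset.sum_congr rfl fun i _ => Finset.sum_comm

/-- Local factors pass through `Γ` at the price of transposing and exchanging those of the first
tensor factor. This is what makes decomposability invariant under local unitaries. -/
theorem kronecker_mul_partialTranspose_mul_kronecker (A C : Matrix (Fin m) (Fin m) ℂ)
    (B D : Matrix (Fin n) (Fin n) ℂ) (X : BipartiteMatrix m n) :
    (A ⊗ₖ B) * partialTranspose X * (C ⊗ₖ D) =
      partialTranspose ((Cᵀ ⊗ₖ B) * X * (Aᵀ ⊗ₖ D)) := by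
  ext ⟨i, k⟩ ⟨j, l⟩
  simp only [mul_apply, partialTranspose, of_apply, kroneckerMap_apply, Fintype.sum_prod_type,
    Finset.sum_mul, transpose_apply]
  calc _ = ∑ x, ∑ y, ∑ z, ∑ t, A i z * B k t * X (x, t) (z, y) * (C x j * D y l) := rfl
    _ = ∑ x, ∑ z, ∑ y, ∑ t, A i z * B k t * X (x, t) (z, y) * (C x j * D y l) :=
        Finset.sum_congr rfl fun x _ => Finset.sum_comm
    _ = ∑ z, ∑ x, ∑ y, ∑ t, A i z * B k t * X (x, t) (z, y) * (C x j * D y l) :=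
        Finset.sum_comm
    _ = ∑ z, ∑ y, ∑ x, ∑ t, A i z * B k t * X (x, t) (z, y) * (C x j * D y l) :=
        Finset.sum_congr rfl fun x _ => Finset.sum_comm
    _ = _ := Finset.sum_congr rfl fun z _ => Finset.sum_congr rfl fun y _ =>
        Finset.sum_congr rfl fun x _ => Finset.sum_congr rfl fun t _ => by ring

/-- The value `⟨v|(|ψ⟩⟨ψ|)^Γ|v⟩` is symmetric in `v` and `ψ`. -/
theorem qform_partialTranspose_ketbra_comm (ψ v : BipartiteVec m n) :
    qform (partialTranspose (ketbra ψ)) v = qform (partialTranspose (ketbra v)) ψ := by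
  simp only [qform, dotProduct, mulVec, partialTranspose, ketbra, vecMulVec_apply, of_apply,
    Fintype.sum_prod_type, Finset.mul_sum, Pi.star_apply]
  congr 1
  calc _ = ∑ i, ∑ j, ∑ k, ∑ l, star (v (i, k)) * (ψ (j, k) * star (ψ (i, l)) * v (j, l)) :=
        Finset.sum_congr rfl fun i _ => Finset.sum_comm
    _ = ∑ i, ∑ j, ∑ l, ∑ k, star (v (i, k)) * (ψ (j, k) * star (ψ (i, l)) * v (j, l)) :=
        Finset.sum_congr rfl fun i _ => Finset.sum_congr rfl fun j _ => Finset.sum_comm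
    _ = ∑ i, ∑ l, ∑ j, ∑ k, star (v (i, k)) * (ψ (j, k) * star (ψ (i, l)) * v (j, l)) :=
        Finset.sum_congr rfl fun i _ => Finset.sum_comm
    _ = _ := Finset.sum_congr rfl fun z _ => Finset.sum_congr rfl fun y _ =>
        Finset.sum_congr rfl fun x _ => Finset.sum_congr rfl fun t _ => by ring

theorem star_tensorVec_dotProduct (a a' : Fin m → ℂ) (b b' : Fin n → ℂ) :
    star (tensorVec a b) ⬝ᵥ tensorVec a' b' = (star a ⬝ᵥ a') * (star b ⬝ᵥ b') := by
  simp only [dotProduct, tensorVec, Fintype.sum_prod_type, Finset.sum_mul_sum, Pi.star_apply,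
    star_mul']
  exact Finset.sum_congr rfl fun i _ => Finset.sum_congr rfl fun j _ => by ring

/-- On product vectors `Γ` amounts to conjugating the first factor. This is why `Q^Γ` is block
positive although it need not be positive semidefinite. -/
theorem qform_partialTranspose_tensorVec (X : BipartiteMatrix m n) (a : Fin m → ℂ) (b : Fin n → ℂ) :
    star (tensorVec a b) ⬝ᵥ partialTranspose X *ᵥ tensorVec a b =
      star (tensorVec (star a) b) ⬝ᵥ X *ᵥ tensorVec (star a) b := by
  simp only [dotProduct, mulVec, partialTranspose, of_apply, tensorVec,
    Fintype.sum_prod_type, Finset.mul_sum, Pi.star_apply, star_mul', star_star]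
  calc _ = ∑ i, ∑ j, ∑ k, ∑ l, star (a i) * star (b k) * (X (j, k) (i, l) * (a j * b l)) :=
        Finset.sum_congr rfl fun i _ => Finset.sum_comm
    _ = ∑ j, ∑ i, ∑ k, ∑ l, star (a i) * star (b k) * (X (j, k) (i, l) * (a j * b l)) :=
        Finset.sum_comm
    _ = ∑ j, ∑ k, ∑ i, ∑ l, star (a i) * star (b k) * (X (j, k) (i, l) * (a j * b l)) :=
        Finset.sum_congr rfl fun i _ => Finset.sum_comm
    _ = _ := Finset.sum_congr rfl fun z _ => Finset.sum_congr rfl fun y _ =>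
        Finset.sum_congr rfl fun x _ => Finset.sum_congr rfl fun t _ => by ring

theorem IsDecomposable.isBlockPositive {W : BipartiteMatrix m n} (hW : IsDecomposable W) :
    IsBlockPositive W := by
  obtain ⟨P, Q, hP, hQ, rfl⟩ := hW
  refine ⟨hP.1.add hQ.1.partialTranspose, fun a b => ?_⟩
  rw [add_mulVec, dotProduct_add, qform_partialTranspose_tensorVec]
  exact add_nonneg (hP.dotProduct_mulVec_nonneg _) (hQ.dotProduct_mulVec_nonneg _)

/-- If no eigenvalue were negative, the spectral resolution would make the form nonnegative; so one
test vector replaces the search for a negative eigenvalue. -/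
theorem mem_normalizedDEW {W : BipartiteMatrix m n} (hW : IsDecomposable W) (ht : W.trace = 1)
    {v : BipartiteVec m n} (hv : qform W v < 0) : W ∈ normalizedDEW m n := by
  refine ⟨⟨hW.isBlockPositive, ?_⟩, hW, ht⟩
  by_contra! h
  obtain ⟨b, hb, -, -, hs⟩ := hW.isBlockPositive.1.exists_eigenvectors rfl
  rw [qform_of_eq_sum hs] at hv
  exact hv.not_ge (Finset.sum_nonneg fun k _ => mul_nonneg (h k) (by positivity))

theorem isDecomposable_partialTranspose {Q : BipartiteMatrix m n} (hQ : Q.PosSemidef) :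
    IsDecomposable (partialTranspose Q) :=
  ⟨0, Q, .zero, hQ, (zero_add _).symm⟩

end PartialTranspose

/-! ### Diagonalization of the partial transpose of a pure state. -/

section Schmidt

/-- The product vector `|b_p^*⟩ ⊗ |c_q⟩`. -/
def crossVec {m n r : ℕ} (b : Fin r → Fin m → ℂ) (c : Fin r → Fin n → ℂ) (p : Fin r × Fin r) :
    BipartiteVec m n :=
  tensorVec (star (b p.1)) (c p.2)

/-- The normalized difference of two product vectors with interchanged labels. -/
noncomputable def asymVec {m n r : ℕ} (b : Fin r → Fin m → ℂ) (c : Fin r → Fin n → ℂ)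
    (p : Fin r × Fin r) : BipartiteVec m n :=
  ((√2 / 2 : ℝ) : ℂ) • (crossVec b c p - crossVec b c p.swap)

/-- The normalized sum of two product vectors with interchanged labels. -/
noncomputable def symVec {m n r : ℕ} (b : Fin r → Fin m → ℂ) (c : Fin r → Fin n → ℂ)
    (p : Fin r × Fin r) : BipartiteVec m n :=
  ((√2 / 2 : ℝ) : ℂ) • (crossVec b c p + crossVec b c p.swap)

/-- The pairs of labels in increasing order. -/
def orderedPairs (r : ℕ) : Finset (Fin r × Fin r) := Finset.univ.filter fun p => p.1 < p.2

theorem mem_orderedPairs {r : ℕ} {p : Fin r × Fin r} : p ∈ orderedPairs r ↔ p.1 < p.2 := by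
  simp [orderedPairs]

theorem sum_eq_diag_add_orderedPairs {r : ℕ} (f : Fin r × Fin r → ℝ) :
    ∑ p, f p = ∑ i, f (i, i) + ∑ p ∈ orderedPairs r, (f p + f p.swap) := by
  classical
  have h1 : ∑ i, f (i, i) = ∑ p ∈ Finset.univ.filter (fun p : Fin r × Fin r => p.1 = p.2), f p := by
    refine Finset.sum_bij (fun i _ => (i, i)) (by simp) (fun a _ b _ h => (Prod.ext_iff.1 h).1)
      ?_ (fun _ _ => rfl)
    rintro ⟨a, b⟩ h
    simp only [Finset.mem_filter, Finset.mem_univ, true_and] at h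
    exact ⟨a, Finset.mem_univ _, by simp [h]⟩
  have h2 : ∑ p ∈ orderedPairs r, f p.swap =
      ∑ p ∈ Finset.univ.filter (fun p : Fin r × Fin r => p.2 < p.1), f p := by
    refine Finset.sum_bij (fun p _ => p.swap) (by simp [orderedPairs])
      (fun a _ b _ h => Prod.swap_injective h) ?_ (fun _ _ => rfl)
    intro p h
    simp only [Finset.mem_filter, Finset.mem_univ, true_and] at h
    exact ⟨p.swap, by simpa [orderedPairs] using h, by simp⟩
  rw [Finset.sum_add_distrib, h1, h2, orderedPairs, Finset.sum_filter, Finset.sum_filter,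
    Finset.sum_filter, ← Finset.sum_add_distrib, ← Finset.sum_add_distrib]
  refine Finset.sum_congr rfl fun p _ => ?_
  rcases lt_trichotomy p.1 p.2 with h | h | h
  · simp [h, h.ne, h.not_gt]
  · simp [h]
  · simp [h, h.ne', h.not_gt]

variable {m n r : ℕ} {b : Fin r → Fin m → ℂ} {c : Fin r → Fin n → ℂ} {s : Fin r → ℝ}
  {ψ : BipartiteVec m n}

/-- The term `|b_i c_i⟩⟨b_j c_j|` becomes `|b_j^* c_i⟩⟨b_i^* c_j|`: on the cross vectors the
operator is a weighted swap of labels, which is the source of the eigenvalues `±s_i s_j`. -/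
theorem partialTranspose_ketbra_of_schmidt (hψ : ψ = ∑ j, (s j : ℂ) • tensorVec (b j) (c j)) :
    partialTranspose (ketbra ψ) = ∑ p : Fin r × Fin r, ((s p.1 * s p.2 : ℝ) : ℂ) •
      vecMulVec (crossVec b c p.swap) (star (crossVec b c p)) := by
  ext ⟨i, k⟩ ⟨j, l⟩
  rw [hψ]
  simp only [partialTranspose, ketbra, of_apply, vecMulVec_apply, Matrix.sum_apply,
    Matrix.smul_apply,
    Pi.star_apply, Finset.sum_apply, Pi.smul_apply, star_sum, Finset.sum_mul_sum,
    Fintype.sum_prod_type, crossVec, tensorVec, smul_eq_mul, star_mul',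
    Complex.star_def, Complex.conj_ofReal, Prod.fst_swap, Prod.snd_swap]
  refine Finset.sum_congr rfl fun p _ => Finset.sum_congr rfl fun q _ => ?_
  push_cast
  simp
  ring

theorem norm_sq_half_sqrt_two_smul (z : ℂ) :
    ‖((√2 / 2 : ℝ) : ℂ) * z‖ ^ 2 = ‖z‖ ^ 2 / 2 := by
  rw [norm_mul, mul_pow, Complex.norm_real, Real.norm_eq_abs, sq_abs, div_pow,
    Real.sq_sqrt (by norm_num)]
  ring

theorem star_asymVec_dotProduct (p : Fin r × Fin r) (v : BipartiteVec m n) :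
    star (asymVec b c p) ⬝ᵥ v = ((√2 / 2 : ℝ) : ℂ) *
      (star (crossVec b c p) ⬝ᵥ v - star (crossVec b c p.swap) ⬝ᵥ v) := by
  rw [asymVec, star_smul, star_sub, smul_dotProduct, sub_dotProduct, Complex.star_def,
    Complex.conj_ofReal, smul_eq_mul]

theorem star_symVec_dotProduct (p : Fin r × Fin r) (v : BipartiteVec m n) :
    star (symVec b c p) ⬝ᵥ v = ((√2 / 2 : ℝ) : ℂ) *
      (star (crossVec b c p) ⬝ᵥ v + star (crossVec b c p.swap) ⬝ᵥ v) := by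
  rw [symVec, star_smul, star_add, smul_dotProduct, add_dotProduct, Complex.star_def,
    Complex.conj_ofReal, smul_eq_mul]

theorem qform_partialTranspose_ketbra (hψ : ψ = ∑ j, (s j : ℂ) • tensorVec (b j) (c j))
    (v : BipartiteVec m n) :
    qform (partialTranspose (ketbra ψ)) v =
      ∑ p : Fin r × Fin r, s p.1 * s p.2 *
        (star (star (crossVec b c p.swap) ⬝ᵥ v) * (star (crossVec b c p) ⬝ᵥ v)).re := by
  rw [partialTranspose_ketbra_of_schmidt hψ, qform_sum]
  refine Finset.sum_congr rfl fun p _ => ?_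
  rw [qform_smul, qform, vecMulVec_mulVec, dotProduct_smul, ← star_dotProduct_comm, op_smul_eq_smul,
    smul_eq_mul, mul_comm (star v ⬝ᵥ _)]

/-- The quadratic form of the partial transpose of a pure state, diagonalized. -/
theorem qform_partialTranspose_ketbra_eq (hψ : ψ = ∑ j, (s j : ℂ) • tensorVec (b j) (c j))
    (v : BipartiteVec m n) :
    qform (partialTranspose (ketbra ψ)) v =
      ∑ i, s i ^ 2 * ‖star (crossVec b c (i, i)) ⬝ᵥ v‖ ^ 2 +
      ∑ p ∈ orderedPairs r, s p.1 * s p.2 *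
        (‖star (symVec b c p) ⬝ᵥ v‖ ^ 2 - ‖star (asymVec b c p) ⬝ᵥ v‖ ^ 2) := by
  rw [qform_partialTranspose_ketbra hψ, sum_eq_diag_add_orderedPairs]
  congr 1
  · refine Finset.sum_congr rfl fun i _ => ?_
    rw [Prod.swap_prod_mk, Complex.star_def, Complex.conj_mul', ← Complex.ofReal_pow,
      Complex.ofReal_re, sq (s i)]
  · refine Finset.sum_congr rfl fun p _ => ?_
    rw [star_symVec_dotProduct, star_asymVec_dotProduct, norm_sq_half_sqrt_two_smul,
      norm_sq_half_sqrt_two_smul, Prod.swap_swap]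
    generalize star (crossVec b c p) ⬝ᵥ v = x
    generalize star (crossVec b c p.swap) ⬝ᵥ v = y
    simp only [← Complex.normSq_eq_norm_sq, Complex.normSq_apply, Complex.mul_re, Complex.star_def,
      Complex.conj_re, Complex.conj_im, Complex.add_re, Complex.add_im, Complex.sub_re,
      Complex.sub_im, Prod.fst_swap, Prod.snd_swap]
    ring

/-- For nonnegative coefficients only the antisymmetric directions contribute negatively; the
diagonal and symmetric terms are dropped. -/
theorem neg_qform_partialTranspose_ketbra_le (hs : ∀ j, 0 ≤ s j)
    (hψ : ψ = ∑ j, (s j : ℂ) • tensorVec (b j) (c j)) (v : BipartiteVec m n) :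
    -qform (partialTranspose (ketbra ψ)) v ≤
      ∑ p ∈ orderedPairs r, s p.1 * s p.2 * ‖star (asymVec b c p) ⬝ᵥ v‖ ^ 2 := by
  rw [qform_partialTranspose_ketbra_eq hψ]
  simp only [mul_sub, Finset.sum_sub_distrib]
  have h1 : 0 ≤ ∑ i, s i ^ 2 * ‖star (crossVec b c (i, i)) ⬝ᵥ v‖ ^ 2 := by positivity
  have h2 : 0 ≤ ∑ p ∈ orderedPairs r, s p.1 * s p.2 * ‖star (symVec b c p) ⬝ᵥ v‖ ^ 2 :=
    Finset.sum_nonneg fun p _ => by have := hs p.1; have := hs p.2; positivity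
  linarith

section Orthonormal

variable (hb : Orthonormal ℂ (fun j => WithLp.toLp 2 (b j)))
  (hc : Orthonormal ℂ (fun j => WithLp.toLp 2 (c j)))

include hb hc

theorem star_crossVec_dotProduct_crossVec (p q : Fin r × Fin r) :
    star (crossVec b c p) ⬝ᵥ crossVec b c q = if p = q then 1 else 0 := by
  rw [crossVec, crossVec, star_tensorVec_dotProduct, star_star, orthonormal_toLp_iff.1 hc,
    dotProduct_comm, orthonormal_toLp_iff.1 hb]
  obtain ⟨i, j⟩ := p
  obtain ⟨k, l⟩ := q
  by_cases h1 : i = k <;> by_cases h2 : j = l <;> simp [h1, h2, eq_comm]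

theorem sum_norm_sq_crossVec_le (v : BipartiteVec m n) :
    ∑ p, ‖star (crossVec b c p) ⬝ᵥ v‖ ^ 2 ≤ ‖WithLp.toLp 2 v‖ ^ 2 :=
  (orthonormal_toLp_iff.2 (star_crossVec_dotProduct_crossVec hb hc)).sum_norm_sq_dotProduct_le v

theorem orthonormal_asymVec :
    Orthonormal ℂ (fun p : orderedPairs r => WithLp.toLp 2 (asymVec b c p)) := by
  rw [orthonormal_toLp_iff]
  rintro ⟨p, hp⟩ ⟨q, hq⟩
  rw [mem_orderedPairs] at hp hq
  rw [star_asymVec_dotProduct, asymVec]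
  simp only [dotProduct_smul, dotProduct_sub, star_crossVec_dotProduct_crossVec hb hc]
  have h1 : p ≠ q.swap := by rintro rfl; exact hp.not_gt hq
  have h2 : p.swap ≠ q := by rintro rfl; exact hp.not_gt hq
  have h3 : ((√2 / 2 : ℝ) : ℂ) * ((√2 / 2 : ℝ) : ℂ) = 1 / 2 := by
    rw [← Complex.ofReal_mul, div_mul_div_comm, Real.mul_self_sqrt (by norm_num)]; norm_num
  by_cases h : p = q
  · subst h
    simp only [h1, h2, if_true, if_false, smul_eq_mul]
    linear_combination 2 * h3
  · have h4 : p.swap ≠ q.swap := fun h' => h (Prod.swap_injective h')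
    simp [h1, h2, h, h4]

theorem partialTranspose_ketbra_mulVec_crossVec
    (hψ : ψ = ∑ j, (s j : ℂ) • tensorVec (b j) (c j)) (p : Fin r × Fin r) :
    partialTranspose (ketbra ψ) *ᵥ crossVec b c p =
      ((s p.1 * s p.2 : ℝ) : ℂ) • crossVec b c p.swap := by
  rw [partialTranspose_ketbra_of_schmidt hψ, sum_mulVec, Finset.sum_eq_single p]
  · rw [smul_mulVec, vecMulVec_mulVec, star_crossVec_dotProduct_crossVec hb hc, if_pos rfl]
    simp
  · intro q _ hq
    rw [smul_mulVec, vecMulVec_mulVec, star_crossVec_dotProduct_crossVec hb hc, if_neg hq]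
    simp
  · simp

theorem qform_crossVec_self (hψ : ψ = ∑ j, (s j : ℂ) • tensorVec (b j) (c j)) (i : Fin r) :
    qform (partialTranspose (ketbra ψ)) (crossVec b c (i, i)) = s i ^ 2 := by
  rw [qform, partialTranspose_ketbra_mulVec_crossVec hb hc hψ, dotProduct_smul, Prod.swap_prod_mk,
    star_crossVec_dotProduct_crossVec hb hc]
  simp [sq]

theorem qform_asymVec (hψ : ψ = ∑ j, (s j : ℂ) • tensorVec (b j) (c j)) {p : Fin r × Fin r}
    (hp : p.1 ≠ p.2) :
    qform (partialTranspose (ketbra ψ)) (asymVec b c p) = -(s p.1 * s p.2) := by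
  have h1 : p ≠ p.swap := fun h => hp (Prod.ext_iff.1 h).1
  have h2 := Real.sq_sqrt (show (0 : ℝ) ≤ 2 by norm_num)
  rw [qform, star_asymVec_dotProduct, asymVec, mulVec_smul, mulVec_sub,
    partialTranspose_ketbra_mulVec_crossVec hb hc hψ,
    partialTranspose_ketbra_mulVec_crossVec hb hc hψ]
  simp only [dotProduct_smul, dotProduct_sub, star_crossVec_dotProduct_crossVec hb hc,
    Prod.swap_swap, h1, h1.symm, if_true, if_false, Prod.fst_swap, Prod.snd_swap, smul_eq_mul]
  simp only [← Complex.ofReal_mul, ← Complex.ofReal_one, ← Complex.ofReal_zero,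
    ← Complex.ofReal_sub, Complex.ofReal_re]
  linear_combination (-(s p.1 * s p.2) / 2) * h2

theorem qform_symVec (hψ : ψ = ∑ j, (s j : ℂ) • tensorVec (b j) (c j)) {p : Fin r × Fin r}
    (hp : p.1 ≠ p.2) :
    qform (partialTranspose (ketbra ψ)) (symVec b c p) = s p.1 * s p.2 := by
  have h1 : p ≠ p.swap := fun h => hp (Prod.ext_iff.1 h).1
  have h2 := Real.sq_sqrt (show (0 : ℝ) ≤ 2 by norm_num)
  rw [qform, star_symVec_dotProduct, symVec, mulVec_smul, mulVec_add,
    partialTranspose_ketbra_mulVec_crossVec hb hc hψ,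
    partialTranspose_ketbra_mulVec_crossVec hb hc hψ]
  simp only [dotProduct_smul, dotProduct_add, star_crossVec_dotProduct_crossVec hb hc,
    Prod.swap_swap, h1, h1.symm, if_true, if_false, Prod.fst_swap, Prod.snd_swap, smul_eq_mul]
  simp only [← Complex.ofReal_mul, ← Complex.ofReal_one, ← Complex.ofReal_zero,
    ← Complex.ofReal_add, Complex.ofReal_re]
  linear_combination ((s p.1 * s p.2) / 2) * h2

theorem norm_sq_of_schmidt (hψ : ψ = ∑ j, (s j : ℂ) • tensorVec (b j) (c j)) :
    ‖WithLp.toLp 2 ψ‖ ^ 2 = ∑ j, s j ^ 2 := by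
  have h : Orthonormal ℂ (fun j => WithLp.toLp 2 (tensorVec (b j) (c j))) := by
    rw [orthonormal_toLp_iff]
    intro i j
    rw [star_tensorVec_dotProduct, orthonormal_toLp_iff.1 hc, orthonormal_toLp_iff.1 hb]
    simp
  have := star_dotProduct_self ψ
  nth_rewrite 1 2 [hψ] at this
  simp only [star_sum, sum_dotProduct, dotProduct_sum, star_smul, smul_dotProduct, dotProduct_smul,
    orthonormal_toLp_iff.1 h] at this
  rw [← Complex.ofReal_inj, ← this]
  simp [sq]

/-- The weights of the negative part of a partial transpose on an orthonormal family. -/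
theorem exists_weights_neg_sum_qform_le {κ : Type*} [Fintype κ] (hs : ∀ j, 0 ≤ s j)
    (hψ : ψ = ∑ j, (s j : ℂ) • tensorVec (b j) (c j)) {v : κ → BipartiteVec m n}
    (hv : Orthonormal ℂ (fun i => WithLp.toLp 2 (v i))) :
    ∃ w : Fin r × Fin r → ℝ, (∀ p ∈ orderedPairs r, 0 ≤ w p) ∧ (∀ p ∈ orderedPairs r, w p ≤ 1) ∧
      ∑ p ∈ orderedPairs r, w p ≤ Fintype.card κ ∧
      -∑ k, qform (partialTranspose (ketbra ψ)) (v k) ≤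
        ∑ p ∈ orderedPairs r, s p.1 * s p.2 * w p := by
  have ho := orthonormal_asymVec hb hc
  refine ⟨fun p => ∑ k, ‖star (asymVec b c p) ⬝ᵥ v k‖ ^ 2, fun _ _ => by positivity,
    fun p hp => ?_, ?_, ?_⟩
  · simp only [norm_star_dotProduct_comm (asymVec b c p)]
    refine (hv.sum_norm_sq_dotProduct_le _).trans ?_
    rw [ho.norm_eq_one_of_mem hp]; norm_num
  · rw [Finset.sum_comm, ← nsmul_one, ← Finset.card_univ]
    refine Finset.sum_le_card_nsmul _ _ _ fun k _ => ?_
    rw [← Finset.sum_coe_sort]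
    refine (ho.sum_norm_sq_dotProduct_le _).trans ?_
    rw [hv.1]; norm_num
  · simp only [Finset.mul_sum]
    rw [← Finset.sum_neg_distrib, Finset.sum_comm]
    exact Finset.sum_le_sum fun k _ => neg_qform_partialTranspose_ketbra_le hs hψ _

/-- Each pair of labels contributes at most `M` times the mean of the two squared overlaps, by the
arithmetic-geometric mean inequality. Swapping labels only permutes these overlaps, so Bessel's
inequality finishes. -/
theorem qform_partialTranspose_ketbra_le {M : ℝ} (hM0 : 0 ≤ M) (hM : ∀ i j, |s i * s j| ≤ M)
    (hψ : ψ = ∑ j, (s j : ℂ) • tensorVec (b j) (c j)) (v : BipartiteVec m n) :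
    qform (partialTranspose (ketbra ψ)) v ≤ M * ‖WithLp.toLp 2 v‖ ^ 2 := by
  rw [qform_partialTranspose_ketbra hψ]
  have hsw : ∑ p : Fin r × Fin r, ‖star (crossVec b c p.swap) ⬝ᵥ v‖ ^ 2 =
      ∑ p : Fin r × Fin r, ‖star (crossVec b c p) ⬝ᵥ v‖ ^ 2 :=
    (Equiv.prodComm (Fin r) (Fin r)).sum_comp fun p => ‖star (crossVec b c p) ⬝ᵥ v‖ ^ 2
  calc _ ≤ ∑ p : Fin r × Fin r, M * ((‖star (crossVec b c p.swap) ⬝ᵥ v‖ ^ 2 +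
          ‖star (crossVec b c p) ⬝ᵥ v‖ ^ 2) / 2) := by
        refine Finset.sum_le_sum fun p _ => ?_
        refine (le_abs_self _).trans ?_
        rw [abs_mul]
        refine mul_le_mul (hM _ _) ?_ (abs_nonneg _) hM0
        refine (Complex.abs_re_le_norm _).trans ?_
        rw [norm_mul, norm_star]
        nlinarith [sq_nonneg (‖star (crossVec b c p.swap) ⬝ᵥ v‖ - ‖star (crossVec b c p) ⬝ᵥ v‖)]
    _ = M * ∑ p, ‖star (crossVec b c p) ⬝ᵥ v‖ ^ 2 := by
        rw [← Finset.mul_sum, ← Finset.sum_div, Finset.sum_add_distrib, hsw, add_self_div_two]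
    _ ≤ _ := mul_le_mul_of_nonneg_left (sum_norm_sq_crossVec_le hb hc v) hM0

end Orthonormal

end Schmidt

/-! ### Existence of the Schmidt decomposition. -/

theorem sum_Icc_one_eq_sum_fin {M : Type*} [AddCommMonoid M] (N : ℕ) (f : ℕ → M) :
    ∑ k ∈ Finset.Icc 1 N, f k = ∑ j : Fin N, f (j + 1) := by
  rw [Fin.sum_univ_eq_sum_range (fun k => f (k + 1)), Finset.range_eq_Ico, Finset.sum_Ico_add' f]
  rfl

/-- Orthogonal vectors, scaled to unit length and completed to an orthonormal family. -/
theorem exists_orthonormal_of_orthogonal {n r : ℕ} (hr : r ≤ n) (t : Fin r → Fin n → ℂ)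
    (ht : ∀ i j, i ≠ j → star (t i) ⬝ᵥ t j = 0) :
    ∃ c : Fin r → Fin n → ℂ, Orthonormal ℂ (fun j => WithLp.toLp 2 (c j)) ∧
      ∀ j, t j = (‖WithLp.toLp 2 (t j)‖ : ℂ) • c j := by
  classical
  let S : Set (Fin r) := {j | t j ≠ 0}
  let e : Fin r → EuclideanSpace ℂ (Fin n) := fun j =>
    ((‖WithLp.toLp 2 (t j)‖⁻¹ : ℝ) : ℂ) • WithLp.toLp 2 (t j)
  -- The family is padded to `n` vectors so that a partial orthonormal family extends to a basis
  -- indexed by the same labels. Where `t j = 0` any basis vector serves, since the required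
  -- coefficient is zero.
  let v : Fin n → EuclideanSpace ℂ (Fin n) := fun k => if h : (k : ℕ) < r then e ⟨k, h⟩ else 0
  have hv : ∀ j : Fin r, v (Fin.castLE hr j) = e j := fun j => by simp [v]
  have hon : Orthonormal ℂ ((Fin.castLE hr '' S).domRestrict v) := by
    rw [orthonormal_iff_ite]
    intro x y
    obtain ⟨i, hi, hx⟩ := x.2
    obtain ⟨j, hj, hy⟩ := y.2
    have hxy : x = y ↔ i = j := by
      rw [Subtype.ext_iff, ← hx, ← hy, (Fin.castLE_injective hr).eq_iff]
    rw [Set.domRestrict_apply, Set.domRestrict_apply, ← hx, ← hy, hv, hv]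
    simp only [e, inner_smul_left, inner_smul_right, inner_toLp_eq, hxy, Complex.conj_ofReal]
    by_cases hij : i = j
    · subst hij
      have hi' : t i ≠ 0 := hi
      have h0 : ‖WithLp.toLp 2 (t i)‖ ≠ 0 := by simpa using hi'
      rw [star_dotProduct_self, if_pos rfl, ← Complex.ofReal_mul, ← Complex.ofReal_mul,
        ← Complex.ofReal_one]
      congr 1
      field_simp
    · rw [ht i j hij, if_neg hij]; simp
  obtain ⟨B, hB⟩ := hon.exists_orthonormalBasis_extension_of_card_eq (by simp)
  refine ⟨fun j => (B (Fin.castLE hr j)).ofLp, ?_, fun j => ?_⟩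
  · exact B.orthonormal.comp _ (Fin.castLE_injective hr)
  · by_cases hj : t j = 0
    · simp [hj]
    · beta_reduce
      rw [hB _ ⟨j, hj, rfl⟩, hv]
      have h0 : ‖WithLp.toLp 2 (t j)‖ ≠ 0 := by simpa using hj
      simp only [e, WithLp.ofLp_smul, smul_smul]
      rw [← Complex.ofReal_mul, mul_inv_cancel₀ h0]; simp

/-- The Schmidt decomposition, with coefficients in decreasing order. -/
theorem exists_schmidt {m n : ℕ} (hmn : m ≤ n) (ψ : BipartiteVec m n) :
    ∃ (s : Fin m → ℝ) (b : Fin m → Fin m → ℂ) (c : Fin m → Fin n → ℂ),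
      (∀ j, 0 ≤ s j) ∧ Antitone s ∧
      Orthonormal ℂ (fun j => WithLp.toLp 2 (b j)) ∧
      Orthonormal ℂ (fun j => WithLp.toLp 2 (c j)) ∧
      ψ = ∑ j, (s j : ℂ) • tensorVec (b j) (c j) := by
  classical
  let A : Matrix (Fin m) (Fin n) ℂ := of fun i k => ψ (i, k)
  have hH : (A * Aᴴ).IsHermitian := isHermitian_mul_conjTranspose_self A
  have hcard : Fintype.card (Fin m) = m := Fintype.card_fin m
  obtain ⟨u, hu, -, hrec, hW⟩ := hH.exists_eigenvectors hcard
  have hmem : ∀ j : Fin m, (j : ℕ) + 1 ∈ Finset.Icc 1 m := fun j =>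
    Finset.mem_Icc.2 ⟨by omega, j.2⟩
  let b : Fin m → Fin m → ℂ := fun j => u (j + 1)
  have hb : Orthonormal ℂ (fun j => WithLp.toLp 2 (b j)) :=
    hu.comp (fun j : Fin m => (⟨j + 1, hmem j⟩ : Finset.Icc 1 m)) fun i j h => by
      ext; simpa using h
  -- With `b_j` the eigenvectors of `A A^*`, the rows `b_j^* A` are orthogonal and their squared
  -- norms are the eigenvalues. Their norms are the Schmidt coefficients, decreasing because the
  -- eigenvalues are.
  let t : Fin m → Fin n → ℂ := fun j => star (b j) ᵥ* A
  have hev : ∀ j : Fin m, (A * Aᴴ) *ᵥ b j = (eigval (A * Aᴴ) (j + 1) : ℂ) • b j := by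
    intro j
    nth_rewrite 1 [hW]
    rw [sum_mulVec, Finset.sum_eq_single ((j : ℕ) + 1)]
    · rw [smul_mulVec, ketbra_mulVec, hu.dotProduct_of_mem (hmem j) (hmem j)]
      simp [b]
    · intro k hk hkj
      rw [smul_mulVec, ketbra_mulVec, hu.dotProduct_of_mem hk (hmem j), if_neg hkj]
      simp
    · exact fun h => absurd (hmem j) h
  have htt : ∀ i j, star (t i) ⬝ᵥ t j =
      if i = j then (eigval (A * Aᴴ) (i + 1) : ℂ) else 0 := by
    intro i j
    have : star (t i) ⬝ᵥ t j = star (b j) ⬝ᵥ (A * Aᴴ) *ᵥ b i := by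
      simp only [t, star_vecMul, star_star]
      rw [dotProduct_comm, ← mulVec_mulVec, dotProduct_mulVec (star (b j))]
    rw [this, hev, dotProduct_smul, orthonormal_toLp_iff.1 hb]
    by_cases h : i = j <;> simp [h, eq_comm]
  obtain ⟨c, hc, htc⟩ := exists_orthonormal_of_orthogonal hmn t fun i j hij => by
    rw [htt, if_neg hij]
  have hnorm : ∀ j, ‖WithLp.toLp 2 (t j)‖ ^ 2 = eigval (A * Aᴴ) (j + 1) := by
    intro j
    have := htt j j
    rw [star_dotProduct_self, if_pos rfl] at this
    exact_mod_cast this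
  refine ⟨fun j => ‖WithLp.toLp 2 (t j)‖, b, c, fun j => norm_nonneg _, fun i j hij => ?_, hb, hc,
    ?_⟩
  · refine le_of_sq_le_sq ?_ (norm_nonneg _)
    rw [hnorm, hnorm]
    exact eigval_antitone hH (by omega) (by simpa using hij) (by rw [hcard]; exact j.2)
  · ext ⟨i, k⟩
    have h1 : ∀ j, (‖WithLp.toLp 2 (t j)‖ : ℂ) * c j k = t j k := fun j => by
      conv_rhs => rw [htc j]
      simp
    -- Expanding column `k` of `A` in the basis `b` gives the coefficients `t j k`.
    have h2 := congrFun (hrec fun i => ψ (i, k)) i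
    rw [← h2, sum_Icc_one_eq_sum_fin, Finset.sum_apply, Finset.sum_apply]
    refine Finset.sum_congr rfl fun j _ => ?_
    simp only [Pi.smul_apply, tensorVec, smul_eq_mul]
    rw [mul_left_comm, h1, mul_comm]
    rfl

/-! ### Optimization over Schmidt coefficients and weights. -/

section PureBounds

variable {r : ℕ} {s : Fin r → ℝ} {w : Fin r × Fin r → ℝ}

theorem mul_le_half_of_sum_sq (hs1 : ∑ j, s j ^ 2 = 1) {p : Fin r × Fin r} (hp : p.1 ≠ p.2) :
    s p.1 * s p.2 ≤ 1 / 2 := by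
  have h := Finset.sum_le_univ_sum_of_nonneg (s := {p.1, p.2}) (fun j => sq_nonneg (s j))
  rw [Finset.sum_pair hp, hs1] at h
  nlinarith [sq_nonneg (s p.1 - s p.2)]

theorem sum_orderedPairs_mul (s : Fin r → ℝ) :
    ∑ p ∈ orderedPairs r, s p.1 * s p.2 = ((∑ j, s j) ^ 2 - ∑ j, s j ^ 2) / 2 := by
  have h := sum_eq_diag_add_orderedPairs fun p : Fin r × Fin r => s p.1 * s p.2
  have h1 : ∑ p : Fin r × Fin r, s p.1 * s p.2 = (∑ j, s j) ^ 2 := by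
    rw [sq, Finset.sum_mul_sum, Fintype.sum_prod_type]
  have h2 : ∑ p ∈ orderedPairs r, (s p.1 * s p.2 + s p.swap.1 * s p.swap.2) =
      2 * ∑ p ∈ orderedPairs r, s p.1 * s p.2 := by
    rw [Finset.mul_sum]
    exact Finset.sum_congr rfl fun p _ => by simp only [Prod.fst_swap, Prod.snd_swap]; ring
  simp only [← sq] at h
  rw [h1, h2] at h
  linarith

/-- Cauchy–Schwarz gives `(∑ s_j)² ≤ r`. -/
theorem sum_orderedPairs_mul_le (hs1 : ∑ j, s j ^ 2 = 1) :
    ∑ p ∈ orderedPairs r, s p.1 * s p.2 ≤ ((r : ℝ) - 1) / 2 := by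
  have h := sq_sum_le_card_mul_sum_sq (s := Finset.univ) (f := s)
  rw [hs1, Finset.card_univ, Fintype.card_fin] at h
  rw [sum_orderedPairs_mul, hs1]
  linarith

variable (hs0 : ∀ j, 0 ≤ s j) (hs1 : ∑ j, s j ^ 2 = 1)
  (hw0 : ∀ p ∈ orderedPairs r, 0 ≤ w p) (hw1 : ∀ p ∈ orderedPairs r, w p ≤ 1)

include hs1 hw0 in
theorem weighted_sum_le_half (hw : ∑ p ∈ orderedPairs r, w p ≤ 1) :
    ∑ p ∈ orderedPairs r, s p.1 * s p.2 * w p ≤ 1 / 2 := by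
  calc _ ≤ ∑ p ∈ orderedPairs r, 1 / 2 * w p := Finset.sum_le_sum fun p hp =>
        mul_le_mul_of_nonneg_right (mul_le_half_of_sum_sq hs1 (mem_orderedPairs.1 hp).ne)
          (hw0 p hp)
    _ ≤ _ := by rw [← Finset.mul_sum]; linarith

include hs0 hs1 hw1 in
theorem weighted_sum_le_max :
    ∑ p ∈ orderedPairs r, s p.1 * s p.2 * w p ≤ ((r : ℝ) - 1) / 2 :=
  (Finset.sum_le_sum fun p hp => mul_le_of_le_one_right (mul_nonneg (hs0 _) (hs0 _))
    (hw1 p hp)).trans (sum_orderedPairs_mul_le hs1)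

include hw0 hw1 in
theorem weighted_sum_le_of_threshold {T : Finset (Fin r × Fin r)} (hT : T ⊆ orderedPairs r)
    (hw : ∑ p ∈ orderedPairs r, w p ≤ T.card) {t : ℝ} (ht : 0 ≤ t)
    (htT : ∀ p ∈ T, t ≤ s p.1 * s p.2)
    (hTt : ∀ p ∈ orderedPairs r, p ∉ T → s p.1 * s p.2 ≤ t) :
    ∑ p ∈ orderedPairs r, s p.1 * s p.2 * w p ≤ ∑ p ∈ T, s p.1 * s p.2 := by
  have := sum_le_sum_mul_of_threshold hT (f := fun p => -(s p.1 * s p.2)) (w := w) (-t)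
    (fun p hp => neg_le_neg (htT p hp))
    (fun p hp => neg_le_neg (hTt p (Finset.mem_sdiff.1 hp).1 (Finset.mem_sdiff.1 hp).2))
    hw0 hw1 (by nlinarith)
  simp only [neg_mul, Finset.sum_neg_distrib] at this
  linarith

include hs0 hs1 hw0 hw1 in
-- For decreasing `s` the two largest products are `s_0 s_1` and `s_0 s_2`. Their sum is at most
-- `s_0 √(2(1 - s_0²)) ≤ √2/2`.
theorem weighted_sum_le_two (hr : 3 ≤ r) (hs : Antitone s)
    (hw : ∑ p ∈ orderedPairs r, w p ≤ 2) :
    ∑ p ∈ orderedPairs r, s p.1 * s p.2 * w p ≤ √2 / 2 := by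
  let i0 : Fin r := ⟨0, by omega⟩
  let i1 : Fin r := ⟨1, by omega⟩
  let i2 : Fin r := ⟨2, by omega⟩
  have h01 : s i1 ≤ s i0 := hs (Fin.mk_le_mk.2 (by norm_num))
  have h12 : s i2 ≤ s i1 := hs (Fin.mk_le_mk.2 (by norm_num))
  have hne : (i0, i1) ≠ (i0, i2) := by simp [i1, i2]
  have hsq : s i0 ^ 2 + (s i1 ^ 2 + s i2 ^ 2) ≤ 1 := by
    rw [← hs1, ← Finset.sum_pair (f := fun j => s j ^ 2) (show i1 ≠ i2 by simp [i1, i2]),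
      ← Finset.sum_insert (f := fun j => s j ^ 2) (show i0 ∉ {i1, i2} by simp [i0, i1, i2])]
    exact Finset.sum_le_univ_sum_of_nonneg fun j => sq_nonneg (s j)
  refine (weighted_sum_le_of_threshold hw0 hw1 (T := {(i0, i1), (i0, i2)}) (t := s i0 * s i2)
    ?_ ?_ (mul_nonneg (hs0 _) (hs0 _)) ?_ ?_).trans ?_
  · intro p hp
    simp only [Finset.mem_insert, Finset.mem_singleton] at hp
    rw [mem_orderedPairs]
    rcases hp with rfl | rfl <;> simp [i0, i1, i2, Fin.lt_def]
  · rw [Finset.card_pair hne]; exact_mod_cast hw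
  · intro p hp
    simp only [Finset.mem_insert, Finset.mem_singleton] at hp
    rcases hp with rfl | rfl
    · exact mul_le_mul_of_nonneg_left h12 (hs0 _)
    · exact le_rfl
  · rintro ⟨p, q⟩ hp hpT
    rw [mem_orderedPairs] at hp
    simp only [Finset.mem_insert, Finset.mem_singleton, Prod.mk.injEq, not_or, i0, i1, i2,
      Fin.ext_iff, Fin.lt_def] at hp hpT
    exact mul_le_mul (hs (Fin.le_def.2 (Nat.zero_le _)))
      (hs (Fin.le_def.2 (show 2 ≤ (q : ℕ) by omega))) (hs0 _) (hs0 _)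
  · rw [Finset.sum_pair hne]
    refine le_of_sq_le_sq ?_ (by positivity)
    rw [div_pow, Real.sq_sqrt (by norm_num)]
    simp only
    -- After squaring: `(s_1 + s_2)² ≤ 2(s_1² + s_2²) ≤ 2(1 - s_0²)` and `s_0²(1 - s_0²) ≤ 1/4`.
    nlinarith [mul_nonneg (sq_nonneg (s i0)) (sq_nonneg (s i1 - s i2)), sq_nonneg (s i0 ^ 2 - 1/2),
      mul_nonneg (sq_nonneg (s i0)) (sub_nonneg.2 hsq)]

include hs0 hs1 hw0 hw1 in
-- The two largest products are `s_0 s_1` and `s_0 s_2`; the third is `s_1 s_2` or `s_0 s_3`,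
-- whichever is larger. The first choice gives `s_0 s_1 + s_0 s_2 + s_1 s_2 ≤ s_0² + s_1² + s_2² ≤
-- 1`, the second gives `s_0 (s_1 + s_2 + s_3)`, also at most `1`.
theorem weighted_sum_le_three (hr : 3 ≤ r) (hs : Antitone s)
    (hw : ∑ p ∈ orderedPairs r, w p ≤ 3) :
    ∑ p ∈ orderedPairs r, s p.1 * s p.2 * w p ≤ 1 := by
  let i0 : Fin r := ⟨0, by omega⟩
  let i1 : Fin r := ⟨1, by omega⟩
  let i2 : Fin r := ⟨2, by omega⟩
  have h01 : s i1 ≤ s i0 := hs (Fin.mk_le_mk.2 (by norm_num))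
  have h12 : s i2 ≤ s i1 := hs (Fin.mk_le_mk.2 (by norm_num))
  by_cases hc : ∀ h : 3 < r, s i0 * s ⟨3, h⟩ ≤ s i1 * s i2
  · have hsq : s i0 ^ 2 + (s i1 ^ 2 + s i2 ^ 2) ≤ 1 := by
      rw [← hs1, ← Finset.sum_pair (f := fun j => s j ^ 2) (show i1 ≠ i2 by simp [i1, i2]),
        ← Finset.sum_insert (f := fun j => s j ^ 2) (show i0 ∉ {i1, i2} by simp [i0, i1, i2])]
      exact Finset.sum_le_univ_sum_of_nonneg fun j => sq_nonneg (s j)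
    have hne1 : (i0, i1) ∉ ({(i0, i2), (i1, i2)} : Finset _) := by simp [i0, i1, i2]
    have hne2 : (i0, i2) ≠ (i1, i2) := by simp [i0, i1]
    refine (weighted_sum_le_of_threshold hw0 hw1 (T := {(i0, i1), (i0, i2), (i1, i2)})
      (t := s i1 * s i2) ?_ ?_ (mul_nonneg (hs0 _) (hs0 _)) ?_ ?_).trans ?_
    · intro p hp
      simp only [Finset.mem_insert, Finset.mem_singleton] at hp
      rw [mem_orderedPairs]
      rcases hp with rfl | rfl | rfl <;> simp [i0, i1, i2, Fin.lt_def]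
    · rw [Finset.card_insert_of_notMem hne1, Finset.card_pair hne2]; exact_mod_cast hw
    · intro p hp
      simp only [Finset.mem_insert, Finset.mem_singleton] at hp
      rcases hp with rfl | rfl | rfl
      · exact mul_le_mul h01 h12 (hs0 _) (hs0 _) |>.trans (by simp)
      · exact mul_le_mul_of_nonneg_right h01 (hs0 _)
      · exact le_rfl
    · rintro ⟨p, q⟩ hp hpT
      rw [mem_orderedPairs] at hp
      simp only [Finset.mem_insert, Finset.mem_singleton, Prod.mk.injEq, not_or, i0, i1, i2,
        Fin.ext_iff, Fin.lt_def] at hp hpT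
      have hq3 : 3 ≤ (q : ℕ) := by omega
      refine le_trans ?_ (hc (by omega))
      exact mul_le_mul (hs (Fin.le_def.2 (by simp [i0]))) (hs (Fin.le_def.2 (by simpa))) (hs0 _)
        (hs0 _)
    · rw [Finset.sum_insert hne1, Finset.sum_pair hne2]
      simp only
      nlinarith [sq_nonneg (s i0 - s i1), sq_nonneg (s i0 - s i2), sq_nonneg (s i1 - s i2)]
  · push Not at hc
    obtain ⟨h3, hc⟩ := hc
    let i3 : Fin r := ⟨3, h3⟩
    have h23 : s i3 ≤ s i2 := hs (Fin.mk_le_mk.2 (by norm_num))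
    have hsq : s i0 ^ 2 + (s i1 ^ 2 + (s i2 ^ 2 + s i3 ^ 2)) ≤ 1 := by
      rw [← hs1, ← Finset.sum_pair (f := fun j => s j ^ 2) (show i2 ≠ i3 by simp [i3, i2]),
        ← Finset.sum_insert (f := fun j => s j ^ 2) (show i1 ∉ {i2, i3} by simp [i3, i1, i2]),
        ← Finset.sum_insert (f := fun j => s j ^ 2)
          (show i0 ∉ {i1, i2, i3} by simp [i0, i1, i2, i3])]
      exact Finset.sum_le_univ_sum_of_nonneg fun j => sq_nonneg (s j)
    have hne1 : (i0, i1) ∉ ({(i0, i2), (i0, i3)} : Finset _) := by simp [i1, i2, i3]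
    have hne2 : (i0, i2) ≠ (i0, i3) := by simp [i2, i3]
    refine (weighted_sum_le_of_threshold hw0 hw1 (T := {(i0, i1), (i0, i2), (i0, i3)})
      (t := s i0 * s i3) ?_ ?_ (mul_nonneg (hs0 _) (hs0 _)) ?_ ?_).trans ?_
    · intro p hp
      simp only [Finset.mem_insert, Finset.mem_singleton] at hp
      rw [mem_orderedPairs]
      rcases hp with rfl | rfl | rfl <;> simp [i0, i1, i2, i3, Fin.lt_def]
    · rw [Finset.card_insert_of_notMem hne1, Finset.card_pair hne2]; exact_mod_cast hw
    · intro p hp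
      simp only [Finset.mem_insert, Finset.mem_singleton] at hp
      rcases hp with rfl | rfl | rfl
      · exact mul_le_mul_of_nonneg_left (h23.trans h12) (hs0 _)
      · exact mul_le_mul_of_nonneg_left h23 (hs0 _)
      · exact le_rfl
    · rintro ⟨p, q⟩ hp hpT
      rw [mem_orderedPairs] at hp
      simp only [Finset.mem_insert, Finset.mem_singleton, Prod.mk.injEq, not_or, i0, i1, i2, i3,
        Fin.ext_iff, Fin.lt_def] at hp hpT
      by_cases hq3 : 3 ≤ (q : ℕ)
      · exact mul_le_mul (hs (Fin.le_def.2 (by simp [i0]))) (hs (Fin.le_def.2 (by simpa [i3])))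
          (hs0 _) (hs0 _)
      · refine le_trans ?_ hc.le
        exact mul_le_mul (hs (Fin.le_def.2 (show 1 ≤ (p : ℕ) by omega)))
          (hs (Fin.le_def.2 (show 2 ≤ (q : ℕ) by omega))) (hs0 _) (hs0 _)
    · rw [Finset.sum_insert hne1, Finset.sum_pair hne2]
      simp only
      -- The three squares add up to `s_0 (s_1 + s_2 + s_3) ≤ s_0² + (3/4)(s_1² + s_2² + s_3²)`,
      -- which is enough here although it is not sharp.
      nlinarith [sq_nonneg (2 * s i0 - 3 * s i1), sq_nonneg (2 * s i0 - 3 * s i2),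
        sq_nonneg (2 * s i0 - 3 * s i3)]

end PureBounds

/-! ### From pure states to decomposable matrices. -/

section Decomposable

variable {m n : ℕ} {κ : Type*} [Fintype κ]

/-- The largest total weight of the negative part of the partial transpose of a pure state. -/
theorem neg_sum_qform_pure_le (hmn : m ≤ n) {ψ : BipartiteVec m n} (hψ : ‖WithLp.toLp 2 ψ‖ = 1)
    {v : κ → BipartiteVec m n} (hv : Orthonormal ℂ (fun i => WithLp.toLp 2 (v i))) :
    -∑ k, qform (partialTranspose (ketbra ψ)) (v k) ≤ ((m : ℝ) - 1) / 2 ∧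
    (Fintype.card κ ≤ 1 → -∑ k, qform (partialTranspose (ketbra ψ)) (v k) ≤ 1 / 2) ∧
    (3 ≤ m → Fintype.card κ ≤ 2 →
      -∑ k, qform (partialTranspose (ketbra ψ)) (v k) ≤ √2 / 2) ∧
    (3 ≤ m → Fintype.card κ ≤ 3 →
      -∑ k, qform (partialTranspose (ketbra ψ)) (v k) ≤ 1) := by
  obtain ⟨s, b, c, hs0, hs, hb, hc, h⟩ := exists_schmidt hmn ψ
  have hs1 : ∑ j, s j ^ 2 = 1 := by rw [← norm_sq_of_schmidt hb hc h, hψ, one_pow]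
  obtain ⟨w, hw0, hw1, hw, hle⟩ := exists_weights_neg_sum_qform_le hb hc hs0 h hv
  refine ⟨hle.trans (weighted_sum_le_max hs0 hs1 hw1),
    fun hκ => hle.trans (weighted_sum_le_half hs1 hw0 (hw.trans (by exact_mod_cast hκ))),
    fun hm hκ => hle.trans (weighted_sum_le_two hs0 hs1 hw0 hw1 hm hs
      (hw.trans (by exact_mod_cast hκ))),
    fun hm hκ => hle.trans (weighted_sum_le_three hs0 hs1 hw0 hw1 hm hs
      (hw.trans (by exact_mod_cast hκ)))⟩

theorem Matrix.PosSemidef.trace_re_nonneg {ι : Type*} [Fintype ι] {P : Matrix ι ι ℂ}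
    (hP : P.PosSemidef) : 0 ≤ P.trace.re := (Complex.nonneg_iff.1 hP.trace_nonneg).1

theorem Matrix.PosSemidef.eq_zero_of_trace_re {ι : Type*} [Fintype ι] {P : Matrix ι ι ℂ}
    (hP : P.PosSemidef) (h : P.trace.re = 0) : P = 0 := by
  refine hP.trace_eq_zero_iff.1 (Complex.ext h ?_)
  exact (Complex.nonneg_iff.1 hP.trace_nonneg).2.symm

theorem sum_qform_decomposable {P Q : BipartiteMatrix m n} {S : Finset ℕ} {q : ℕ → ℝ}
    {b : ℕ → BipartiteVec m n} (h : Q = ∑ k ∈ S, (q k : ℂ) • ketbra (b k))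
    (v : κ → BipartiteVec m n) :
    ∑ i, qform (P + partialTranspose Q) (v i) = ∑ i, qform P (v i) +
      ∑ k ∈ S, q k * ∑ i, qform (partialTranspose (ketbra (b k))) (v i) := by
  simp only [qform_add, Finset.sum_add_distrib, Finset.mul_sum]
  congr 1
  rw [Finset.sum_comm]
  refine Finset.sum_congr rfl fun i _ => ?_
  rw [h, partialTranspose_sum, qform_sum]
  exact Finset.sum_congr rfl fun k _ => by rw [partialTranspose_smul, qform_smul]

/-- A bound for partial transposes of pure states extends to decomposable matrices. -/
theorem neg_sum_qform_le {P Q : BipartiteMatrix m n} (hP : P.PosSemidef) (hQ : Q.PosSemidef)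
    (htr : (P + partialTranspose Q).trace = 1) (v : κ → BipartiteVec m n) {C : ℝ} (hC : 0 ≤ C)
    (hpure : ∀ ψ : BipartiteVec m n, ‖WithLp.toLp 2 ψ‖ = 1 →
      -∑ k, qform (partialTranspose (ketbra ψ)) (v k) ≤ C) :
    -∑ k, qform (P + partialTranspose Q) (v k) ≤ C := by
  obtain ⟨b, hb, -, -, h⟩ := hQ.1.exists_eigenvectors rfl
  have hPt := hP.trace_re_nonneg
  have ht : ∑ k ∈ Finset.Icc 1 (Fintype.card (Fin m × Fin n)), eigval Q k ≤ 1 := by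
    have h1 := congrArg Complex.re htr
    rw [trace_add, trace_partialTranspose, trace_of_eq_sum hb h, Complex.add_re, Complex.ofReal_re,
      Complex.one_re] at h1
    linarith
  rw [sum_qform_decomposable h, neg_add, ← Finset.sum_neg_distrib (f := fun k => eigval Q k * _)]
  have h1 : 0 ≤ ∑ k, qform P (v k) := Finset.sum_nonneg fun k _ => hP.qform_nonneg _
  have h2 : ∑ k ∈ Finset.Icc 1 (Fintype.card (Fin m × Fin n)),
      -(eigval Q k * ∑ i, qform (partialTranspose (ketbra (b k))) (v i)) ≤
      ∑ k ∈ Finset.Icc 1 (Fintype.card (Fin m × Fin n)), eigval Q k * C :=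
    Finset.sum_le_sum fun k hk => by
      rw [← mul_neg]
      exact mul_le_mul_of_nonneg_left (hpure _ (hb.norm_eq_one_of_mem hk)) (hQ.eigval_nonneg k)
  rw [← Finset.sum_mul] at h2
  nlinarith

/-- The case of equality in `neg_sum_qform_le`. -/
theorem eq_of_neg_sum_qform_eq {P Q : BipartiteMatrix m n} (hP : P.PosSemidef)
    (hQ : Q.PosSemidef) (htr : (P + partialTranspose Q).trace = 1) (v : κ → BipartiteVec m n)
    {C : ℝ} (hC : 0 < C)
    (hpure : ∀ ψ : BipartiteVec m n, ‖WithLp.toLp 2 ψ‖ = 1 →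
      -∑ k, qform (partialTranspose (ketbra ψ)) (v k) ≤ C)
    (heq : -∑ k, qform (P + partialTranspose Q) (v k) = C)
    {N : ℕ} {b : ℕ → BipartiteVec m n}
    (hb : Orthonormal ℂ (fun k : Finset.Icc 1 N => WithLp.toLp 2 (b k)))
    (h : Q = ∑ k ∈ Finset.Icc 1 N, (eigval Q k : ℂ) • ketbra (b k)) :
    P = 0 ∧ ∀ k ∈ Finset.Icc 1 N, eigval Q k ≠ 0 →
      -∑ i, qform (partialTranspose (ketbra (b k))) (v i) = C := by
  have hPt := hP.trace_re_nonneg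
  have ht : P.trace.re + ∑ k ∈ Finset.Icc 1 N, eigval Q k = 1 := by
    have h1 := congrArg Complex.re htr
    rwa [trace_add, trace_partialTranspose, trace_of_eq_sum hb h, Complex.add_re,
      Complex.ofReal_re, Complex.one_re] at h1
  rw [sum_qform_decomposable h] at heq
  have h1 : 0 ≤ ∑ k, qform P (v k) := Finset.sum_nonneg fun k _ => hP.qform_nonneg _
  have h0 : ∀ k ∈ Finset.Icc 1 N, 0 ≤
      eigval Q k * (C + ∑ i, qform (partialTranspose (ketbra (b k))) (v i)) := fun k hk =>
    mul_nonneg (hQ.eigval_nonneg k) (by linarith [hpure _ (hb.norm_eq_one_of_mem hk)])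
  have h2 := Finset.sum_nonneg h0
  have h3 : ∑ k ∈ Finset.Icc 1 N,
      eigval Q k * (C + ∑ i, qform (partialTranspose (ketbra (b k))) (v i)) =
      (∑ k ∈ Finset.Icc 1 N, eigval Q k) * C +
      ∑ k ∈ Finset.Icc 1 N, eigval Q k * ∑ i, qform (partialTranspose (ketbra (b k))) (v i) := by
    rw [Finset.sum_mul, ← Finset.sum_add_distrib]
    exact Finset.sum_congr rfl fun k _ => mul_add _ _ _
  -- Attaining `C > 0` needs the eigenvalues of `Q` to add up to at least `1`, which leaves no trace
  -- for `P`.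
  have hP0 : P.trace.re = 0 := by nlinarith
  refine ⟨hP.eq_zero_of_trace_re hP0, fun k hk hk0 => ?_⟩
  have h4 : ∑ k ∈ Finset.Icc 1 N,
      eigval Q k * (C + ∑ i, qform (partialTranspose (ketbra (b k))) (v i)) = 0 := by
    rw [h3]; nlinarith
  have h5 := (Finset.sum_eq_zero_iff_of_nonneg h0).1 h4 k hk
  linarith [(mul_eq_zero.1 h5).resolve_left hk0]

variable {W : BipartiteMatrix m n}

theorem IsDecomposable.neg_sum_qform_le (hW : IsDecomposable W) (htr : W.trace = 1)
    (v : κ → BipartiteVec m n) {C : ℝ} (hC : 0 ≤ C)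
    (hpure : ∀ ψ : BipartiteVec m n, ‖WithLp.toLp 2 ψ‖ = 1 →
      -∑ k, qform (partialTranspose (ketbra ψ)) (v k) ≤ C) :
    -∑ k, qform W (v k) ≤ C := by
  obtain ⟨P, Q, hP, hQ, rfl⟩ := hW
  exact _root_.neg_sum_qform_le hP hQ htr v hC hpure

theorem card_prod_fin : Fintype.card (Fin m × Fin n) = m * n := by simp

/-- Lower bounds for sums of eigenvalues of decomposable matrices. -/
theorem IsDecomposable.neg_sum_eigval_le (hW : IsDecomposable W) (htr : W.trace = 1)
    (hm : 1 ≤ m) (hmn : m ≤ n) {T : Finset ℕ} (hT : T ⊆ Finset.Icc 1 (m * n)) :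
    -∑ k ∈ T, eigval W k ≤ ((m : ℝ) - 1) / 2 ∧
    (T.card ≤ 1 → -∑ k ∈ T, eigval W k ≤ 1 / 2) ∧
    (3 ≤ m → T.card ≤ 2 → -∑ k ∈ T, eigval W k ≤ √2 / 2) ∧
    (3 ≤ m → T.card ≤ 3 → -∑ k ∈ T, eigval W k ≤ 1) := by
  rw [← card_prod_fin] at hT
  obtain ⟨v, hv, h⟩ := hW.isBlockPositive.1.exists_orthonormal_sum_eigval hT
  have hc : Fintype.card T = T.card := Fintype.card_coe T
  have hm' : (1 : ℝ) ≤ m := by exact_mod_cast hm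
  rw [h, ← hc]
  exact ⟨hW.neg_sum_qform_le htr v (by linarith) fun ψ hψ => (neg_sum_qform_pure_le hmn hψ hv).1,
    fun hκ => hW.neg_sum_qform_le htr v (by norm_num) fun ψ hψ =>
      (neg_sum_qform_pure_le hmn hψ hv).2.1 hκ,
    fun hm3 hκ => hW.neg_sum_qform_le htr v (by positivity) fun ψ hψ =>
      (neg_sum_qform_pure_le hmn hψ hv).2.2.1 hm3 hκ,
    fun hm3 hκ => hW.neg_sum_qform_le htr v (by norm_num) fun ψ hψ =>
      (neg_sum_qform_pure_le hmn hψ hv).2.2.2 hm3 hκ⟩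

theorem negativity_le_of_mem (hW : W ∈ normalizedDEW m n) (hm : 1 ≤ m) (hmn : m ≤ n) :
    negativity W ≤ ((m : ℝ) - 1) / 2 := by
  rw [negativity_eq, card_prod_fin]
  exact (hW.2.1.neg_sum_eigval_le hW.2.2 hm hmn (Finset.filter_subset _ _)).1

theorem Matrix.PosSemidef.sum_qform_le {ι : Type*} [Fintype ι] {P : Matrix ι ι ℂ}
    (hP : P.PosSemidef) {v : κ → ι → ℂ} (hv : Orthonormal ℂ (fun i => WithLp.toLp 2 (v i))) :
    ∑ i, qform P (v i) ≤ P.trace.re := by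
  classical
  obtain ⟨w, -, h1, -, h⟩ := hP.1.exists_weights rfl hv
  rw [h, hP.1.sum_eigval rfl, Complex.ofReal_re]
  exact Finset.sum_le_sum fun k hk => mul_le_of_le_one_right (hP.eigval_nonneg k) (h1 k hk)

theorem one_div_two_add_two_sqrt_two : 1 / (2 + 2 * √2) = (√2 - 1) / 2 := by
  have h := Real.sq_sqrt (show (0 : ℝ) ≤ 2 by norm_num)
  rw [div_eq_div_iff (by positivity) (by norm_num)]
  linear_combination -2 * h

/-- For `m = 2`, the two largest values of the partial transpose of a pure state. -/
theorem sum_qform_pure_le_of_two {n : ℕ} (hn : 2 ≤ n) {ψ : BipartiteVec 2 n}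
    (hψ : ‖WithLp.toLp 2 ψ‖ = 1) {v : κ → BipartiteVec 2 n}
    (hv : Orthonormal ℂ (fun i => WithLp.toLp 2 (v i))) (hκ : Fintype.card κ = 2) :
    ∑ k, qform (partialTranspose (ketbra ψ)) (v k) ≤ (1 + √2) / 2 := by
  obtain ⟨s, b, c, hs0, hs, hb, hc, h⟩ := exists_schmidt hn ψ
  have hs1 : s 0 ^ 2 + s 1 ^ 2 = 1 := by
    rw [← Fin.sum_univ_two (fun j => s j ^ 2), ← norm_sq_of_schmidt hb hc h, hψ, one_pow]
  have h01 : s 1 ≤ s 0 := hs (Fin.zero_le 1)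
  have ho : orderedPairs 2 = {(0, 1)} := by decide
  -- For `s_0 ≥ s_1` every direction orthogonal to `b_0^* ⊗ c_0` has value at most `s_0 s_1`. By
  -- Bessel's inequality the excess `s_0² - s_0 s_1` is counted at most once over the family, so the
  -- total is at most `s_0² + s_0 s_1`.
  have hq : ∀ k, qform (partialTranspose (ketbra ψ)) (v k) ≤
      (s 0 ^ 2 - s 0 * s 1) * ‖star (v k) ⬝ᵥ crossVec b c (0, 0)‖ ^ 2 + s 0 * s 1 := by
    intro k
    have hsum := sum_norm_sq_crossVec_le hb hc (v k)
    rw [hv.1, one_pow, sum_eq_diag_add_orderedPairs, ho, Finset.sum_singleton,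
      Fin.sum_univ_two] at hsum
    have hpar : ‖star (crossVec b c (0, 1)) ⬝ᵥ v k‖ ^ 2 +
        ‖star (crossVec b c (Prod.swap (0, 1))) ⬝ᵥ v k‖ ^ 2 =
        ‖star (symVec b c (0, 1)) ⬝ᵥ v k‖ ^ 2 + ‖star (asymVec b c (0, 1)) ⬝ᵥ v k‖ ^ 2 := by
      rw [star_symVec_dotProduct, star_asymVec_dotProduct, norm_sq_half_sqrt_two_smul,
        norm_sq_half_sqrt_two_smul]
      have := parallelogram_law_with_norm ℝ (star (crossVec b c (0, 1)) ⬝ᵥ v k)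
        (star (crossVec b c (Prod.swap (0, 1))) ⬝ᵥ v k)
      linarith
    rw [hpar] at hsum
    rw [qform_partialTranspose_ketbra_eq h, ho, Finset.sum_singleton, Fin.sum_univ_two,
      norm_star_dotProduct_comm (v k)]
    have e0 := sq_nonneg ‖star (crossVec b c (0, 0)) ⬝ᵥ v k‖
    have e1 := sq_nonneg ‖star (crossVec b c (1, 1)) ⬝ᵥ v k‖
    have e2 := sq_nonneg ‖star (symVec b c (0, 1)) ⬝ᵥ v k‖
    have e3 := sq_nonneg ‖star (asymVec b c (0, 1)) ⬝ᵥ v k‖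
    have h1 : 0 ≤ s 0 * s 1 := mul_nonneg (hs0 _) (hs0 _)
    have h2 : 0 ≤ s 1 * (s 0 - s 1) := mul_nonneg (hs0 _) (by linarith)
    simp only
    nlinarith [mul_nonneg h1 e3, mul_nonneg h2 e1, mul_nonneg h1 (sub_nonneg.2 hsum)]
  have hbes := hv.sum_norm_sq_dotProduct_le (crossVec b c (0, 0))
  rw [(orthonormal_toLp_iff.2 (star_crossVec_dotProduct_crossVec hb hc)).1, one_pow] at hbes
  have htot := Finset.sum_le_sum fun k (_ : k ∈ Finset.univ) => hq k
  rw [Finset.sum_add_distrib, ← Finset.mul_sum, Finset.sum_const, Finset.card_univ, hκ,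
    nsmul_eq_mul] at htot
  have h3 : 0 ≤ s 0 ^ 2 - s 0 * s 1 := by nlinarith [hs0 0]
  refine htot.trans ?_
  -- With `s = (cos θ, sin θ)` this is `cos 2θ + sin 2θ ≤ √2`; moreover `s_0² + s_0 s_1 = (1 + cos
  -- 2θ + sin 2θ)/2`.
  have h4 : (s 0 ^ 2 - s 1 ^ 2) + 2 * (s 0 * s 1) ≤ √2 := by
    refine Real.le_sqrt_of_sq_le ?_
    have : (s 0 ^ 2 - s 1 ^ 2) ^ 2 + (2 * (s 0 * s 1)) ^ 2 = 1 := by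
      linear_combination (s 0 ^ 2 + s 1 ^ 2 + 1) * hs1
    nlinarith [sq_nonneg ((s 0 ^ 2 - s 1 ^ 2) - 2 * (s 0 * s 1))]
  have h5 := mul_le_mul_of_nonneg_left hbes h3
  push_cast
  linarith

theorem sum_first_eigval {n : ℕ} (hn : 2 ≤ n) {W : BipartiteMatrix 2 n}
    (hH : W.IsHermitian) (ht : W.trace = 1) :
    ∑ i ∈ Finset.Icc 1 2, eigval W i + ∑ i ∈ Finset.Icc 3 (2 * n), eigval W i = 1 := by
  have h1 := hH.sum_eigval card_prod_fin
  rw [ht, ← Finset.sum_sdiff (Finset.Icc_subset_Icc le_rfl (by omega) :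
    Finset.Icc 1 2 ⊆ Finset.Icc 1 (2 * n)),
    show Finset.Icc 1 (2 * n) \ Finset.Icc 1 2 = Finset.Icc 3 (2 * n) by
      ext; simp only [Finset.mem_sdiff, Finset.mem_Icc]; omega] at h1
  rw [add_comm]
  exact_mod_cast h1.symm

/-- For `m = 2`, the sum of all but the two largest eigenvalues. -/
theorem IsDecomposable.le_sum_eigval_of_two {n : ℕ} (hn : 2 ≤ n) {W : BipartiteMatrix 2 n}
    (hW : IsDecomposable W) (htr : W.trace = 1) :
    -(1 / (2 + 2 * √2)) ≤ ∑ i ∈ Finset.Icc 3 (2 * n), eigval W i := by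
  have hH := hW.isBlockPositive.1
  have hT : Finset.Icc 1 2 ⊆ Finset.Icc 1 (Fintype.card (Fin 2 × Fin n)) :=
    Finset.Icc_subset_Icc le_rfl (by rw [card_prod_fin]; omega)
  obtain ⟨v, hv, h⟩ := hH.exists_orthonormal_sum_eigval hT
  have hsum := sum_first_eigval hn hH htr
  have hcard : Fintype.card (Finset.Icc 1 2) = 2 := by simp
  obtain ⟨P, Q, hP, hQ, rfl⟩ := hW
  obtain ⟨b, hb, -, -, hQs⟩ := hQ.1.exists_eigenvectors rfl
  have ht := congrArg Complex.re htr
  rw [trace_add, trace_partialTranspose, trace_of_eq_sum hb hQs, Complex.add_re,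
    Complex.ofReal_re, Complex.one_re] at ht
  rw [sum_qform_decomposable hQs] at h
  have h1 := hP.sum_qform_le hv
  have h2 : ∑ k ∈ Finset.Icc 1 (Fintype.card (Fin 2 × Fin n)),
      eigval Q k * ∑ i, qform (partialTranspose (ketbra (b k))) (v i) ≤
      ∑ k ∈ Finset.Icc 1 (Fintype.card (Fin 2 × Fin n)), eigval Q k * ((1 + √2) / 2) :=
    Finset.sum_le_sum fun k hk => mul_le_mul_of_nonneg_left
      (sum_qform_pure_le_of_two hn (hb.norm_eq_one_of_mem hk) hv hcard) (hQ.eigval_nonneg k)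
  rw [← Finset.sum_mul] at h2
  -- The part `P` adds at most `tr P`, which this constant dominates; thus the pure-state bound also
  -- holds for mixtures with `P`.
  have h3 : 1 ≤ (1 + √2) / 2 := by linarith [Real.one_le_sqrt.2 (show (1 : ℝ) ≤ 2 by norm_num)]
  have h4 := mul_le_mul_of_nonneg_left h3 hP.trace_re_nonneg
  rw [one_div_two_add_two_sqrt_two]
  nlinarith

end Decomposable

/-! ### Bounds on `tr W²`, `λ_1` and the negativity, and the case `tr W² = 1`. -/

section Range

variable {m n : ℕ} {W : BipartiteMatrix m n}

theorem eigval_last_neg (hW : W ∈ normalizedDEW m n) : eigval W (m * n) < 0 := by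
  obtain ⟨⟨hB, k, hk⟩, -, -⟩ := hW
  have hmem : k ∈ Finset.Icc 1 (Fintype.card (Fin m × Fin n)) := by
    by_contra h
    exact hk.ne (eigval_eq_zero_of_notMem h)
  rw [card_prod_fin, Finset.mem_Icc] at hmem
  exact (eigval_antitone hB.1 hmem.1 hmem.2 card_prod_fin.ge).trans_lt hk

theorem sum_eigval_of_mem (hW : W ∈ normalizedDEW m n) :
    ∑ k ∈ Finset.Icc 1 (m * n), eigval W k = 1 := by
  have := hW.1.1.1.sum_eigval card_prod_fin
  rw [hW.2.2] at this
  exact_mod_cast this.symm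

theorem one_lt_sum_eigval_of_mem (hm : 2 ≤ m) (hmn : m ≤ n) (hW : W ∈ normalizedDEW m n) :
    1 < ∑ k ∈ Finset.Icc 1 (m * n - 1), eigval W k := by
  have hN : m * n - 1 + 1 = m * n :=
    Nat.sub_add_cancel (Nat.mul_pos (by omega : 0 < m) (by omega : 0 < n))
  have h := sum_eigval_of_mem hW
  rw [← hN, Finset.sum_Icc_succ_top (by omega), hN] at h
  linarith [eigval_last_neg hW]

theorem cast_mul_sub_one (hm : 2 ≤ m) (hmn : m ≤ n) :
    ((m * n - 1 : ℕ) : ℝ) = (m : ℝ) * n - 1 ∧ (0 : ℝ) < (m : ℝ) * n - 1 := by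
  have h : 2 * 2 ≤ m * n := Nat.mul_le_mul hm (hm.trans hmn)
  have h' : ((2 * 2 : ℕ) : ℝ) ≤ ((m * n : ℕ) : ℝ) := Nat.cast_le.2 h
  push_cast at h'
  refine ⟨?_, by linarith⟩
  rw [Nat.cast_sub (by omega)]
  push_cast; ring

/-- Cauchy–Schwarz over the `mn - 1` largest eigenvalues, whose sum exceeds `1`. -/
theorem lt_trace_sq_of_mem (hm : 2 ≤ m) (hmn : m ≤ n) (hW : W ∈ normalizedDEW m n) :
    1 / ((m : ℝ) * n - 1) < (W ^ 2).trace.re := by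
  obtain ⟨hc, hpos⟩ := cast_mul_sub_one hm hmn
  have hN : m * n - 1 + 1 = m * n :=
    Nat.sub_add_cancel (Nat.mul_pos (by omega : 0 < m) (by omega : 0 < n))
  have h := sq_sum_le_card_mul_sum_sq (s := Finset.Icc 1 (m * n - 1)) (f := eigval W)
  rw [Nat.card_Icc, Nat.add_sub_cancel, hc] at h
  have h1 := one_lt_sum_eigval_of_mem hm hmn hW
  have h2 := eigval_last_neg hW
  rw [hW.1.1.1.sum_eigval_sq card_prod_fin, ← hN, Finset.sum_Icc_succ_top (by omega), hN,
    div_lt_iff₀ hpos]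
  nlinarith [mul_pos hpos (mul_pos_of_neg_of_neg h2 h2)]

theorem lt_eigval_one_of_mem (hm : 2 ≤ m) (hmn : m ≤ n) (hW : W ∈ normalizedDEW m n) :
    1 / ((m : ℝ) * n - 1) < eigval W 1 := by
  obtain ⟨hc, hpos⟩ := cast_mul_sub_one hm hmn
  have h : ∑ k ∈ Finset.Icc 1 (m * n - 1), eigval W k ≤
      (Finset.Icc 1 (m * n - 1)).card • eigval W 1 :=
    Finset.sum_le_card_nsmul _ _ _ fun k hk => by
      rw [Finset.mem_Icc] at hk
      exact eigval_antitone hW.1.1.1 le_rfl hk.1 (by rw [card_prod_fin]; omega)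
  rw [Nat.card_Icc, Nat.add_sub_cancel, nsmul_eq_mul, hc] at h
  rw [div_lt_iff₀ hpos]
  linarith [one_lt_sum_eigval_of_mem hm hmn hW]

theorem trace_sq_re_nonneg {ι : Type*} [Fintype ι] [DecidableEq ι] {X : Matrix ι ι ℂ}
    (hX : X.IsHermitian) : 0 ≤ (X * X).trace.re := by
  rw [← sq, hX.sum_eigval_sq rfl]
  positivity

theorem eq_zero_of_trace_sq_re {ι : Type*} [Fintype ι] [DecidableEq ι] {X : Matrix ι ι ℂ}
    (hX : X.IsHermitian) (h : (X * X).trace.re = 0) : X = 0 := by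
  have h1 : (X * Xᴴ).PosSemidef := posSemidef_self_mul_conjTranspose X
  rw [hX.eq] at h1
  have h2 := h1.eq_zero_of_trace_re h
  nth_rewrite 2 [← hX.eq] at h2
  exact self_mul_conjTranspose_eq_zero.1 h2

theorem Matrix.PosSemidef.trace_sq_le {ι : Type*} [Fintype ι] [DecidableEq ι] {P : Matrix ι ι ℂ}
    (hP : P.PosSemidef) : (P * P).trace.re ≤ P.trace.re ^ 2 := by
  rw [← sq, hP.1.sum_eigval_sq rfl, hP.1.sum_eigval rfl, Complex.ofReal_re]
  exact Finset.sum_sq_le_sq_sum_of_nonneg fun k _ => hP.eigval_nonneg k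

theorem trace_sq_smul_sub_smul {ι : Type*} [Fintype ι] [DecidableEq ι] (P R : Matrix ι ι ℂ)
    (p q : ℝ) :
    (((q : ℂ) • P - (p : ℂ) • R) * ((q : ℂ) • P - (p : ℂ) • R)).trace.re =
      q ^ 2 * (P * P).trace.re - 2 * p * q * (P * R).trace.re + p ^ 2 * (R * R).trace.re := by
  simp only [sub_mul, mul_sub, trace_sub, smul_mul_smul_comm, trace_smul, trace_mul_comm R P,
    ← Complex.ofReal_mul, smul_eq_mul, Complex.sub_re, Complex.re_ofReal_mul]
  ring

theorem trace_add_sq {ι : Type*} [Fintype ι] [DecidableEq ι] (P R : Matrix ι ι ℂ) :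
    ((P + R) ^ 2).trace.re =
      (P * P).trace.re + (R * R).trace.re + 2 * (P * R).trace.re := by
  simp only [sq, add_mul, mul_add, trace_add, trace_mul_comm R P, Complex.add_re]
  ring

/-- Put `p = tr P`, `q = tr Q`, `R = Q^Γ`. From `tr (qP - pR)² ≥ 0`, `tr P² ≤ p²` and `tr R² = tr Q²
≤ q²` follows `tr PR ≤ pq`, hence `tr W² ≤ (p + q)² = 1`. Equality with `p, q > 0` forces `qP = pR`,
which makes `W` positive, contrary to a negative value of the form. -/
theorem trace_sq_of_decomposable {P Q : BipartiteMatrix m n} (hP : P.PosSemidef)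
    (hQ : Q.PosSemidef) (htr : (P + partialTranspose Q).trace = 1) :
    ((P + partialTranspose Q) ^ 2).trace.re ≤ 1 ∧
    (((P + partialTranspose Q) ^ 2).trace.re = 1 →
      (∃ v, qform (P + partialTranspose Q) v < 0) → P = 0 ∧ (Q ^ 2).trace.re = 1) := by
  set R := partialTranspose Q with hR
  have hp := hP.trace_re_nonneg
  have hq := hQ.trace_re_nonneg
  have ht : P.trace.re + Q.trace.re = 1 := by
    have h1 := congrArg Complex.re htr
    rwa [trace_add, hR, trace_partialTranspose, Complex.add_re, Complex.one_re] at h1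
  have ha := hP.trace_sq_le
  have hb := hQ.trace_sq_le
  have hbR : (R * R).trace.re = (Q * Q).trace.re := by rw [hR, trace_partialTranspose_mul]
  have hX := trace_sq_smul_sub_smul P R P.trace.re Q.trace.re
  have hXh : ((Q.trace.re : ℂ) • P - (P.trace.re : ℂ) • R).IsHermitian := by
    refine (IsHermitian.smul hP.1 ?_).sub (IsHermitian.smul hQ.1.partialTranspose ?_) <;>
    exact Complex.conj_ofReal _
  have hX0 := trace_sq_re_nonneg hXh
  rw [trace_add_sq, hbR]
  rw [hbR] at hX
  rcases hp.eq_or_lt with hp0 | hp0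
  · have hP0 := hP.eq_zero_of_trace_re hp0.symm
    have hq1 : Q.trace.re = 1 := by linarith
    rw [hq1] at hb
    rw [hP0, sq]
    simp only [zero_mul, trace_zero, Complex.zero_re]
    exact ⟨by linarith, fun h _ => ⟨trivial, by linarith⟩⟩
  rcases hq.eq_or_lt with hq0 | hq0
  · have hQ0 := hQ.eq_zero_of_trace_re hq0.symm
    have hp1 : P.trace.re = 1 := by linarith
    rw [hp1] at ha
    rw [hR, hQ0, partialTranspose_zero]
    simp only [mul_zero, trace_zero, Complex.zero_re, add_zero]
    exact ⟨by linarith, fun _ ⟨v, hv⟩ => absurd (hP.qform_nonneg v) hv.not_ge⟩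
  have hpq := mul_pos hp0 hq0
  have hd : (P * R).trace.re ≤ P.trace.re * Q.trace.re := by
    have h1 := mul_le_mul_of_nonneg_left ha (sq_nonneg Q.trace.re)
    have h2 := mul_le_mul_of_nonneg_left hb (sq_nonneg P.trace.re)
    nlinarith
  have hsq : P.trace.re ^ 2 + Q.trace.re ^ 2 + 2 * (P.trace.re * Q.trace.re) = 1 := by
    linear_combination (P.trace.re + Q.trace.re + 1) * ht
  refine ⟨by linarith, fun h ⟨v, hv⟩ => ?_⟩
  have ha' : (P * P).trace.re = P.trace.re ^ 2 := by linarith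
  have hb' : (Q * Q).trace.re = Q.trace.re ^ 2 := by linarith
  have hd' : (P * R).trace.re = P.trace.re * Q.trace.re := by linarith
  have hz := eq_zero_of_trace_sq_re hXh (by rw [hX, ha', hb', hd']; ring)
  have hz' : qform ((Q.trace.re : ℂ) • P - (P.trace.re : ℂ) • R) v = 0 := by
    rw [hz]; simp [qform]
  rw [qform_sub, qform_smul, qform_smul] at hz'
  rw [qform_add] at hv
  nlinarith [hP.qform_nonneg v]

theorem trace_sq_le_one_of_mem (hW : W ∈ normalizedDEW m n) : (W ^ 2).trace.re ≤ 1 := by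
  obtain ⟨-, ⟨P, Q, hP, hQ, rfl⟩, ht⟩ := hW
  exact (trace_sq_of_decomposable hP hQ ht).1

/-- `λ_1² + λ_mn² ≤ tr W² ≤ 1` with `λ_mn ≠ 0`. -/
theorem eigval_one_lt_one_of_mem (hm : 2 ≤ m) (hmn : m ≤ n) (hW : W ∈ normalizedDEW m n) :
    eigval W 1 < 1 := by
  by_contra! h
  have h1 := trace_sq_le_one_of_mem hW
  have h2 := eigval_last_neg hW
  have hN : 2 * 2 ≤ m * n := Nat.mul_le_mul hm (hm.trans hmn)
  rw [hW.1.1.1.sum_eigval_sq card_prod_fin] at h1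
  have h3 : ∑ k ∈ {1, m * n}, eigval W k ^ 2 ≤ ∑ k ∈ Finset.Icc 1 (m * n), eigval W k ^ 2 := by
    refine Finset.sum_le_sum_of_subset_of_nonneg ?_ fun _ _ _ => sq_nonneg _
    intro k hk
    simp only [Finset.mem_insert, Finset.mem_singleton] at hk
    rw [Finset.mem_Icc]; omega
  rw [Finset.sum_pair (by omega)] at h3
  nlinarith

theorem negativity_pos_of_mem (hm : 2 ≤ m) (hmn : m ≤ n) (hW : W ∈ normalizedDEW m n) :
    0 < negativity W := by
  have h := eigval_last_neg hW
  obtain ⟨v, hv, h'⟩ := hW.1.1.1.exists_eigval_eq_qform (k := m * n) (by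
    rw [card_prod_fin, Finset.mem_Icc]
    have := Nat.mul_pos (by omega : 0 < m) (by omega : 0 < n); omega)
  have := hW.1.1.1.neg_sum_qform_le_negativity (v := fun _ : Fin 1 => v)
    ⟨fun _ => hv, fun i j h => absurd (Subsingleton.elim i j) h⟩
  simp only [Finset.univ_unique, Finset.sum_const, Finset.card_singleton, one_smul] at this
  linarith

theorem partialTranspose_kronecker (A : Matrix (Fin m) (Fin m) ℂ) (B : Matrix (Fin n) (Fin n) ℂ) :
    partialTranspose (A ⊗ₖ B) = Aᵀ ⊗ₖ B := rfl

/-- The Peres criterion: `Γ` turns a product of positive matrices into another such product. -/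
theorem IsSeparableState.posSemidef_partialTranspose {ρ : BipartiteMatrix m n}
    (h : IsSeparableState ρ) : (partialTranspose ρ).PosSemidef := by
  obtain ⟨r, p, v, w, hp, -, -, -, rfl⟩ := h
  rw [partialTranspose_sum]
  refine posSemidef_sum _ fun i _ => ?_
  rw [partialTranspose_smul, partialTranspose_kronecker]
  exact ((ketbra_posSemidef (v i)).transpose.kronecker (ketbra_posSemidef (w i))).smul
    (by exact_mod_cast hp i)

theorem ketbra_tensorVec (a : Fin m → ℂ) (b : Fin n → ℂ) :
    ketbra (tensorVec a b) = ketbra a ⊗ₖ ketbra b := by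
  ext ⟨i, k⟩ ⟨j, l⟩
  simp [ketbra, tensorVec, vecMulVec_apply]
  ring

theorem isSeparableState_ketbra_tensorVec {a : Fin m → ℂ} {b : Fin n → ℂ}
    (ha : ‖WithLp.toLp 2 a‖ = 1) (hb : ‖WithLp.toLp 2 b‖ = 1) :
    IsSeparableState (ketbra (tensorVec a b)) := by
  refine ⟨1, fun _ => 1, fun _ => a, fun _ => b, by simp, by simp, by simpa, by simpa, ?_⟩
  rw [ketbra_tensorVec]; simp

/-- The partial transpose of a pure state with two positive Schmidt coefficients. -/
theorem partialTranspose_ketbra_mem {r : ℕ} {ψ : BipartiteVec m n} {s : Fin r → ℝ}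
    {b : Fin r → Fin m → ℂ} {c : Fin r → Fin n → ℂ} (hψ : ‖WithLp.toLp 2 ψ‖ = 1)
    (hb : Orthonormal ℂ (fun j => WithLp.toLp 2 (b j)))
    (hc : Orthonormal ℂ (fun j => WithLp.toLp 2 (c j)))
    (h : ψ = ∑ j, (s j : ℂ) • tensorVec (b j) (c j)) {i j : Fin r} (hij : i ≠ j)
    (hs : 0 < s i * s j) : partialTranspose (ketbra ψ) ∈ normalizedDEW m n := by
  refine mem_normalizedDEW (isDecomposable_partialTranspose (ketbra_posSemidef ψ)) ?_
    (v := asymVec b c (i, j)) ?_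
  · rw [trace_partialTranspose, trace_ketbra, hψ]; simp
  · rw [qform_asymVec hb hc h hij]; exact neg_neg_of_pos hs

/-- If the second Schmidt coefficient vanished, `ψ` would be a product vector and its projector
separable. -/
theorem partialTranspose_ketbra_mem_of_entangled (hm : 2 ≤ m) (hmn : m ≤ n)
    {ψ : BipartiteVec m n} (hψ : IsPureEntangled ψ) :
    partialTranspose (ketbra ψ) ∈ normalizedDEW m n := by
  obtain ⟨s, b, c, hs0, hs, hb, hc, h⟩ := exists_schmidt hmn ψ
  let i0 : Fin m := ⟨0, by omega⟩
  let i1 : Fin m := ⟨1, by omega⟩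
  have hne : i0 ≠ i1 := by simp [i0, i1]
  by_cases h1 : 0 < s i1
  · exact partialTranspose_ketbra_mem hψ.1 hb hc h hne
      (mul_pos (h1.trans_le (hs (Fin.le_def.2 (Nat.zero_le _)))) h1)
  · have hz : ∀ j, j ≠ i0 → s j = 0 := fun j hj =>
      le_antisymm ((hs (Fin.le_def.2 (show 1 ≤ (j : ℕ) by
        have : (j : ℕ) ≠ 0 := fun h => hj (Fin.ext h)
        omega))).trans (not_lt.1 h1)) (hs0 j)
    have hs1 : ∑ j, s j ^ 2 = 1 := by rw [← norm_sq_of_schmidt hb hc h, hψ.1, one_pow]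
    rw [Finset.sum_eq_single i0 (fun j _ hj => by rw [hz j hj]; norm_num) (by simp)] at hs1
    have hs1' : s i0 = 1 := (pow_eq_one_iff_of_nonneg (hs0 i0) two_ne_zero).1 hs1
    rw [Finset.sum_eq_single i0 (fun j _ hj => by rw [hz j hj]; simp) (by simp), hs1'] at h
    refine absurd ?_ hψ.2
    rw [h, Complex.ofReal_one, one_smul]
    exact isSeparableState_ketbra_tensorVec (hb.1 i0) (hc.1 i0)

theorem trace_sq_partialTranspose_ketbra {ψ : BipartiteVec m n} (hψ : ‖WithLp.toLp 2 ψ‖ = 1) :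
    (partialTranspose (ketbra ψ) ^ 2).trace.re = 1 := by
  rw [sq, trace_partialTranspose_mul, ketbra_mul_self hψ, trace_ketbra, hψ]; simp

theorem trace_sq_eq_one_iff (hm : 2 ≤ m) (hmn : m ≤ n) :
    (W ∈ normalizedDEW m n ∧ (W ^ 2).trace.re = 1) ↔
      ∃ ψ : BipartiteVec m n, IsPureEntangled ψ ∧ W = partialTranspose (ketbra ψ) := by
  constructor
  · rintro ⟨hW, h⟩
    have hneg := eigval_last_neg hW
    obtain ⟨v, -, hv⟩ := hW.1.1.1.exists_eigval_eq_qform (k := m * n) (by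
      rw [card_prod_fin, Finset.mem_Icc]
      have := Nat.mul_pos (by omega : 0 < m) (by omega : 0 < n); omega)
    rw [hv] at hneg
    obtain ⟨-, ⟨P, Q, hP, hQ, rfl⟩, ht⟩ := hW
    obtain ⟨rfl, hQ2⟩ := (trace_sq_of_decomposable hP hQ ht).2 h ⟨v, hneg⟩
    rw [zero_add] at hneg ht ⊢
    obtain ⟨b, hb, -, -, hQs⟩ := hQ.1.exists_eigenvectors rfl
    rw [hQ.1.sum_eigval_sq rfl] at hQ2
    rw [trace_partialTranspose, trace_of_eq_sum hb hQs] at ht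
    have ht' : ∑ k ∈ Finset.Icc 1 (Fintype.card (Fin m × Fin n)), eigval Q k = 1 := by
      exact_mod_cast ht
    have hle : ∀ k ∈ Finset.Icc 1 (Fintype.card (Fin m × Fin n)), eigval Q k ≤ 1 := fun k hk => by
      rw [← ht']; exact Finset.single_le_sum (fun k _ => hQ.eigval_nonneg k) hk
    have h0 : ∀ k ∈ Finset.Icc 1 (Fintype.card (Fin m × Fin n)),
        0 ≤ eigval Q k * (1 - eigval Q k) := fun k hk =>
      mul_nonneg (hQ.eigval_nonneg k) (by linarith [hle k hk])
    -- The eigenvalues of `Q` lie in `[0,1]`, and both they and their squares add up to `1`. Each is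
    -- therefore `0` or `1`, and exactly one is `1`.
    have hs : ∑ k ∈ Finset.Icc 1 (Fintype.card (Fin m × Fin n)),
        eigval Q k * (1 - eigval Q k) = 0 := by
      simp only [mul_sub, mul_one, ← sq, Finset.sum_sub_distrib, ht', hQ2, sub_self]
    have hz := (Finset.sum_eq_zero_iff_of_nonneg h0).1 hs
    obtain ⟨k, hk, hk0⟩ := Finset.exists_ne_zero_of_sum_ne_zero (ht'.trans_ne one_ne_zero)
    have hk1 : eigval Q k = 1 := by
      linarith [(mul_eq_zero.1 (hz k hk)).resolve_left hk0]
    have hrest : ∀ l ∈ Finset.Icc 1 (Fintype.card (Fin m × Fin n)), l ≠ k → eigval Q l = 0 := by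
      have h2 := Finset.add_sum_erase _ (eigval Q) hk
      rw [ht', hk1] at h2
      intro l hl hlk
      exact (Finset.sum_eq_zero_iff_of_nonneg fun k _ => hQ.eigval_nonneg k).1
        (by linarith : ∑ x ∈ (Finset.Icc 1 (Fintype.card (Fin m × Fin n))).erase k, eigval Q x = 0)
        l (Finset.mem_erase.2 ⟨hlk, hl⟩)
    have hQk : Q = ketbra (b k) := by
      rw [hQs, Finset.sum_eq_single k (fun l hl hlk => by rw [hrest l hl hlk]; simp)
        (fun h => absurd hk h), hk1]
      simp
    refine ⟨b k, ⟨hb.norm_eq_one_of_mem hk, fun hsep => ?_⟩, by rw [← hQk]⟩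
    rw [← hQk] at hsep
    exact hneg.not_ge (hsep.posSemidef_partialTranspose.qform_nonneg v)
  · rintro ⟨ψ, hψ, rfl⟩
    exact ⟨partialTranspose_ketbra_mem_of_entangled hm hmn hψ,
      trace_sq_partialTranspose_ketbra hψ.1⟩

end Range

/-! ### Witnesses that fill the ranges. -/

section Examples

variable {m n : ℕ}

theorem orthonormal_single {r m : ℕ} (h : r ≤ m) :
    Orthonormal ℂ (fun j : Fin r => WithLp.toLp 2 (Pi.single (Fin.castLE h j) 1 : Fin m → ℂ)) := by
  rw [orthonormal_toLp_iff]
  intro i j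
  rw [dotProduct_single, Pi.star_apply, Pi.single_apply, mul_one]
  simp only [(Fin.castLE_injective h).eq_iff, eq_comm (a := j)]
  split_ifs <;> simp

theorem exists_state {r : ℕ} (hr : r ≤ m) (hmn : m ≤ n) {s : Fin r → ℝ}
    (hs1 : ∑ j, s j ^ 2 = 1) :
    ∃ (ψ : BipartiteVec m n) (b : Fin r → Fin m → ℂ) (c : Fin r → Fin n → ℂ),
      ‖WithLp.toLp 2 ψ‖ = 1 ∧ Orthonormal ℂ (fun j => WithLp.toLp 2 (b j)) ∧
      Orthonormal ℂ (fun j => WithLp.toLp 2 (c j)) ∧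
      ψ = ∑ j, (s j : ℂ) • tensorVec (b j) (c j) := by
  refine ⟨_, _, _, ?_, orthonormal_single hr, orthonormal_single (hr.trans hmn), rfl⟩
  refine (pow_eq_one_iff_of_nonneg (norm_nonneg _) two_ne_zero).1 ?_
  rw [norm_sq_of_schmidt (orthonormal_single hr) (orthonormal_single (hr.trans hmn)) rfl, hs1]

theorem orderedPairs_two : orderedPairs 2 = {(0, 1)} := by decide

section Two

variable {ψ : BipartiteVec m n} {s : Fin 2 → ℝ} {b : Fin 2 → Fin m → ℂ} {c : Fin 2 → Fin n → ℂ}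
  (hs : ∀ j, 0 ≤ s j)
  (hb : Orthonormal ℂ (fun j => WithLp.toLp 2 (b j)))
  (hc : Orthonormal ℂ (fun j => WithLp.toLp 2 (c j)))
  (h : ψ = ∑ j, (s j : ℂ) • tensorVec (b j) (c j))

include hs hb hc h

theorem eigval_last_of_two (hmn : 1 ≤ m * n) :
    eigval (partialTranspose (ketbra ψ)) (m * n) = -(s 0 * s 1) := by
  have hH := (ketbra_isHermitian ψ).partialTranspose
  have hmem : (0, 1) ∈ orderedPairs 2 := by simp [orderedPairs_two]
  refine le_antisymm ?_ ?_
  · rw [← qform_asymVec hb hc h (p := (0, 1)) (by simp)]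
    exact hH.eigval_last_le card_prod_fin ((orthonormal_asymVec hb hc).norm_eq_one_of_mem hmem)
  · obtain ⟨v, hv, hq⟩ := hH.exists_eigval_eq_qform (k := m * n) (by
      rw [card_prod_fin, Finset.mem_Icc]; omega)
    have h1 := neg_qform_partialTranspose_ketbra_le hs h v
    have h2 := (orthonormal_asymVec hb hc).sum_norm_sq_dotProduct_le v
    rw [Finset.sum_coe_sort (orderedPairs 2) (fun p => ‖star (asymVec b c p) ⬝ᵥ v‖ ^ 2),
      orderedPairs_two, Finset.sum_singleton, hv, one_pow] at h2
    rw [orderedPairs_two, Finset.sum_singleton] at h1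
    rw [hq]
    have := mul_le_of_le_one_right (mul_nonneg (hs 0) (hs 1)) h2
    simp only at h1
    linarith

theorem eigval_one_of_two (h01 : s 1 ≤ s 0) (hmn : 1 ≤ m * n) :
    eigval (partialTranspose (ketbra ψ)) 1 = s 0 ^ 2 := by
  have hH := (ketbra_isHermitian ψ).partialTranspose
  refine le_antisymm ?_ ?_
  · obtain ⟨v, hv, hq⟩ := hH.exists_eigval_eq_qform (k := 1) (by
      rw [card_prod_fin, Finset.mem_Icc]; omega)
    rw [hq]
    have := qform_partialTranspose_ketbra_le hb hc (M := s 0 ^ 2) (sq_nonneg _) ?_ h v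
    · rwa [hv, one_pow, mul_one] at this
    · intro i j
      have hle : ∀ k, s k ≤ s 0 := fun k => by fin_cases k <;> simp [h01]
      rw [abs_of_nonneg (mul_nonneg (hs i) (hs j)), sq]
      exact mul_le_mul (hle i) (hle j) (hs j) (hs 0)
  · rw [← qform_crossVec_self hb hc h 0]
    exact hH.le_eigval_one
      ((orthonormal_toLp_iff.2 (star_crossVec_dotProduct_crossVec hb hc)).1 (0, 0))

end Two

/-- The upper bound uses only that the weights are at most `1`; for the lower bound the
antisymmetric vectors serve as test family. -/
theorem negativity_of_schmidt {r : ℕ} {ψ : BipartiteVec m n} {s : Fin r → ℝ}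
    {b : Fin r → Fin m → ℂ} {c : Fin r → Fin n → ℂ} (hs : ∀ j, 0 ≤ s j)
    (hb : Orthonormal ℂ (fun j => WithLp.toLp 2 (b j)))
    (hc : Orthonormal ℂ (fun j => WithLp.toLp 2 (c j)))
    (h : ψ = ∑ j, (s j : ℂ) • tensorVec (b j) (c j)) :
    negativity (partialTranspose (ketbra ψ)) = ∑ p ∈ orderedPairs r, s p.1 * s p.2 := by
  have hH := (ketbra_isHermitian ψ).partialTranspose
  refine le_antisymm ?_ ?_
  · rw [negativity_eq]
    obtain ⟨v, hv, hq⟩ := hH.exists_orthonormal_sum_eigval (Finset.filter_subset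
      (fun k => eigval (partialTranspose (ketbra ψ)) k < 0) _)
    rw [hq]
    obtain ⟨w, -, hw1, -, hle⟩ := exists_weights_neg_sum_qform_le hb hc hs h hv
    exact hle.trans (Finset.sum_le_sum fun p hp =>
      mul_le_of_le_one_right (mul_nonneg (hs _) (hs _)) (hw1 p hp))
  · refine le_trans (le_of_eq ?_) (hH.neg_sum_qform_le_negativity (orthonormal_asymVec hb hc))
    rw [Finset.sum_coe_sort (orderedPairs r)
      (fun p => qform (partialTranspose (ketbra ψ)) (asymVec b c p)), ← Finset.sum_neg_distrib]
    exact Finset.sum_congr rfl fun p hp => by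
      rw [qform_asymVec hb hc h (mem_orderedPairs.1 hp).ne, neg_neg]

theorem exists_mem_negativity_eq (hm : 2 ≤ m) (hmn : m ≤ n) {y : ℝ} (hy0 : 0 < y)
    (hy1 : y ≤ ((m : ℝ) - 1) / 2) : ∃ W ∈ normalizedDEW m n, negativity W = y := by
  obtain ⟨k, rfl⟩ : ∃ k, m = k + 1 + 1 := ⟨m - 2, by omega⟩
  have hk : (0 : ℝ) ≤ k := Nat.cast_nonneg k
  push_cast at hy1
  -- The negativity of the state with coefficients `√(1 - (m-1)x²), x, …, x`, where `m = k + 2`. It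
  -- runs from `0` at the product state `x = 0` to `(m-1)/2` at `x₀ = 1/√m`, where all coefficients
  -- agree.
  set f : ℝ → ℝ := fun x => ((√(1 - (k + 1) * x ^ 2) + (k + 1) * x) ^ 2 - 1) / 2 with hf
  have hfc : Continuous f := by fun_prop
  set x₀ : ℝ := (√(k + 2))⁻¹ with hx₀
  have hx₀0 : 0 ≤ x₀ := by positivity
  have hx₀s : x₀ ^ 2 * (k + 2) = 1 := by
    rw [hx₀, inv_pow, Real.sq_sqrt (by positivity), inv_mul_cancel₀ (by positivity)]
  have hf0 : f 0 = 0 := by simp [hf]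
  have hf1 : f x₀ = (k + 1) / 2 := by
    have h1 : 1 - ((k : ℝ) + 1) * x₀ ^ 2 = x₀ ^ 2 := by linear_combination -hx₀s
    simp only [hf]
    rw [h1, Real.sqrt_sq hx₀0]
    linear_combination ((k + 2 : ℝ) / 2) * hx₀s
  obtain ⟨x, hx, hfx⟩ := intermediate_value_Icc hx₀0 hfc.continuousOn
    (show y ∈ Set.Icc (f 0) (f x₀) by rw [hf0, hf1]; exact ⟨hy0.le, by linarith⟩)
  have hx2 : x ^ 2 ≤ x₀ ^ 2 := pow_le_pow_left₀ hx.1 hx.2 2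
  have hpos : 0 < 1 - ((k : ℝ) + 1) * x ^ 2 := by
    have h1 : ((k : ℝ) + 1) * x ^ 2 ≤ (k + 1) * x₀ ^ 2 :=
      mul_le_mul_of_nonneg_left hx2 (by positivity)
    have h2 : 0 < x₀ ^ 2 := by positivity
    linarith
  have hx0 : 0 < x := hx.1.lt_of_ne fun h => by
    rw [← h, hf0] at hfx; exact hy0.ne hfx
  let s : Fin (k + 1 + 1) → ℝ := Fin.cons (√(1 - (k + 1) * x ^ 2)) fun _ => x
  have hs0 : ∀ j, 0 ≤ s j := fun j => by
    refine Fin.cases ?_ (fun i => ?_) j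
    · simp [s]
    · simpa [s] using hx0.le
  have hs1 : ∑ j, s j ^ 2 = 1 := by
    rw [Fin.sum_univ_succ]
    simp only [s, Fin.cons_zero, Fin.cons_succ, Finset.sum_const, Finset.card_univ,
      Fintype.card_fin, nsmul_eq_mul, Real.sq_sqrt hpos.le]
    push_cast; ring
  obtain ⟨ψ, b, c, hψ, hb, hc, h⟩ := exists_state (m := k + 1 + 1) le_rfl hmn hs1
  refine ⟨_, partialTranspose_ketbra_mem hψ hb hc h (i := 0) (j := Fin.succ 0)
    (Fin.succ_ne_zero 0).symm ?_, ?_⟩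
  · simp only [s, Fin.cons_zero, Fin.cons_succ]
    exact mul_pos (Real.sqrt_pos.2 hpos) hx0
  · rw [negativity_of_schmidt hs0 hb hc h, sum_orderedPairs_mul, hs1, ← hfx, Fin.sum_univ_succ]
    simp only [s, Fin.cons_zero, Fin.cons_succ, Finset.sum_const, Finset.card_univ,
      Fintype.card_fin, nsmul_eq_mul, hf]
    push_cast; ring

theorem one_le_mul_of_two_le (hm : 2 ≤ m) (hmn : m ≤ n) : 1 ≤ m * n :=
  Nat.mul_pos (by omega) (by omega)

theorem exists_mem_eigval_last_eq (hm : 2 ≤ m) (hmn : m ≤ n) {y : ℝ} (hy0 : y < 0)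
    (hy1 : -(1 / 2) ≤ y) : ∃ W ∈ normalizedDEW m n, eigval W (m * n) = y := by
  have h1 : 0 ≤ 1 - 2 * y := by linarith
  have h2 : 0 ≤ 1 + 2 * y := by linarith
  have e1 := Real.sq_sqrt h1
  have e2 := Real.sq_sqrt h2
  have hlt : √(1 + 2 * y) < √(1 - 2 * y) := Real.sqrt_lt_sqrt h2 (by linarith)
  -- The solution of `s_0² + s_1² = 1`, `s_0 s_1 = -y`, from `(s_0 ± s_1)² = 1 ∓ 2y`.
  let s : Fin 2 → ℝ := ![(√(1 - 2 * y) + √(1 + 2 * y)) / 2, (√(1 - 2 * y) - √(1 + 2 * y)) / 2]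
  have hs0 : ∀ j, 0 ≤ s j := fun j => by
    have := Real.sqrt_nonneg (1 + 2 * y)
    fin_cases j <;> simp [s] <;> linarith
  have hs1 : ∑ j, s j ^ 2 = 1 := by
    rw [Fin.sum_univ_two]
    simp only [s, cons_val_zero, cons_val_one]
    linear_combination (e1 + e2) / 2
  have hs : s 0 * s 1 = -y := by
    simp only [s, cons_val_zero, cons_val_one]
    linear_combination (e1 - e2) / 4
  obtain ⟨ψ, b, c, hψ, hb, hc, h⟩ := exists_state hm hmn hs1
  refine ⟨_, partialTranspose_ketbra_mem hψ hb hc h (i := 0) (j := 1) (by simp)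
    (by rw [hs]; linarith), ?_⟩
  rw [eigval_last_of_two hs0 hb hc h (one_le_mul_of_two_le hm hmn), hs, neg_neg]

/-- All products `s_i s_j` are at most `1`. Consequently `1 - |ψ⟩⟨ψ|` is the partial transpose of a
positive semidefinite matrix. -/
theorem one_sub_partialTranspose_ketbra_posSemidef (hmn : m ≤ n) {ψ : BipartiteVec m n}
    (hψ : ‖WithLp.toLp 2 ψ‖ = 1) : (1 - partialTranspose (ketbra ψ)).PosSemidef := by
  obtain ⟨s, b, c, hs0, hs, hb, hc, h⟩ := exists_schmidt hmn ψ
  have hs1 : ∑ j, s j ^ 2 = 1 := by rw [← norm_sq_of_schmidt hb hc h, hψ, one_pow]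
  refine (isHermitian_one.sub (ketbra_isHermitian ψ).partialTranspose).posSemidef_of_qform
    fun v => ?_
  rw [qform_sub, qform_one]
  have := qform_partialTranspose_ketbra_le hb hc (M := 1) zero_le_one ?_ h v
  · linarith
  · have hle : ∀ k, s k ≤ 1 := fun k => by
      have := Finset.single_le_sum (f := fun j => s j ^ 2) (fun j _ => sq_nonneg _)
        (Finset.mem_univ k)
      rw [hs1] at this
      nlinarith [hs0 k]
    intro i j
    rw [abs_of_nonneg (mul_nonneg (hs0 i) (hs0 j))]
    exact mul_le_one₀ (hle i) (hs0 j) (hle j)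

/-- A segment from the partial transpose of a maximally entangled two-level state to the normalized
projector onto the orthogonal complement of an entangled vector. -/
theorem exists_segment (hm : 2 ≤ m) (hmn : m ≤ n) :
    ∃ W : ℝ → BipartiteMatrix m n,
      (∀ t ∈ Set.Ico (0 : ℝ) 1, W t ∈ normalizedDEW m n) ∧
      (∃ d : ℝ, ∀ t, (W t ^ 2).trace.re = (1 - t) ^ 2 + 2 * (1 - t) * t * d +
        t ^ 2 / ((m : ℝ) * n - 1)) ∧
      ∀ t ∈ Set.Ico (0 : ℝ) 1, eigval (W t) 1 = (1 - t) / 2 + t / ((m : ℝ) * n - 1) := by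
  obtain ⟨-, hK⟩ := cast_mul_sub_one hm hmn
  set K : ℝ := (m : ℝ) * n - 1 with hKdef
  have h2 := Real.sq_sqrt (show (0 : ℝ) ≤ 2 by norm_num)
  let s : Fin 2 → ℝ := fun _ => √2 / 2
  have hs1 : ∑ j, s j ^ 2 = 1 := by
    rw [Fin.sum_univ_two]; simp only [s]; linear_combination h2 / 2
  have hss : √2 / 2 * (√2 / 2) = (1 / 2 : ℝ) := by linear_combination h2 / 4
  obtain ⟨φ, b, c, hφ, hb, hc, h⟩ := exists_state hm hmn hs1
  have hmem : (0, 1) ∈ orderedPairs 2 := by simp [orderedPairs_two]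
  -- An eigenvector of `F` for `-1/2`. Since `R` vanishes on it, mixing in `R` leaves the value at
  -- `a` equal to `-(1-t)/2`, negative for all `t < 1`.
  set a := asymVec b c (0, 1) with ha
  have ha1 : ‖WithLp.toLp 2 a‖ = 1 := (orthonormal_asymVec hb hc).norm_eq_one_of_mem hmem
  set R : BipartiteMatrix m n := 1 - ketbra a with hR
  set F := partialTranspose (ketbra φ) with hF
  have hRh : R.IsHermitian := isHermitian_one.sub (ketbra_isHermitian a)
  have hRtr : R.trace = (K : ℂ) := by
    rw [hR, trace_sub, trace_one, trace_ketbra, ha1, card_prod_fin, hKdef]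
    push_cast; ring
  have hRR : R * R = R := by
    rw [hR, sub_mul, one_mul, mul_sub, mul_one, ketbra_mul_self ha1, sub_self, sub_zero]
  have hFF : (F * F).trace.re = 1 := by rw [← sq]; exact trace_sq_partialTranspose_ketbra hφ
  have hFtr : F.trace = 1 := by rw [hF, trace_partialTranspose, trace_ketbra, hφ]; simp
  let W : ℝ → BipartiteMatrix m n := fun t =>
    ((1 - t : ℝ) : ℂ) • F + ((t / K : ℝ) : ℂ) • R
  have hWmem : ∀ t ∈ Set.Ico (0 : ℝ) 1, W t ∈ normalizedDEW m n := by
    rintro t ⟨ht0, ht1⟩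
    have htK : 0 ≤ t / K := div_nonneg ht0 hK.le
    refine mem_normalizedDEW ⟨0, ((1 - t : ℝ) : ℂ) • ketbra φ +
      ((t / K : ℝ) : ℂ) • (1 - partialTranspose (ketbra a)), .zero,
      ((ketbra_posSemidef φ).smul ?_).add
        ((one_sub_partialTranspose_ketbra_posSemidef hmn ha1).smul ?_), ?_⟩ ?_ (v := a) ?_
    · exact_mod_cast (by linarith : (0 : ℝ) ≤ 1 - t)
    · exact_mod_cast htK
    · rw [zero_add, partialTranspose_add, partialTranspose_smul, partialTranspose_smul,
        partialTranspose_sub, partialTranspose_one, partialTranspose_partialTranspose]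
    · rw [trace_add, trace_smul, trace_smul, hFtr, hRtr, smul_eq_mul, smul_eq_mul,
        ← Complex.ofReal_mul, div_mul_cancel₀ _ hK.ne']
      push_cast; ring
    · rw [qform_add, qform_smul, qform_smul, hF, ha, qform_asymVec hb hc h (by simp), ← ha, hR,
        qform_sub, qform_one, qform_ketbra, star_dotProduct_self, ha1]
      simp only [s, hss]
      norm_num
      linarith
  refine ⟨W, hWmem, ⟨(F * R).trace.re / K, fun t => ?_⟩, ?_⟩
  · have h1 : W t = ((1 - t : ℝ) : ℂ) • F - ((-(t / K) : ℝ) : ℂ) • R := by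
      simp only [W]; push_cast; rw [neg_smul, sub_neg_eq_add]
    rw [h1, sq, trace_sq_smul_sub_smul, hFF, hRR, hRtr, Complex.ofReal_re]
    field_simp
    ring
  · rintro t ⟨ht0, ht1⟩
    have htK : 0 ≤ t / K := div_nonneg ht0 hK.le
    have hH := (hWmem t ⟨ht0, ht1⟩).1.1.1
    have hmn1 := one_le_mul_of_two_le hm hmn
    refine le_antisymm ?_ ?_
    · obtain ⟨v, hv, hq⟩ := hH.exists_eigval_eq_qform (k := 1) (by
        rw [card_prod_fin, Finset.mem_Icc]; omega)
      have h3 := qform_partialTranspose_ketbra_le hb hc (M := 1 / 2) (by norm_num)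
        (fun i j => by simp only [s, hss]; norm_num) h v
      rw [hv, one_pow, mul_one] at h3
      rw [hq, qform_add, qform_smul, qform_smul, hR, qform_sub, qform_one, hv, qform_ketbra]
      have h4 : t / K * (1 ^ 2 - ‖star a ⬝ᵥ v‖ ^ 2) ≤ t / K :=
        mul_le_of_le_one_right htK (by nlinarith [sq_nonneg ‖star a ⬝ᵥ v‖])
      nlinarith
    -- The vector `b_0^* ⊗ c_0` is orthogonal to `a` and attains the maxima `1/2` of `F` and `1` of
    -- `R` simultaneously.
    · have hcross := star_crossVec_dotProduct_crossVec hb hc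
      have he : ‖WithLp.toLp 2 (crossVec b c (0, 0))‖ = 1 := (orthonormal_toLp_iff.2 hcross).1 _
      refine le_trans (le_of_eq ?_) (hH.le_eigval_one he)
      rw [qform_add, qform_smul, qform_smul, hF, qform_crossVec_self hb hc h, hR, qform_sub,
        qform_one, he, qform_ketbra, ha, star_asymVec_dotProduct, hcross, hcross]
      simp only [s, sq (√2 / 2), hss]
      norm_num
      ring

theorem exists_mem_trace_sq_eq (hm : 2 ≤ m) (hmn : m ≤ n) {y : ℝ}
    (hy0 : 1 / ((m : ℝ) * n - 1) < y) (hy1 : y ≤ 1) :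
    ∃ W ∈ normalizedDEW m n, (W ^ 2).trace.re = y := by
  obtain ⟨W, hW, ⟨d, hd⟩, -⟩ := exists_segment hm hmn
  have hc : Continuous fun t => (W t ^ 2).trace.re := by
    simp only [hd]; fun_prop
  have h0 : (W 0 ^ 2).trace.re = 1 := by rw [hd]; ring
  have h1 : (W 1 ^ 2).trace.re = 1 / ((m : ℝ) * n - 1) := by rw [hd]; ring
  obtain ⟨t, ht, hty⟩ := intermediate_value_Icc' zero_le_one hc.continuousOn
    (show y ∈ Set.Icc _ _ by rw [h0, h1]; exact ⟨hy0.le, hy1⟩)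
  -- The endpoint `t = 1` is not a witness; it is excluded because the infimum is only reached
  -- there.
  refine ⟨W t, hW t ⟨ht.1, ht.2.lt_of_ne ?_⟩, hty⟩
  rintro rfl
  exact hy0.ne (h1.symm.trans hty)

/-- Up to `1/2` the segment is used, along which `λ_1` is affine; above `1/2` a state with
coefficients `√y, √(1-y)` has `λ_1 = y`. -/
theorem exists_mem_eigval_one_eq (hm : 2 ≤ m) (hmn : m ≤ n) {y : ℝ}
    (hy0 : 1 / ((m : ℝ) * n - 1) < y) (hy1 : y < 1) :
    ∃ W ∈ normalizedDEW m n, eigval W 1 = y := by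
  rcases le_or_gt y (1 / 2) with hy | hy
  · obtain ⟨W, hW, -, hl⟩ := exists_segment hm hmn
    have hK : 0 < 1 / 2 - 1 / ((m : ℝ) * n - 1) := by linarith
    have ht : (1 / 2 - y) / (1 / 2 - 1 / ((m : ℝ) * n - 1)) ∈ Set.Ico (0 : ℝ) 1 :=
      ⟨div_nonneg (by linarith) hK.le, by rw [div_lt_one hK]; linarith⟩
    refine ⟨_, hW _ ht, ?_⟩
    rw [hl _ ht]
    have h1 := div_mul_cancel₀ (1 / 2 - y) hK.ne'
    linear_combination -h1
  · let s : Fin 2 → ℝ := ![√y, √(1 - y)]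
    have hs0 : ∀ j, 0 ≤ s j := fun j => by fin_cases j <;> simp [s, Real.sqrt_nonneg]
    have e1 := Real.sq_sqrt (show 0 ≤ y by linarith)
    have hs1 : ∑ j, s j ^ 2 = 1 := by
      have e2 := Real.sq_sqrt (show 0 ≤ 1 - y by linarith)
      rw [Fin.sum_univ_two]
      simp only [s, cons_val_zero, cons_val_one]
      linarith
    obtain ⟨ψ, b, c, hψ, hb, hc, h⟩ := exists_state hm hmn hs1
    refine ⟨_, partialTranspose_ketbra_mem hψ hb hc h (i := 0) (j := 1) (by simp) ?_, ?_⟩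
    · exact mul_pos (Real.sqrt_pos.2 (by linarith)) (Real.sqrt_pos.2 (by linarith))
    · rw [eigval_one_of_two hs0 hb hc h (Real.sqrt_le_sqrt (by linarith))
        (one_le_mul_of_two_le hm hmn)]
      exact e1

end Examples

/-! ### The witnesses with smallest eigenvalue `-1/2`. -/

section MinimalEigenvalue

variable {m n : ℕ}

/-- Equality in Cauchy–Schwarz: the vectors differ by a phase, which the projector does not see. -/
theorem ketbra_eq_of_one_le {ι : Type*} [Fintype ι] {a ψ : ι → ℂ} (ha : ‖WithLp.toLp 2 a‖ = 1)
    (hψ : ‖WithLp.toLp 2 ψ‖ = 1) (h : 1 ≤ ‖star a ⬝ᵥ ψ‖) : ketbra ψ = ketbra a := by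
  have hle := norm_inner_le_norm (𝕜 := ℂ) (WithLp.toLp 2 a) (WithLp.toLp 2 ψ)
  have heq : ‖inner ℂ (WithLp.toLp 2 a) (WithLp.toLp 2 ψ)‖ =
      ‖WithLp.toLp 2 a‖ * ‖WithLp.toLp 2 ψ‖ := by
    refine le_antisymm hle ?_
    rw [ha, hψ, inner_toLp_eq, one_mul]
    exact h
  have ha0 : WithLp.toLp 2 a ≠ 0 := norm_ne_zero_iff.1 (by rw [ha]; norm_num)
  have hψ0 : WithLp.toLp 2 ψ ≠ 0 := norm_ne_zero_iff.1 (by rw [hψ]; norm_num)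
  obtain ⟨r, -, hr⟩ := (norm_inner_eq_norm_iff ha0 hψ0).1 heq
  have hr1 : ‖r‖ = 1 := by
    have := congrArg norm hr
    rw [norm_smul, ha, hψ, mul_one] at this
    exact this.symm
  have hr' : ψ = r • a := congrArg WithLp.ofLp hr
  ext i j
  have hrr : r * star r = 1 := by
    rw [Complex.star_def, Complex.mul_conj, Complex.normSq_eq_norm_sq, hr1]; simp
  simp only [hr', ketbra, vecMulVec_apply, Pi.star_apply, Pi.smul_apply, smul_eq_mul, star_mul']
  linear_combination (a i * star (a j)) * hrr

theorem hasSchmidtCoeffs_asymVec {r : ℕ} {b : Fin r → Fin m → ℂ} {c : Fin r → Fin n → ℂ}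
    (hb : Orthonormal ℂ (fun j => WithLp.toLp 2 (b j)))
    (hc : Orthonormal ℂ (fun j => WithLp.toLp 2 (c j))) {i j : Fin r} (hij : i < j) :
    HasSchmidtCoeffs (asymVec b c (i, j)) ![√2 / 2, √2 / 2] := by
  have hb' := orthonormal_toLp_iff.1 hb
  have hc' := orthonormal_toLp_iff.1 hc
  refine ⟨(orthonormal_asymVec hb hc).norm_eq_one_of_mem (mem_orderedPairs.2 hij), fun k => ?_,
    ![star (b i), -star (b j)], ![c j, c i], ?_, ?_, ?_⟩
  · fin_cases k <;> simp
  · rw [orthonormal_toLp_iff]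
    intro k l
    fin_cases k <;> fin_cases l <;>
      simp [dotProduct_comm (b _) (star (b _)), hb', hij.ne, hij.ne']
  · rw [orthonormal_toLp_iff]
    intro k l
    fin_cases k <;> fin_cases l <;> simp [hc', hij.ne, hij.ne']
  · rw [Fin.sum_univ_two, asymVec, smul_sub, sub_eq_add_neg]
    ext p
    simp [crossVec, tensorVec]

/-- If `⟨ψ|(|v⟩⟨v|)^Γ|ψ⟩ = -1/2` then `ψ` is determined by `v` up to a phase. -/
theorem exists_ketbra_eq_of_qform_eq (hm : 2 ≤ m) (hmn : m ≤ n) {v : BipartiteVec m n}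
    (hv : ‖WithLp.toLp 2 v‖ = 1) :
    ∃ a : BipartiteVec m n, HasSchmidtCoeffs a ![√2 / 2, √2 / 2] ∧
      ∀ ψ : BipartiteVec m n, ‖WithLp.toLp 2 ψ‖ = 1 →
        qform (partialTranspose (ketbra ψ)) v = -(1 / 2) → ketbra ψ = ketbra a := by
  obtain ⟨s, b, c, hs0, hs, hb, hc, h⟩ := exists_schmidt hmn v
  have hs1 : ∑ j, s j ^ 2 = 1 := by rw [← norm_sq_of_schmidt hb hc h, hv, one_pow]
  let i0 : Fin m := ⟨0, by omega⟩
  let i1 : Fin m := ⟨1, by omega⟩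
  have h01 : i0 < i1 := Fin.mk_lt_mk.2 (by norm_num)
  have hmem : (i0, i1) ∈ orderedPairs m := mem_orderedPairs.2 h01
  have ho := orthonormal_asymVec hb hc
  refine ⟨asymVec b c (i0, i1), hasSchmidtCoeffs_asymVec hb hc h01, fun ψ hψ hq => ?_⟩
  refine ketbra_eq_of_one_le (ho.norm_eq_one_of_mem hmem) hψ ?_
  -- By the symmetry, `v` rather than `ψ` is decomposed. Then the same `a`, the leading
  -- antisymmetric vector of `v`, serves every `ψ`.
  rw [qform_partialTranspose_ketbra_comm] at hq
  have hle := neg_qform_partialTranspose_ketbra_le hs0 h ψ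
  rw [hq, neg_neg] at hle
  have hbes := ho.sum_norm_sq_dotProduct_le ψ
  rw [Finset.sum_coe_sort (orderedPairs m) (fun p => ‖star (asymVec b c p) ⬝ᵥ ψ‖ ^ 2), hψ,
    one_pow] at hbes
  have hle2 : ∑ p ∈ orderedPairs m, s p.1 * s p.2 * ‖star (asymVec b c p) ⬝ᵥ ψ‖ ^ 2 ≤
      ∑ p ∈ orderedPairs m, s i0 * s i1 * ‖star (asymVec b c p) ⬝ᵥ ψ‖ ^ 2 := by
    refine Finset.sum_le_sum fun p hp => mul_le_mul_of_nonneg_right ?_ (sq_nonneg _)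
    rw [mem_orderedPairs, Fin.lt_def] at hp
    exact mul_le_mul (hs (Fin.le_def.2 (Nat.zero_le _)))
      (hs (Fin.le_def.2 (show 1 ≤ (p.2 : ℕ) by omega))) (hs0 _) (hs0 _)
  rw [← Finset.mul_sum] at hle2
  -- Since `s_0 s_1` is the largest product it must reach `1/2`, so the norm is exhausted by the
  -- first two coefficients and all other products vanish. The overlap of `ψ` with `a` then has to
  -- be full.
  have hprod : 1 / 2 ≤ s i0 * s i1 :=
    (hle.trans hle2).trans (mul_le_of_le_one_right (mul_nonneg (hs0 _) (hs0 _)) hbes)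
  have hprod' := mul_le_half_of_sum_sq hs1 (p := (i0, i1)) h01.ne
  have hz : ∀ j, j ≠ i0 → j ≠ i1 → s j = 0 := by
    intro j hj0 hj1
    have hsq : s i0 ^ 2 + (s i1 ^ 2 + s j ^ 2) ≤ 1 := by
      rw [← hs1, ← Finset.sum_pair (f := fun j => s j ^ 2) hj1.symm,
        ← Finset.sum_insert (f := fun j => s j ^ 2) (show i0 ∉ {i1, j} by
          simp [h01.ne, hj0.symm])]
      exact Finset.sum_le_univ_sum_of_nonneg fun j => sq_nonneg (s j)
    have : s j ^ 2 ≤ 0 := by nlinarith [sq_nonneg (s i0 - s i1)]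
    exact pow_eq_zero_iff two_ne_zero |>.1 (le_antisymm this (sq_nonneg _))
  rw [Finset.sum_eq_single (i0, i1)] at hle
  · have h1 : 1 ≤ ‖star (asymVec b c (i0, i1)) ⬝ᵥ ψ‖ ^ 2 := by
      simp only at hle hprod'
      nlinarith [sq_nonneg ‖star (asymVec b c (i0, i1)) ⬝ᵥ ψ‖]
    exact (one_le_sq_iff₀ (norm_nonneg _)).1 h1
  · rintro ⟨p, q⟩ hp hpq
    rw [mem_orderedPairs, Fin.lt_def] at hp
    rw [hz q, mul_zero, zero_mul]
    · rintro rfl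
      simp [i0] at hp
    · rintro rfl
      simp only [i1] at hp
      exact hpq (Prod.ext (Fin.ext (show (p : ℕ) = 0 by omega)) rfl)
  · exact fun h => absurd hmem h

theorem HasSchmidtCoeffs.eigval_last {ψ : BipartiteVec m n}
    (h : HasSchmidtCoeffs ψ ![√2 / 2, √2 / 2]) (hm : 2 ≤ m) (hmn : m ≤ n) :
    partialTranspose (ketbra ψ) ∈ normalizedDEW m n ∧
      eigval (partialTranspose (ketbra ψ)) (m * n) = -(1 / 2) := by
  obtain ⟨hψ, hs, b, c, hb, hc, h⟩ := h
  refine ⟨partialTranspose_ketbra_mem hψ hb hc h (i := 0) (j := 1) (by simp)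
    (mul_pos (hs _) (hs _)), ?_⟩
  rw [eigval_last_of_two (fun j => (hs j).le) hb hc h (one_le_mul_of_two_le hm hmn)]
  have h2 := Real.sq_sqrt (show (0 : ℝ) ≤ 2 by norm_num)
  simp only [cons_val_zero, cons_val_one]
  linear_combination -h2 / 4

theorem eigval_last_eq_iff (hm : 2 ≤ m) (hmn : m ≤ n) (W : BipartiteMatrix m n) :
    (W ∈ normalizedDEW m n ∧ eigval W (m * n) = -(1 / 2)) ↔
      ∃ ψ : BipartiteVec m n, HasSchmidtCoeffs ψ ![√2 / 2, √2 / 2] ∧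
        W = partialTranspose (ketbra ψ) := by
  constructor
  · rintro ⟨hW, heq⟩
    obtain ⟨v, hv, hq⟩ := hW.1.1.1.exists_eigval_eq_qform (k := m * n) (by
      rw [card_prod_fin, Finset.mem_Icc]
      exact ⟨one_le_mul_of_two_le hm hmn, le_rfl⟩)
    rw [heq] at hq
    obtain ⟨-, ⟨P, Q, hP, hQ, rfl⟩, ht⟩ := hW
    obtain ⟨b, hb, -, -, hQs⟩ := hQ.1.exists_eigenvectors rfl
    have hon : Orthonormal ℂ (fun _ : Fin 1 => WithLp.toLp 2 v) :=
      ⟨fun _ => hv, fun i j h => absurd (Subsingleton.elim i j) h⟩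
    obtain ⟨rfl, hval⟩ := eq_of_neg_sum_qform_eq hP hQ ht (fun _ : Fin 1 => v)
      (by norm_num : (0 : ℝ) < 1 / 2)
      (fun ψ hψ => (neg_sum_qform_pure_le hmn hψ hon).2.1 (by simp))
      (by simp [← hq]) hb hQs
    obtain ⟨a, ha, hψa⟩ := exists_ketbra_eq_of_qform_eq hm hmn hv
    refine ⟨a, ha, ?_⟩
    rw [zero_add] at ht ⊢
    rw [trace_partialTranspose, trace_of_eq_sum hb hQs] at ht
    have hQa : Q = ketbra a := by
      nth_rewrite 1 [hQs]
      rw [← one_smul ℂ (ketbra a), ← ht, Complex.ofReal_sum, Finset.sum_smul]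
      refine Finset.sum_congr rfl fun k hk => ?_
      by_cases hk0 : eigval Q k = 0
      · simp [hk0]
      · have := hval k hk hk0
        simp only [Finset.univ_unique, Finset.sum_const, Finset.card_singleton, one_smul] at this
        rw [hψa _ (hb.norm_eq_one_of_mem hk) (by linarith)]
    rw [hQa]
  · rintro ⟨ψ, hψ, rfl⟩
    exact hψ.eigval_last hm hmn

end MinimalEigenvalue

/-! ### Partial sums of the smallest eigenvalues. -/

section PartialSums

variable {m n r : ℕ}

theorem sum_last_eigval_le_of_schmidt {ψ : BipartiteVec m n} {s : Fin r → ℝ}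
    {b : Fin r → Fin m → ℂ} {c : Fin r → Fin n → ℂ}
    (hb : Orthonormal ℂ (fun j => WithLp.toLp 2 (b j)))
    (hc : Orthonormal ℂ (fun j => WithLp.toLp 2 (c j)))
    (h : ψ = ∑ j, (s j : ℂ) • tensorVec (b j) (c j)) {T : Finset (Fin r × Fin r)}
    (hT : T ⊆ orderedPairs r) {k : ℕ} (hk : 1 ≤ k) (hkT : k + T.card = m * n + 1) :
    ∑ i ∈ Finset.Icc k (m * n), eigval (partialTranspose (ketbra ψ)) i ≤
      -∑ p ∈ T, s p.1 * s p.2 := by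
  have := (ketbra_isHermitian ψ).partialTranspose.sum_last_eigval_le card_prod_fin
    ((orthonormal_asymVec hb hc).comp_subset hT) hk (by rwa [Fintype.card_coe])
  refine this.trans (le_of_eq ?_)
  rw [Finset.sum_coe_sort T (fun p => qform (partialTranspose (ketbra ψ)) (asymVec b c p)),
    ← Finset.sum_neg_distrib]
  exact Finset.sum_congr rfl fun p hp =>
    qform_asymVec hb hc h (mem_orderedPairs.1 (hT hp)).ne

/-- These three vectors test the largest eigenvalues of a state of Schmidt rank two. -/
theorem orthonormal_cross_cross_sym {b : Fin 2 → Fin m → ℂ} {c : Fin 2 → Fin n → ℂ}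
    (hb : Orthonormal ℂ (fun j => WithLp.toLp 2 (b j)))
    (hc : Orthonormal ℂ (fun j => WithLp.toLp 2 (c j))) :
    Orthonormal ℂ (fun i : Fin 3 => WithLp.toLp 2
      ((![crossVec b c (0, 0), crossVec b c (1, 1), symVec b c (0, 1)] :
        Fin 3 → BipartiteVec m n) i)) := by
  have hcr := star_crossVec_dotProduct_crossVec hb hc
  have h1 : ∀ v, star v ⬝ᵥ symVec b c (0, 1) = ((√2 / 2 : ℝ) : ℂ) *
      (star v ⬝ᵥ crossVec b c (0, 1) + star v ⬝ᵥ crossVec b c (1, 0)) := fun v => by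
    rw [symVec, dotProduct_smul, dotProduct_add, smul_eq_mul]; rfl
  have h3 : ((√2 / 2 : ℝ) : ℂ) * ((√2 / 2 : ℝ) : ℂ) = 1 / 2 := by
    rw [← Complex.ofReal_mul, div_mul_div_comm, Real.mul_self_sqrt (by norm_num)]; norm_num
  rw [orthonormal_toLp_iff]
  intro i j
  fin_cases i <;> fin_cases j <;>
    simp [-Complex.ofReal_div, h1, star_symVec_dotProduct, hcr]
  linear_combination 2 * h3

theorem basisKet_succ (i : Fin m) (k : Fin n) :
    basisKet ((i : ℕ) + 1) ((k : ℕ) + 1) =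
      (tensorVec (Pi.single i 1) (Pi.single k 1) : BipartiteVec m n) := by
  ext p
  simp only [basisKet, tensorVec, Pi.single_apply, add_left_inj, Fin.val_inj]
  split_ifs <;> simp_all

theorem sum_eigval_two_of_coeffs {n : ℕ} (hn : 2 ≤ n) {x₁ x₂ : ℝ} (h1 : x₁ ^ 2 + x₂ ^ 2 = 1)
    (h2 : x₁ ^ 2 + x₁ * x₂ = 1 + 1 / (2 + 2 * √2)) {W : BipartiteMatrix 2 n}
    (hW : W = partialTranspose (ketbra ((x₁ : ℂ) • basisKet 1 1 + (x₂ : ℂ) • basisKet 2 2))) :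
    W ∈ normalizedDEW 2 n ∧ ∑ i ∈ Finset.Icc 3 (2 * n), eigval W i = -(1 / (2 + 2 * √2)) := by
  let b : Fin 2 → Fin 2 → ℂ := fun j => Pi.single (Fin.castLE le_rfl j) 1
  let c : Fin 2 → Fin n → ℂ := fun j => Pi.single (Fin.castLE hn j) 1
  have hb : Orthonormal ℂ (fun j => WithLp.toLp 2 (b j)) := orthonormal_single le_rfl
  have hc : Orthonormal ℂ (fun j => WithLp.toLp 2 (c j)) := orthonormal_single hn
  let s : Fin 2 → ℝ := ![x₁, x₂]
  set ψ : BipartiteVec 2 n := (x₁ : ℂ) • basisKet 1 1 + (x₂ : ℂ) • basisKet 2 2 with hψ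
  have h : ψ = ∑ j, (s j : ℂ) • tensorVec (b j) (c j) := by
    have e0 := basisKet_succ (Fin.castLE le_rfl (0 : Fin 2) : Fin 2) (Fin.castLE hn 0)
    have e1 := basisKet_succ (Fin.castLE le_rfl (1 : Fin 2) : Fin 2) (Fin.castLE hn 1)
    rw [Fin.sum_univ_two, ← e0, ← e1, hψ]
    simp [s]
  have hnorm : ‖WithLp.toLp 2 ψ‖ = 1 := by
    refine (pow_eq_one_iff_of_nonneg (norm_nonneg _) two_ne_zero).1 ?_
    rw [norm_sq_of_schmidt hb hc h, Fin.sum_univ_two]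
    exact h1
  have hpos : 0 < 1 / (2 + 2 * √2) := by positivity
  -- Subtracting the two equations gives `x₁ x₂ = x₂² + 1/(2 + 2√2)`.
  have hx : 0 < x₁ * x₂ := by nlinarith [sq_nonneg x₂]
  have hmem : W ∈ normalizedDEW 2 n := by
    rw [hW]
    exact partialTranspose_ketbra_mem hnorm hb hc h (i := 0) (j := 1) (by simp) hx
  refine ⟨hmem, le_antisymm ?_ (hmem.2.1.le_sum_eigval_of_two hn hmem.2.2)⟩
  -- The values `x₁²` and `x₁ x₂` on these two vectors add up to `1 + 1/(2 + 2√2)`, so by the trace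
  -- the remaining eigenvalues add up to at most the claimed minimum.
  have hfam := (orthonormal_cross_cross_sym hb hc).comp ![0, 2] (fun i j => by
    fin_cases i <;> fin_cases j <;> simp)
  have htop := hmem.1.1.1.le_sum_first_eigval rfl (v := fun i : Fin 2 =>
    (![crossVec b c (0, 0), crossVec b c (1, 1), symVec b c (0, 1)] :
        Fin 3 → BipartiteVec 2 n) (![0, 2] i)) hfam
  rw [Fin.sum_univ_two, Fintype.card_fin] at htop
  simp only [cons_val_zero, cons_val_one, cons_val] at htop
  nth_rewrite 1 2 [hW] at htop
  rw [qform_crossVec_self hb hc h, qform_symVec hb hc h (by simp)] at htop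
  have := sum_first_eigval hn hmem.1.1.1 hmem.2.2
  simp only [s, cons_val_zero, cons_val_one] at htop
  linarith

theorem exists_coeffs : ∃ x₁ x₂ : ℝ, x₁ ^ 2 + x₂ ^ 2 = 1 ∧
    x₁ ^ 2 + x₁ * x₂ = 1 + 1 / (2 + 2 * √2) ∧
    |x₁ - 0.92388| < 0.000001 ∧ |x₂ - 0.382683| < 0.000001 := by
  have h2 := Real.sq_sqrt (show (0 : ℝ) ≤ 2 by norm_num)
  have hl : 1.4142135 < √2 := Real.lt_sqrt_of_sq_lt (by norm_num)
  have hu : √2 < 1.4142136 := (Real.sqrt_lt' (by norm_num)).2 (by norm_num)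
  have e1 := Real.sq_sqrt (show 0 ≤ 2 + √2 by linarith)
  have e2 := Real.sq_sqrt (show 0 ≤ 2 - √2 by linarith)
  have e12 : √(2 + √2) * √(2 - √2) = √2 := by
    rw [← Real.sqrt_mul (by linarith)]
    congr 1
    linear_combination -h2
  -- These are `cos (π/8)` and `sin (π/8)`, the optimum of the angle bound.
  refine ⟨√(2 + √2) / 2, √(2 - √2) / 2, ?_, ?_, ?_, ?_⟩
  · linear_combination (e1 + e2) / 4
  · rw [one_div_two_add_two_sqrt_two]
    linear_combination e1 / 4 + e12 / 4
  · have l1 : 1.847759 < √(2 + √2) := Real.lt_sqrt_of_sq_lt (by norm_num; linarith)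
    have u1 : √(2 + √2) < 1.847760 := (Real.sqrt_lt' (by norm_num)).2 (by norm_num; linarith)
    rw [abs_lt]; constructor <;> linarith
  · have l1 : 0.7653665 < √(2 - √2) := Real.lt_sqrt_of_sq_lt (by norm_num; linarith)
    have u1 : √(2 - √2) < 0.765367 := (Real.sqrt_lt' (by norm_num)).2 (by norm_num; linarith)
    rw [abs_lt]; constructor <;> linarith

/-- The squares of the eigenvalues add up to `1`. The top three eigenvalues have sum at least `3/2`,
hence squares of sum at least `3/4`, and the last one contributes `1/4`; so all others are zero. -/
theorem sum_eigval_of_maximally_entangled {n : ℕ} (hn : 2 ≤ n) {ψ : BipartiteVec 2 n}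
    (h : HasSchmidtCoeffs ψ ![√2 / 2, √2 / 2]) {k : ℕ} (hk : 4 ≤ k) (hkn : k ≤ 2 * n) :
    ∑ i ∈ Finset.Icc k (2 * n), eigval (partialTranspose (ketbra ψ)) i = -(1 / 2) := by
  obtain ⟨hmem, hlast⟩ := h.eigval_last le_rfl hn
  obtain ⟨hψ, hs, b, c, hb, hc, h⟩ := h
  set W := partialTranspose (ketbra ψ) with hW
  have hH := hmem.1.1.1
  have h2 := Real.sq_sqrt (show (0 : ℝ) ≤ 2 by norm_num)
  have htop := hH.le_sum_first_eigval rfl (orthonormal_cross_cross_sym hb hc)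
  rw [Fin.sum_univ_three, Fintype.card_fin] at htop
  simp only [cons_val_zero, cons_val_one, cons_val] at htop
  rw [hW, qform_crossVec_self hb hc h, qform_crossVec_self hb hc h,
    qform_symVec hb hc h (by simp), ← hW] at htop
  simp only [cons_val_zero, cons_val_one, cons_val_fin_one] at htop
  rw [show Finset.Icc 1 3 = {1, 2, 3} from rfl, Finset.sum_insert (by decide),
    Finset.sum_pair (by decide)] at htop
  have hsq := hH.sum_eigval_sq card_prod_fin
  rw [trace_sq_partialTranspose_ketbra hψ] at hsq
  have hzero : ∀ i ∈ Finset.Icc k (2 * n), i ≠ 2 * n → eigval W i = 0 := by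
    intro i hi hin
    rw [Finset.mem_Icc] at hi
    have hsub : ∑ j ∈ {1, 2, 3, i, 2 * n}, eigval W j ^ 2 ≤
        ∑ j ∈ Finset.Icc 1 (2 * n), eigval W j ^ 2 := by
      refine Finset.sum_le_sum_of_subset_of_nonneg ?_ fun _ _ _ => sq_nonneg _
      intro j hj
      simp only [Finset.mem_insert, Finset.mem_singleton] at hj
      rw [Finset.mem_Icc]; omega
    rw [← hsq, Finset.sum_insert (by simp; omega), Finset.sum_insert (by simp; omega),
      Finset.sum_insert (by simp; omega), Finset.sum_pair hin, hlast] at hsub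
    have : eigval W i ^ 2 ≤ 0 := by
      nlinarith [sq_nonneg (eigval W 1 - 1 / 2), sq_nonneg (eigval W 2 - 1 / 2),
        sq_nonneg (eigval W 3 - 1 / 2)]
    exact pow_eq_zero_iff two_ne_zero |>.1 (le_antisymm this (sq_nonneg _))
  rw [Finset.sum_eq_single (2 * n) hzero, hlast]
  intro h; exact absurd (Finset.mem_Icc.2 ⟨hkn, le_rfl⟩) h

theorem exists_hasSchmidtCoeffs (hr : r ≤ m) (hmn : m ≤ n) {s : Fin r → ℝ} (hs : ∀ j, 0 < s j)
    (hs1 : ∑ j, s j ^ 2 = 1) : ∃ ψ : BipartiteVec m n, HasSchmidtCoeffs ψ s := by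
  obtain ⟨ψ, b, c, hψ, hb, hc, h⟩ := exists_state hr hmn hs1
  exact ⟨ψ, hψ, hs, b, c, hb, hc, h⟩

theorem sqrt_two_div_two_eq : √2 / 2 = 1 / √2 := by
  rw [div_eq_div_iff (by norm_num) (by positivity), Real.mul_self_sqrt (by norm_num), one_mul]

theorem isLeast_sum_eigval_two (n : ℕ) (hn : 2 ≤ n) :
    (IsLeast ((fun W : BipartiteMatrix 2 n => ∑ i ∈ Finset.Icc 3 (2 * n), eigval W i) ''
        normalizedDEW 2 n) (-(1 / (2 + 2 * √2))) ∧
      (∃ x₁ x₂ : ℝ, x₁ ^ 2 + x₂ ^ 2 = 1 ∧ x₁ ^ 2 + x₁ * x₂ = 1 + 1 / (2 + 2 * √2) ∧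
        |x₁ - 0.92388| < 0.000001 ∧ |x₂ - 0.382683| < 0.000001) ∧
      (∀ x₁ x₂ : ℝ, x₁ ^ 2 + x₂ ^ 2 = 1 → x₁ ^ 2 + x₁ * x₂ = 1 + 1 / (2 + 2 * √2) →
        ∀ W : BipartiteMatrix 2 n,
          W = partialTranspose (ketbra ((x₁ : ℂ) • basisKet 1 1 + (x₂ : ℂ) • basisKet 2 2)) →
          W ∈ normalizedDEW 2 n ∧
            ∑ i ∈ Finset.Icc 3 (2 * n), eigval W i = -(1 / (2 + 2 * √2)))) ∧
    (∀ k : ℕ, 4 ≤ k → k ≤ 2 * n →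
      IsLeast ((fun W : BipartiteMatrix 2 n => ∑ i ∈ Finset.Icc k (2 * n), eigval W i) ''
        normalizedDEW 2 n) (-(1 / 2)) ∧
      (∀ ψ : BipartiteVec 2 n, HasSchmidtCoeffs ψ (fun _ : Fin 2 => 1 / √((2 : ℕ) : ℝ)) →
        ∀ W : BipartiteMatrix 2 n, W = partialTranspose (ketbra ψ) →
          W ∈ normalizedDEW 2 n ∧
            ∑ i ∈ Finset.Icc k (2 * n), eigval W i = -(1 / 2))) := by
  refine ⟨⟨⟨?_, ?_⟩, exists_coeffs, fun x₁ x₂ h1 h2 W hW => sum_eigval_two_of_coeffs hn h1 h2 hW⟩,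
    fun k hk hkn => ?_⟩
  · obtain ⟨x₁, x₂, h1, h2, -⟩ := exists_coeffs
    obtain ⟨h3, h4⟩ := sum_eigval_two_of_coeffs hn h1 h2 rfl
    exact ⟨_, h3, h4⟩
  · rintro _ ⟨W, hW, rfl⟩
    exact hW.2.1.le_sum_eigval_of_two hn hW.2.2
  · have hpure : ∀ ψ : BipartiteVec 2 n,
        HasSchmidtCoeffs ψ (fun _ : Fin 2 => 1 / √((2 : ℕ) : ℝ)) →
        ∀ W : BipartiteMatrix 2 n, W = partialTranspose (ketbra ψ) →
          W ∈ normalizedDEW 2 n ∧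
            ∑ i ∈ Finset.Icc k (2 * n), eigval W i = -(1 / 2) := by
      rintro ψ hψ W rfl
      have hs : (fun _ : Fin 2 => 1 / √((2 : ℕ) : ℝ)) = ![√2 / 2, √2 / 2] := by
        ext j; fin_cases j <;> simp [sqrt_two_div_two_eq]
      rw [hs] at hψ
      exact ⟨(hψ.eigval_last le_rfl hn).1, sum_eigval_of_maximally_entangled hn hψ hk hkn⟩
    refine ⟨⟨?_, ?_⟩, hpure⟩
    · obtain ⟨ψ, hψ⟩ := exists_hasSchmidtCoeffs (m := 2) le_rfl hn
        (s := fun _ : Fin 2 => 1 / √((2 : ℕ) : ℝ)) (fun _ => by positivity)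
        (by rw [Fin.sum_univ_two]; norm_num)
      obtain ⟨h1, h2⟩ := hpure ψ hψ _ rfl
      exact ⟨_, h1, h2⟩
    · rintro _ ⟨W, hW, rfl⟩
      have := (hW.2.1.neg_sum_eigval_le hW.2.2 (by norm_num) hn
        (Finset.Icc_subset_Icc (by omega : 1 ≤ k) le_rfl)).1
      norm_num at this ⊢
      linarith

theorem isLeast_sum_eigval_of_three_le (hm : 3 ≤ m) (hmn : m ≤ n) :
    (IsLeast ((fun W : BipartiteMatrix m n => eigval W (m * n) + eigval W (m * n - 1)) ''
        normalizedDEW m n) (-(√2 / 2)) ∧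
      (∀ ψ : BipartiteVec m n, HasSchmidtCoeffs ψ ![√2 / 2, 1 / 2, 1 / 2] →
        ∀ W : BipartiteMatrix m n, W = partialTranspose (ketbra ψ) →
          W ∈ normalizedDEW m n ∧
            eigval W (m * n) + eigval W (m * n - 1) = -(√2 / 2))) ∧
    (IsLeast ((fun W : BipartiteMatrix m n =>
          eigval W (m * n) + eigval W (m * n - 1) + eigval W (m * n - 2)) ''
        normalizedDEW m n) (-1) ∧
      (∀ ψ : BipartiteVec m n, HasSchmidtCoeffs ψ (fun _ : Fin 3 => 1 / √3) →
        ∀ W : BipartiteMatrix m n, W = partialTranspose (ketbra ψ) →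
          W ∈ normalizedDEW m n ∧
            eigval W (m * n) + eigval W (m * n - 1) + eigval W (m * n - 2) = -1)) := by
  have hN : 3 * 3 ≤ m * n := Nat.mul_le_mul hm (hm.trans hmn)
  have h2 := Real.sq_sqrt (show (0 : ℝ) ≤ 2 by norm_num)
  have h3 := Real.sq_sqrt (show (0 : ℝ) ≤ 3 by norm_num)
  have hIcc2 : Finset.Icc (m * n - 1) (m * n) = {m * n, m * n - 1} := by
    ext; simp only [Finset.mem_Icc, Finset.mem_insert, Finset.mem_singleton]; omega
  have hIcc3 : Finset.Icc (m * n - 2) (m * n) = {m * n, m * n - 1, m * n - 2} := by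
    ext; simp only [Finset.mem_Icc, Finset.mem_insert, Finset.mem_singleton]; omega
  have hsum2 : ∀ W : BipartiteMatrix m n, ∑ i ∈ Finset.Icc (m * n - 1) (m * n), eigval W i =
      eigval W (m * n) + eigval W (m * n - 1) := fun W => by
    rw [hIcc2, Finset.sum_pair (by omega)]
  have hsum3 : ∀ W : BipartiteMatrix m n, ∑ i ∈ Finset.Icc (m * n - 2) (m * n), eigval W i =
      eigval W (m * n) + eigval W (m * n - 1) + eigval W (m * n - 2) := fun W => by
    rw [hIcc3, Finset.sum_insert (by simp; omega), Finset.sum_pair (by omega), add_assoc]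
  have hlow2 : ∀ W ∈ normalizedDEW m n,
      -(√2 / 2) ≤ eigval W (m * n) + eigval W (m * n - 1) := fun W hW => by
    have := (hW.2.1.neg_sum_eigval_le hW.2.2 (by omega) hmn
      (Finset.Icc_subset_Icc (by omega : 1 ≤ m * n - 1) le_rfl)).2.2.1 hm
      (by rw [Nat.card_Icc]; omega)
    rw [hsum2] at this
    linarith
  have hlow3 : ∀ W ∈ normalizedDEW m n,
      -1 ≤ eigval W (m * n) + eigval W (m * n - 1) + eigval W (m * n - 2) := fun W hW => by
    have := (hW.2.1.neg_sum_eigval_le hW.2.2 (by omega) hmn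
      (Finset.Icc_subset_Icc (by omega : 1 ≤ m * n - 2) le_rfl)).2.2.2 hm
      (by rw [Nat.card_Icc]; omega)
    rw [hsum3] at this
    linarith
  have hpure2 : ∀ ψ : BipartiteVec m n, HasSchmidtCoeffs ψ ![√2 / 2, 1 / 2, 1 / 2] →
      ∀ W : BipartiteMatrix m n, W = partialTranspose (ketbra ψ) →
        W ∈ normalizedDEW m n ∧ eigval W (m * n) + eigval W (m * n - 1) = -(√2 / 2) := by
    rintro ψ ⟨hψ, hs, b, c, hb, hc, h⟩ W rfl
    have hmem := partialTranspose_ketbra_mem hψ hb hc h (i := 0) (j := 1) (by simp)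
      (mul_pos (hs _) (hs _))
    refine ⟨hmem, le_antisymm ?_ (hlow2 _ hmem)⟩
    rw [← hsum2]
    refine (sum_last_eigval_le_of_schmidt hb hc h (T := {(0, 1), (0, 2)}) (by decide) (by omega)
      (by rw [Finset.card_pair (by decide)]; omega)).trans ?_
    rw [Finset.sum_pair (by decide)]
    simp only [cons_val_zero, cons_val_one, cons_val]
    linarith
  have hpure3 : ∀ ψ : BipartiteVec m n, HasSchmidtCoeffs ψ (fun _ : Fin 3 => 1 / √3) →
      ∀ W : BipartiteMatrix m n, W = partialTranspose (ketbra ψ) →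
        W ∈ normalizedDEW m n ∧
          eigval W (m * n) + eigval W (m * n - 1) + eigval W (m * n - 2) = -1 := by
    rintro ψ ⟨hψ, hs, b, c, hb, hc, h⟩ W rfl
    have hmem := partialTranspose_ketbra_mem hψ hb hc h (i := 0) (j := 1) (by simp)
      (mul_pos (hs 0) (hs 1))
    refine ⟨hmem, le_antisymm ?_ (hlow3 _ hmem)⟩
    rw [← hsum3]
    have hcard : (orderedPairs 3).card = 3 := by decide
    refine (sum_last_eigval_le_of_schmidt hb hc h subset_rfl (by omega)
      (by rw [hcard]; omega)).trans ?_
    rw [Finset.sum_const, hcard, div_mul_div_comm, ← sq √3, h3]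
    norm_num
  refine ⟨⟨⟨?_, ?_⟩, hpure2⟩, ⟨?_, ?_⟩, hpure3⟩
  · obtain ⟨ψ, hψ⟩ := exists_hasSchmidtCoeffs hm hmn (s := ![√2 / 2, 1 / 2, 1 / 2])
      (fun j => by fin_cases j <;> simp) (by
        rw [Fin.sum_univ_three]
        simp only [cons_val_zero, cons_val_one, cons_val]
        linear_combination h2 / 4)
    obtain ⟨h1, h2⟩ := hpure2 ψ hψ _ rfl
    exact ⟨_, h1, h2⟩
  · rintro _ ⟨W, hW, rfl⟩
    exact hlow2 W hW
  · obtain ⟨ψ, hψ⟩ := exists_hasSchmidtCoeffs hm hmn (s := fun _ : Fin 3 => 1 / √3)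
      (fun _ => by positivity) (by rw [Fin.sum_univ_three, div_pow, h3]; norm_num)
    obtain ⟨h1, h2⟩ := hpure3 ψ hψ _ rfl
    exact ⟨_, h1, h2⟩
  · rintro _ ⟨W, hW, rfl⟩
    exact hlow3 W hW

end PartialSums

/-! ### Maximal negativity: coefficient matrices of the optimal vectors. -/

section MaximalNegativity

variable {m n : ℕ}

theorem ketbra_mulVec_eq {ι : Type*} [Fintype ι] (M : Matrix ι ι ℂ) (v : ι → ℂ) :
    ketbra (M *ᵥ v) = M * ketbra v * Mᴴ := by
  rw [ketbra, ketbra, star_mulVec, mul_vecMulVec, vecMulVec_mul]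

theorem qform_conjTranspose_mulVec {ι : Type*} [Fintype ι] (W G : Matrix ι ι ℂ) (v : ι → ℂ) :
    qform W (Gᴴ *ᵥ v) = qform (G * W * Gᴴ) v := by
  rw [qform, qform, star_mulVec, conjTranspose_conjTranspose, ← dotProduct_mulVec, mulVec_mulVec,
    mulVec_mulVec, Matrix.mul_assoc]

/-- The coefficient matrix of a vector. -/
def coeffMatrix (ψ : BipartiteVec m n) : Matrix (Fin m) (Fin n) ℂ := of fun i x => ψ (i, x)

theorem coeffMatrix_add (ψ φ : BipartiteVec m n) :
    coeffMatrix (ψ + φ) = coeffMatrix ψ + coeffMatrix φ := rfl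

theorem coeffMatrix_smul (z : ℂ) (ψ : BipartiteVec m n) :
    coeffMatrix (z • ψ) = z • coeffMatrix ψ := rfl

theorem star_mul_self_of_orthonormal {r n : ℕ} {c : Fin r → Fin n → ℂ}
    (hc : Orthonormal ℂ (fun j => WithLp.toLp 2 (c j))) :
    of (fun j x => star (c j x)) * (of fun j x => star (c j x))ᴴ =
      (1 : Matrix (Fin r) (Fin r) ℂ) := by
  ext i j
  have := orthonormal_toLp_iff.1 hc i j
  simp only [dotProduct, Pi.star_apply] at this
  simp [mul_apply, one_apply, ← this]

theorem coeffMatrix_mul_conjTranspose_of_const {s : ℝ} {b : Fin m → Fin m → ℂ}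
    {c : Fin m → Fin n → ℂ} (hb : Orthonormal ℂ (fun j => WithLp.toLp 2 (b j)))
    (hc : Orthonormal ℂ (fun j => WithLp.toLp 2 (c j))) :
    coeffMatrix (∑ j, (s : ℂ) • tensorVec (b j) (c j)) *
      (coeffMatrix (∑ j, (s : ℂ) • tensorVec (b j) (c j)))ᴴ = ((s ^ 2 : ℝ) : ℂ) • 1 := by
  set B : Matrix (Fin m) (Fin m) ℂ := of fun j x => star (b j x) with hB
  set C : Matrix (Fin m) (Fin n) ℂ := of fun j x => star (c j x) with hC
  have h1 : B * Bᴴ = 1 := star_mul_self_of_orthonormal hb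
  have h2 : C * Cᴴ = 1 := star_mul_self_of_orthonormal hc
  have h3 : coeffMatrix (∑ j, (s : ℂ) • tensorVec (b j) (c j)) =
      (s : ℂ) • (Bᴴ * C.map star) := by
    ext i x
    simp [coeffMatrix, mul_apply, tensorVec, hB, hC, Finset.mul_sum]
  have h4 : C.map star * (C.map star)ᴴ = 1 := by
    have := congrArg (fun M => Mᵀ) h2
    simp only [transpose_mul, transpose_one] at this
    have h5 : C.map star = Cᴴᵀ := by ext; simp
    have h6 : Cᴴᵀᴴ = Cᵀ := by ext; simp
    rw [h5, h6]
    exact this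
  rw [h3, conjTranspose_smul, Matrix.smul_mul, Matrix.mul_smul, smul_smul, conjTranspose_mul,
    conjTranspose_conjTranspose,
    Matrix.mul_assoc, ← Matrix.mul_assoc _ _ B, h4, Matrix.one_mul, mul_eq_one_comm.1 h1,
    Complex.star_def, Complex.conj_ofReal, sq, Complex.ofReal_mul]

/-- A pure state attaining the largest total weight of the negative part is maximally entangled. -/
theorem coeffMatrix_mul_of_unit {κ : Type*} [Fintype κ] (hm : 1 ≤ m) (hmn : m ≤ n)
    {ψ : BipartiteVec m n} (hψ : ‖WithLp.toLp 2 ψ‖ = 1) {v : κ → BipartiteVec m n}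
    (hv : Orthonormal ℂ (fun i => WithLp.toLp 2 (v i)))
    (h : -∑ k, qform (partialTranspose (ketbra ψ)) (v k) = ((m : ℝ) - 1) / 2) :
    coeffMatrix ψ * (coeffMatrix ψ)ᴴ = ((1 / m : ℝ) : ℂ) • 1 := by
  obtain ⟨s, b, c, hs0, -, hb, hc, hd⟩ := exists_schmidt hmn ψ
  have hs1 : ∑ j, s j ^ 2 = 1 := by rw [← norm_sq_of_schmidt hb hc hd, hψ, one_pow]
  obtain ⟨w, -, hw1, -, hle⟩ := exists_weights_neg_sum_qform_le hb hc hs0 hd hv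
  have h1 : ∑ p ∈ orderedPairs m, s p.1 * s p.2 * w p ≤ ∑ p ∈ orderedPairs m, s p.1 * s p.2 :=
    Finset.sum_le_sum fun p hp => mul_le_of_le_one_right (mul_nonneg (hs0 _) (hs0 _)) (hw1 p hp)
  rw [sum_orderedPairs_mul, hs1] at h1
  have hm0 : (0 : ℝ) < m := by exact_mod_cast hm
  set S := ∑ j, s j with hS
  have hSm : (m : ℝ) ≤ S ^ 2 := by linarith
  -- Equality in Cauchy–Schwarz as a vanishing variance: maximality gives `S² ≥ m`, so all Schmidt
  -- coefficients equal their mean.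
  have hvar : ∑ j, (s j - S / m) ^ 2 = 1 - S ^ 2 / m := by
    simp only [sub_sq, Finset.sum_add_distrib, Finset.sum_sub_distrib, hs1, ← Finset.sum_mul,
      ← Finset.mul_sum, ← hS, Finset.sum_const, Finset.card_univ, Fintype.card_fin, nsmul_eq_mul]
    field_simp
    ring
  have hvar0 : ∑ j, (s j - S / m) ^ 2 ≤ 0 := by
    rw [hvar, sub_nonpos, le_div_iff₀ hm0]; linarith
  have hconst : ∀ j, s j = S / m := fun j => by
    have := (Finset.sum_eq_zero_iff_of_nonneg (fun j _ => sq_nonneg (s j - S / m))).1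
      (le_antisymm hvar0 (by positivity)) j (Finset.mem_univ j)
    linarith [pow_eq_zero_iff two_ne_zero |>.1 this]
  have hsq : (S / m) ^ 2 = 1 / m := by
    have : (m : ℝ) * (S / m) ^ 2 = 1 := by
      rw [← hs1]
      simp [hconst]
    field_simp at this ⊢
    linarith
  simp only [hconst] at hd
  rw [hd, coeffMatrix_mul_conjTranspose_of_const hb hc, hsq]

/-- The normalized basis vectors on the second factor of the states `maxEntangledPhi`. -/
def blockVec (m n j : ℕ) (i : Fin m) : Fin n → ℂ :=
  fun x => if (x : ℕ) = i + (j - 1) * m then 1 else 0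

theorem maxEntangledPhi_eq (m n j : ℕ) : maxEntangledPhi m n j =
    ∑ i : Fin m, (((1 / √m : ℝ)) : ℂ) • tensorVec (Pi.single i 1) (blockVec m n j i) := by
  rw [maxEntangledPhi, sum_Icc_one_eq_sum_fin, Finset.smul_sum]
  refine Finset.sum_congr rfl fun i _ => ?_
  congr 1
  ext p
  simp only [basisKet, tensorVec, blockVec, Pi.single_apply, add_left_inj, Fin.val_inj]
  have : (p.2 : ℕ) + 1 = (i : ℕ) + 1 + (j - 1) * m ↔ (p.2 : ℕ) = i + (j - 1) * m := by omega
  simp only [this]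
  split_ifs <;> simp_all

theorem shift_lt {j : ℕ} (hj : 1 ≤ j) (hjn : j ≤ n / m) (i : Fin m) : i + (j - 1) * m < n := by
  have h1 : j * m ≤ n := (Nat.mul_le_mul_right m hjn).trans (Nat.div_mul_le_self n m)
  obtain ⟨j, rfl⟩ := Nat.exists_eq_add_of_le' hj
  rw [Nat.add_sub_cancel]
  have := i.2
  rw [Nat.add_mul] at h1
  omega

theorem shift_inj {j j' : ℕ} {i i' : Fin m} (h : (i : ℕ) + j * m = i' + j' * m) :
    i = i' ∧ j = j' := by
  have h1 := congrArg (· % m) h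
  simp only [Nat.add_mul_mod_self_right, Nat.mod_eq_of_lt i.2, Nat.mod_eq_of_lt i'.2] at h1
  refine ⟨Fin.ext h1, ?_⟩
  rw [h1] at h
  exact Nat.eq_of_mul_eq_mul_right (i.pos) (Nat.add_left_cancel h)

theorem star_blockVec_dotProduct {j j' : ℕ} (hj : 1 ≤ j) (hj' : 1 ≤ j') (hjn : j ≤ n / m)
    (i i' : Fin m) :
    star (blockVec m n j i) ⬝ᵥ blockVec m n j' i' = if j = j' ∧ i = i' then 1 else 0 := by
  have h1 : blockVec m n j i = Pi.single ⟨_, shift_lt hj hjn i⟩ 1 := by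
    ext x
    simp [blockVec, Pi.single_apply, Fin.ext_iff]
  rw [h1, ← Pi.single_star, star_one, single_one_dotProduct, blockVec]
  refine if_congr ⟨fun h => ?_, ?_⟩ rfl rfl
  · have := shift_inj h
    exact ⟨by omega, this.1⟩
  · rintro ⟨rfl, rfl⟩; rfl

theorem orthonormal_blockVec {j : ℕ} (hj : 1 ≤ j) (hjn : j ≤ n / m) :
    Orthonormal ℂ (fun i => WithLp.toLp 2 (blockVec m n j i)) := by
  rw [orthonormal_toLp_iff]
  intro i i'
  rw [star_blockVec_dotProduct hj hj hjn]
  simp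

theorem orthonormal_single_self :
    Orthonormal ℂ (fun i : Fin m => WithLp.toLp 2 (Pi.single i 1 : Fin m → ℂ)) :=
  orthonormal_single le_rfl

theorem norm_maxEntangledPhi {j : ℕ} (hm : 1 ≤ m) (hj : 1 ≤ j) (hjn : j ≤ n / m) :
    ‖WithLp.toLp 2 (maxEntangledPhi m n j)‖ = 1 := by
  refine (pow_eq_one_iff_of_nonneg (norm_nonneg _) two_ne_zero).1 ?_
  have hm0 : (0 : ℝ) < m := by exact_mod_cast hm
  rw [norm_sq_of_schmidt orthonormal_single_self (orthonormal_blockVec hj hjn)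
    (maxEntangledPhi_eq m n j), Finset.sum_const, Finset.card_univ, Fintype.card_fin, div_pow,
    Real.sq_sqrt hm0.le, nsmul_eq_mul]
  field_simp

/-- Mixtures of the states `maxEntangledPhi` have partial transposes of maximal negativity. -/
theorem negativity_of_mixture (hm : 2 ≤ m) (hmn : m ≤ n) {W : BipartiteMatrix m n}
    {U : Matrix (Fin m) (Fin m) ℂ} (hU : U ∈ unitaryGroup (Fin m) ℂ)
    {V : Matrix (Fin n) (Fin n) ℂ} (hV : V ∈ unitaryGroup (Fin n) ℂ) {k : ℕ} (hk : k ≤ n / m)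
    {p : ℕ → ℝ} (hp0 : ∀ j ∈ Finset.Icc 1 k, 0 ≤ p j) (hp1 : ∑ j ∈ Finset.Icc 1 k, p j = 1)
    (hW : (U ⊗ₖ V) * W * (U ⊗ₖ V)ᴴ = ∑ j ∈ Finset.Icc 1 k,
      (p j : ℂ) • partialTranspose (ketbra (maxEntangledPhi m n j))) :
    W ∈ normalizedDEW m n ∧ negativity W = ((m : ℝ) - 1) / 2 := by
  have hm0 : (0 : ℝ) < m := by exact_mod_cast (by omega : 0 < m)
  have hm2 : (2 : ℝ) ≤ m := by exact_mod_cast hm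
  set G := U ⊗ₖ V with hG
  have hGG : Gᴴ * G = 1 := by
    rw [hG, conjTranspose_kronecker, ← mul_kronecker_mul, ← star_eq_conjTranspose,
      ← star_eq_conjTranspose, mem_unitaryGroup_iff'.1 hU, mem_unitaryGroup_iff'.1 hV,
      one_kronecker_one]
  set Q₀ : BipartiteMatrix m n :=
    ∑ j ∈ Finset.Icc 1 k, (p j : ℂ) • ketbra (maxEntangledPhi m n j) with hQ₀
  have hQ₀p : Q₀.PosSemidef := posSemidef_sum _ fun j hj =>
    (ketbra_posSemidef _).smul (by exact_mod_cast hp0 j hj)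
  have hW₀ : G * W * Gᴴ = partialTranspose Q₀ := by
    rw [hW, hQ₀, partialTranspose_sum]; rfl
  have hWeq : W = Gᴴ * partialTranspose Q₀ * G := by
    rw [← hW₀]
    simp only [← Matrix.mul_assoc, hGG, Matrix.one_mul]
    rw [Matrix.mul_assoc, hGG, Matrix.mul_one]
  have hdec : IsDecomposable W := by
    rw [hWeq, hG, conjTranspose_kronecker, kronecker_mul_partialTranspose_mul_kronecker]
    refine isDecomposable_partialTranspose ?_
    have := hQ₀p.mul_mul_conjTranspose_same (Uᵀ ⊗ₖ Vᴴ)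
    have hUU : Uᵀᴴ = Uᴴᵀ := rfl
    rwa [conjTranspose_kronecker, conjTranspose_conjTranspose, hUU] at this
  have htr : W.trace = 1 := by
    rw [hWeq, trace_mul_comm, ← Matrix.mul_assoc, mul_eq_one_comm.1 hGG, Matrix.one_mul,
      trace_partialTranspose, hQ₀, trace_sum, ← Complex.ofReal_one, ← hp1, Complex.ofReal_sum]
    refine Finset.sum_congr rfl fun j hj => ?_
    rw [Finset.mem_Icc] at hj
    rw [trace_smul, trace_ketbra, norm_maxEntangledPhi (by omega) hj.1 (hj.2.trans hk)]
    simp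
  have hH := hdec.isBlockPositive.1
  let a : ℕ → Fin m × Fin m → BipartiteVec m n := fun j =>
    asymVec (fun i => Pi.single i 1) (blockVec m n j)
  have hcross : ∀ j ∈ Finset.Icc 1 k, ∀ j' ∈ Finset.Icc 1 k, j ≠ j' → ∀ x y,
      star (crossVec (fun i : Fin m => Pi.single i 1) (blockVec m n j) x) ⬝ᵥ
        crossVec (fun i : Fin m => Pi.single i 1) (blockVec m n j') y = 0 := by
    intro j hj j' hj' hne x y
    rw [Finset.mem_Icc] at hj hj'
    rw [crossVec, crossVec, star_tensorVec_dotProduct,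
      star_blockVec_dotProduct hj.1 hj'.1 (hj.2.trans hk), if_neg fun h => hne h.1, mul_zero]
  have hcrossa : ∀ j ∈ Finset.Icc 1 k, ∀ j' ∈ Finset.Icc 1 k, j ≠ j' → ∀ x y,
      star (crossVec (fun i : Fin m => Pi.single i 1) (blockVec m n j) x) ⬝ᵥ a j' y = 0 := by
    intro j hj j' hj' hne x y
    simp only [a, asymVec, dotProduct_smul, dotProduct_sub, hcross j hj j' hj' hne, sub_zero,
      smul_zero]
  -- The antisymmetric vectors of all the `Φ_j`, pulled back by the local unitary. Different `j`
  -- occupy disjoint blocks of the second factor, so the families are mutually orthogonal and each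
  -- sees only its own `Φ_j`; the values add up to `-∑ p_j (m-1)/2`.
  have hon : Orthonormal ℂ (fun q : Finset.Icc 1 k × orderedPairs m =>
      WithLp.toLp 2 (Gᴴ *ᵥ a q.1 q.2)) := by
    rw [orthonormal_toLp_iff]
    rintro ⟨j, x⟩ ⟨j', y⟩
    rw [star_mulVec, conjTranspose_conjTranspose, ← dotProduct_mulVec, mulVec_mulVec,
      mul_eq_one_comm.1 hGG, one_mulVec]
    by_cases hne : (j : ℕ) = j'
    · have hj' := Finset.mem_Icc.1 j.2
      have := orthonormal_toLp_iff.1 (orthonormal_asymVec (orthonormal_single_self (m := m))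
        (orthonormal_blockVec hj'.1 (hj'.2.trans hk))) x y
      obtain rfl := Subtype.ext hne
      simpa [a] using this
    · rw [if_neg fun h => hne (congrArg Subtype.val (Prod.ext_iff.1 h).1)]
      simp only [a, star_asymVec_dotProduct]
      have h1 := hcrossa j j.2 j' j'.2 hne
      simp only [a] at h1
      rw [h1, h1, sub_zero, mul_zero]
  have hval : ∀ q : Finset.Icc 1 k × orderedPairs m,
      qform W (Gᴴ *ᵥ a q.1 q.2) = -(p q.1 * (1 / √m * (1 / √m))) := by
    rintro ⟨⟨j, hj⟩, ⟨x, hx⟩⟩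
    rw [qform_conjTranspose_mulVec, hW, qform_sum, Finset.sum_eq_single j]
    · have hj' := Finset.mem_Icc.1 hj
      rw [qform_smul, qform_asymVec orthonormal_single_self
        (orthonormal_blockVec hj'.1 (hj'.2.trans hk)) (maxEntangledPhi_eq m n j)
        (mem_orderedPairs.1 hx).ne, mul_neg]
    · intro j' hj' hne
      rw [qform_smul, qform_partialTranspose_ketbra (maxEntangledPhi_eq m n j')]
      simp only [hcrossa j' hj' j hj hne]
      simp
    · exact fun h => absurd hj h
  have hsum : -∑ q : Finset.Icc 1 k × orderedPairs m, qform W (Gᴴ *ᵥ a q.1 q.2) =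
      ((m : ℝ) - 1) / 2 := by
    have h1 := sum_orderedPairs_mul (fun _ : Fin m => 1 / √(m : ℝ))
    simp only [Finset.sum_const, Finset.card_univ, Fintype.card_fin, nsmul_eq_mul] at h1
    simp only [hval, Finset.sum_neg_distrib, neg_neg, Fintype.sum_prod_type, Finset.sum_const,
      Finset.card_univ, Fintype.card_coe, nsmul_eq_mul]
    rw [← Finset.mul_sum, ← Finset.sum_mul, Finset.sum_coe_sort (Finset.Icc 1 k) p, hp1, one_mul,
      h1, mul_pow, div_pow, one_pow, Real.sq_sqrt hm0.le]
    field_simp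
  have hle := hH.neg_sum_qform_le_negativity hon
  rw [hsum] at hle
  obtain ⟨q, hq⟩ : ∃ q : Finset.Icc 1 k × orderedPairs m, qform W (Gᴴ *ᵥ a q.1 q.2) < 0 := by
    by_contra! h
    have := Finset.sum_nonneg fun q (_ : q ∈ Finset.univ) => h q
    linarith
  have hmem := mem_normalizedDEW hdec htr hq
  exact ⟨hmem, le_antisymm (negativity_le_of_mem hmem (by omega) hmn) hle⟩

theorem coeffMatrix_mul_of_scaled {κ : Type*} [Fintype κ] (hm : 1 ≤ m) (hmn : m ≤ n)
    {ψ : BipartiteVec m n} {v : κ → BipartiteVec m n}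
    (hv : Orthonormal ℂ (fun i => WithLp.toLp 2 (v i)))
    (h : -∑ k, qform (partialTranspose (ketbra (v k))) ψ =
      ((m : ℝ) - 1) / 2 * ‖WithLp.toLp 2 ψ‖ ^ 2) :
    coeffMatrix ψ * (coeffMatrix ψ)ᴴ = ((‖WithLp.toLp 2 ψ‖ ^ 2 / m : ℝ) : ℂ) • 1 := by
  by_cases h0 : ψ = 0
  · subst h0
    have : coeffMatrix (0 : BipartiteVec m n) = 0 := rfl
    simp [this]
  have hn0 : ‖WithLp.toLp 2 ψ‖ ≠ 0 := by simpa using h0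
  set r := ‖WithLp.toLp 2 ψ‖ with hr
  set φ : BipartiteVec m n := ((r⁻¹ : ℝ) : ℂ) • ψ with hφdef
  have hφ : ‖WithLp.toLp 2 φ‖ = 1 := by
    rw [hφdef, WithLp.toLp_smul, norm_smul, Complex.norm_real, ← hr, Real.norm_of_nonneg
      (inv_nonneg.2 (norm_nonneg _)), inv_mul_cancel₀ hn0]
  have hψφ : ψ = (r : ℂ) • φ := by
    rw [hφdef, smul_smul, ← Complex.ofReal_mul, mul_inv_cancel₀ hn0, Complex.ofReal_one, one_smul]
  have hq : ∀ X : BipartiteMatrix m n, qform X ψ = r ^ 2 * qform X φ := by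
    intro X
    rw [hψφ, qform, qform, mulVec_smul, dotProduct_smul, star_smul, smul_dotProduct,
      Complex.star_def, Complex.conj_ofReal, smul_smul, ← Complex.ofReal_mul, smul_eq_mul,
      Complex.re_ofReal_mul, sq]
  have h1 : -∑ k, qform (partialTranspose (ketbra φ)) (v k) = ((m : ℝ) - 1) / 2 := by
    simp only [qform_partialTranspose_ketbra_comm φ]
    simp only [hq, ← Finset.mul_sum] at h
    have : 0 < r ^ 2 := by positivity
    nlinarith
  rw [hψφ, coeffMatrix_smul, conjTranspose_smul, Matrix.smul_mul, Matrix.mul_smul, smul_smul,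
    coeffMatrix_mul_of_unit hm hmn hφ hv h1, smul_smul, Complex.star_def, Complex.conj_ofReal,
    ← Complex.ofReal_mul, ← Complex.ofReal_mul]
  congr 2
  ring

/-- Polarization: `A + B` yields `AB^* + BA^* = 0` and `A + iB` yields `AB^* - BA^* = 0`. -/
theorem coeffMatrix_mul_eq_zero {A B : Matrix (Fin m) (Fin n) ℂ} {z : ℂ} (hA : A * Aᴴ = z • 1)
    (hB : B * Bᴴ = z • 1) (h1 : (A + B) * (A + B)ᴴ = (2 * z) • 1)
    (h2 : (A + Complex.I • B) * (A + Complex.I • B)ᴴ = (2 * z) • 1) : A * Bᴴ = 0 := by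
  rw [conjTranspose_add, Matrix.add_mul, Matrix.mul_add, Matrix.mul_add, hA, hB, mul_smul,
    two_smul] at h1
  rw [conjTranspose_add, conjTranspose_smul, Matrix.add_mul, Matrix.mul_add, Matrix.mul_add,
    Matrix.smul_mul, Matrix.smul_mul, Matrix.mul_smul, Matrix.mul_smul, smul_smul, hA, hB,
    Complex.star_def, Complex.mul_conj, Complex.normSq_I, Complex.ofReal_one, one_smul, mul_smul,
    two_smul, Complex.conj_I] at h2
  ext i j
  have e1 := congrFun (congrFun h1 i) j
  have e2 := congrFun (congrFun h2 i) j
  simp only [Matrix.add_apply, Matrix.smul_apply, smul_eq_mul, Matrix.zero_apply] at e1 e2 ⊢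
  have hI := Complex.I_mul_I
  linear_combination (1 / 2 : ℂ) * e1 + (Complex.I / 2) * e2 +
    ((A * Bᴴ) i j - (B * Aᴴ) i j) / 2 * hI

/-- The eigenvectors of `Q` when `Q^Γ` has maximal negativity. -/
theorem eigenvectors_of_negativity_eq (hm : 2 ≤ m) (hmn : m ≤ n) {P Q : BipartiteMatrix m n}
    (hP : P.PosSemidef) (hQ : Q.PosSemidef) (ht : (P + partialTranspose Q).trace = 1)
    (hN : negativity (P + partialTranspose Q) = ((m : ℝ) - 1) / 2)
    {b : ℕ → BipartiteVec m n} {N : ℕ}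
    (hb : Orthonormal ℂ (fun k : Finset.Icc 1 N => WithLp.toLp 2 (b k)))
    (hQs : Q = ∑ k ∈ Finset.Icc 1 N, (eigval Q k : ℂ) • ketbra (b k)) :
    P = 0 ∧ ∀ k ∈ Finset.Icc 1 N, ∀ l ∈ Finset.Icc 1 N, eigval Q k ≠ 0 → eigval Q l ≠ 0 →
      coeffMatrix (b k) * (coeffMatrix (b l))ᴴ = if k = l then ((1 / m : ℝ) : ℂ) • 1 else 0 := by
  have hm2 : (2 : ℝ) ≤ m := by exact_mod_cast hm
  have hH := hP.1.add hQ.1.partialTranspose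
  rw [negativity_eq] at hN
  obtain ⟨v, hv, hq⟩ := hH.exists_orthonormal_sum_eigval (Finset.filter_subset
    (fun k => eigval (P + partialTranspose Q) k < 0) _)
  rw [hq] at hN
  have hpure := fun ψ (hψ : ‖WithLp.toLp 2 ψ‖ = 1) => (neg_sum_qform_pure_le hmn hψ hv).1
  obtain ⟨hP0, hval⟩ := eq_of_neg_sum_qform_eq hP hQ ht v (by linarith) hpure hN hb hQs
  refine ⟨hP0, ?_⟩
  set C : ℝ := ((m : ℝ) - 1) / 2 with hC
  -- By the symmetry between `ψ` and `v`, positivity of `M` is the pure-state bound, and the optimal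
  -- unit vectors are the zeros of its form. For a positive semidefinite matrix these zeros form the
  -- kernel, a subspace, so linear combinations of optimal vectors are again optimal up to scale.
  set M : BipartiteMatrix m n := ∑ i, partialTranspose (ketbra (v i)) + (C : ℂ) • 1 with hM
  have hMq : ∀ ψ, qform M ψ =
      ∑ i, qform (partialTranspose (ketbra (v i))) ψ + C * ‖WithLp.toLp 2 ψ‖ ^ 2 := fun ψ => by
    rw [hM, qform_add, qform_sum, qform_smul, qform_one]
  have hMh : M.IsHermitian := by
    refine IsHermitian.add ?_ (IsHermitian.smul isHermitian_one (Complex.conj_ofReal C))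
    exact (isSelfAdjoint_sum _ fun i _ => (ketbra_isHermitian (v i)).partialTranspose)
  have hMp : M.PosSemidef := by
    refine hMh.posSemidef_of_qform fun ψ => ?_
    by_cases h0 : ψ = 0
    · subst h0; simp [qform]
    have hn0 : ‖WithLp.toLp 2 ψ‖ ≠ 0 := by simpa using h0
    set r := ‖WithLp.toLp 2 ψ‖ with hr
    have hφ : ‖WithLp.toLp 2 (((r⁻¹ : ℝ) : ℂ) • ψ)‖ = 1 := by
      rw [WithLp.toLp_smul, norm_smul, Complex.norm_real, ← hr, Real.norm_of_nonneg
        (inv_nonneg.2 (norm_nonneg _)), inv_mul_cancel₀ hn0]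
    have h1 : 0 ≤ qform M (((r⁻¹ : ℝ) : ℂ) • ψ) := by
      rw [hMq, hφ]
      have := hpure _ hφ
      simp only [qform_partialTranspose_ketbra_comm _ (v _)] at this
      linarith
    have h2 : qform M (((r⁻¹ : ℝ) : ℂ) • ψ) = r⁻¹ ^ 2 * qform M ψ := by
      rw [qform, qform, mulVec_smul, dotProduct_smul, star_smul, smul_dotProduct,
        Complex.star_def, Complex.conj_ofReal, smul_smul, ← Complex.ofReal_mul, smul_eq_mul,
        Complex.re_ofReal_mul, sq]
    rw [h2] at h1
    have hr2 : 0 < r⁻¹ ^ 2 := by positivity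
    exact nonneg_of_mul_nonneg_right h1 hr2
  have hker : ∀ k ∈ Finset.Icc 1 N, eigval Q k ≠ 0 → M *ᵥ b k = 0 := by
    intro k hk hk0
    refine (hMp.dotProduct_mulVec_zero_iff _).1 ?_
    rw [hMh.dotProduct_eq_qform, hMq, hb.norm_eq_one_of_mem hk]
    have := hval k hk hk0
    simp only [qform_partialTranspose_ketbra_comm (b k)] at this
    rw [Complex.ofReal_eq_zero]
    linarith
  have hAA : ∀ ψ, M *ᵥ ψ = 0 →
      coeffMatrix ψ * (coeffMatrix ψ)ᴴ = ((‖WithLp.toLp 2 ψ‖ ^ 2 / m : ℝ) : ℂ) • 1 := by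
    intro ψ hψ
    refine coeffMatrix_mul_of_scaled (by omega) hmn hv ?_
    have h1 : qform M ψ = 0 := by rw [qform, hψ]; simp
    rw [hMq] at h1
    rw [← hC]
    linarith
  intro k hk l hl hk0 hl0
  have hkk := hAA _ (hker k hk hk0)
  rw [hb.norm_eq_one_of_mem hk, one_pow] at hkk
  by_cases hkl : k = l
  · subst hkl
    rw [if_pos rfl, hkk]
  rw [if_neg hkl]
  have hll := hAA _ (hker l hl hl0)
  rw [hb.norm_eq_one_of_mem hl, one_pow] at hll
  -- The combination has squared norm `2`. The cases `z = 1` and `z = i` feed the polarization.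
  have hcomb : ∀ z : ℂ, ‖z‖ = 1 →
      (coeffMatrix (b k) + z • coeffMatrix (b l)) * (coeffMatrix (b k) + z • coeffMatrix (b l))ᴴ =
        (2 * ((1 / m : ℝ) : ℂ)) • 1 := by
    intro z hz
    have h1 := hAA (b k + z • b l) (by
      rw [mulVec_add, mulVec_smul, hker k hk hk0, hker l hl hl0, smul_zero, add_zero])
    have h2 : ‖WithLp.toLp 2 (b k + z • b l)‖ ^ 2 = 2 := by
      rw [← Complex.ofReal_inj, ← star_dotProduct_self]
      simp only [star_add, star_smul, add_dotProduct, dotProduct_add, smul_dotProduct,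
        dotProduct_smul, hb.dotProduct_of_mem hk hl, hb.dotProduct_of_mem hl hk,
        hb.dotProduct_of_mem hk hk, hb.dotProduct_of_mem hl hl, hkl, Ne.symm hkl, if_true,
        if_false, smul_eq_mul]
      rw [mul_one, mul_zero, add_zero, zero_add, Complex.star_def, Complex.mul_conj,
        Complex.normSq_eq_norm_sq, hz]
      norm_num
    rw [h2, coeffMatrix_add, coeffMatrix_smul] at h1
    rw [h1]
    congr 1
    push_cast
    ring
  have h1 := hcomb 1 (by simp)
  rw [one_smul] at h1
  exact coeffMatrix_mul_eq_zero hkk hll h1 (hcomb Complex.I (by simp))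

end MaximalNegativity

/-! ### Maximal negativity: the normal form under local unitaries. -/

section MaximalNegativity

variable {m n : ℕ}

/-- The number of nonzero eigenvalues, in the form of the index of the last of them. -/
theorem Matrix.PosSemidef.exists_last_eigval_ne_zero {ι : Type*} [Fintype ι] [DecidableEq ι]
    {Q : Matrix ι ι ℂ} (hQ : Q.PosSemidef) {N : ℕ} (hN : Fintype.card ι = N)
    (h0 : ∑ k ∈ Finset.Icc 1 N, eigval Q k ≠ 0) :
    ∃ r, 1 ≤ r ∧ r ≤ N ∧ (∀ k ∈ Finset.Icc 1 r, eigval Q k ≠ 0) ∧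
      ∀ k ∈ Finset.Icc 1 N, k ∉ Finset.Icc 1 r → eigval Q k = 0 := by
  classical
  obtain ⟨l, hl, hl0⟩ := Finset.exists_ne_zero_of_sum_ne_zero h0
  rw [Finset.mem_Icc] at hl
  refine ⟨Nat.findGreatest (fun k => eigval Q k ≠ 0) N,
    hl.1.trans (Nat.le_findGreatest (P := fun k => eigval Q k ≠ 0) hl.2 hl0),
    Nat.findGreatest_le N, fun k hk => ?_, fun k hk hkr => ?_⟩
  · rw [Finset.mem_Icc] at hk
    have h1 : eigval Q (Nat.findGreatest (fun k => eigval Q k ≠ 0) N) ≠ 0 :=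
      Nat.findGreatest_spec (P := fun k => eigval Q k ≠ 0) hl.2 hl0
    have h2 := eigval_antitone hQ.1 hk.1 hk.2 ((Nat.findGreatest_le N).trans hN.ge)
    exact ((lt_of_le_of_ne (hQ.eigval_nonneg _) h1.symm).trans_le h2).ne'
  · rw [Finset.mem_Icc] at hk hkr
    have := Nat.findGreatest_is_greatest (P := fun k => eigval Q k ≠ 0) (n := N) (k := k)
      (by omega) hk.2
    exact not_not.1 this

/-- Vectors whose coefficient matrices have mutually orthogonal rows of norm `1 / √m` become the
states `maxEntangledPhi` after a unitary transformation of the second factor. -/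
theorem exists_unitary_mulVec_eq (hm : 1 ≤ m) {r : ℕ} {b : ℕ → BipartiteVec m n}
    (h : ∀ k ∈ Finset.Icc 1 r, ∀ l ∈ Finset.Icc 1 r,
      coeffMatrix (b k) * (coeffMatrix (b l))ᴴ = if k = l then ((1 / m : ℝ) : ℂ) • 1 else 0) :
    r ≤ n / m ∧ ∃ V ∈ unitaryGroup (Fin n) ℂ, ∀ k ∈ Finset.Icc 1 r,
      ((1 : Matrix (Fin m) (Fin m) ℂ) ⊗ₖ V) *ᵥ b k = maxEntangledPhi m n k := by
  have hm0 : (0 : ℝ) < m := by exact_mod_cast hm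
  have hrow : ∀ k ∈ Finset.Icc 1 r, ∀ l ∈ Finset.Icc 1 r, ∀ i j : Fin m,
      star (fun x => b k (i, x)) ⬝ᵥ (fun x => b l (j, x)) =
        if k = l ∧ i = j then ((1 / m : ℝ) : ℂ) else 0 := by
    intro k hk l hl i j
    have h1 := congrFun (congrFun (h l hl k hk) j) i
    have h2 : (coeffMatrix (b l) * (coeffMatrix (b k))ᴴ) j i =
        star (fun x => b k (i, x)) ⬝ᵥ (fun x => b l (j, x)) := by
      simp [coeffMatrix, mul_apply, dotProduct, mul_comm]
    rw [← h2, h1]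
    by_cases hkl : k = l
    · subst hkl
      by_cases hij : i = j <;> simp [hij, one_apply, eq_comm]
    · simp [hkl, Ne.symm hkl]
  have hmem : ∀ k : Fin r, (k : ℕ) + 1 ∈ Finset.Icc 1 r := fun k =>
    Finset.mem_Icc.2 ⟨by omega, k.2⟩
  have hsqrt : (√m : ℝ) ^ 2 = m := Real.sq_sqrt hm0.le
  have hon : Orthonormal ℂ (fun q : Fin r × Fin m =>
      WithLp.toLp 2 (((√m : ℝ) : ℂ) • fun x => b (q.1 + 1) (q.2, x))) := by
    rw [orthonormal_toLp_iff]
    rintro ⟨k, i⟩ ⟨l, j⟩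
    rw [star_smul, smul_dotProduct, dotProduct_smul, hrow _ (hmem k) _ (hmem l), Complex.star_def,
      Complex.conj_ofReal, smul_smul, ← Complex.ofReal_mul, ← sq, hsqrt, smul_eq_mul]
    simp only [Prod.mk.injEq, add_left_inj, Fin.val_inj]
    split_ifs
    · rw [← Complex.ofReal_mul, mul_one_div_cancel hm0.ne', Complex.ofReal_one]
    · rw [mul_zero]
  -- The `r m` rescaled rows are orthonormal in `ℂ^n`, which is the origin of the bound `⌊n/m⌋`.
  have hrm : r * m ≤ n := by
    have := hon.linearIndependent.fintype_card_le_finrank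
    simpa using this
  have hr : r ≤ n / m := (Nat.le_div_iff_mul_le hm).2 hrm
  refine ⟨hr, ?_⟩
  -- Row `i` of the `k`-th coefficient matrix is placed at position `i + (k-1)m`, as in `Φ_k`. The
  -- remaining positions are zero and get filled when the family is completed; `V` then sends the
  -- normalized row at position `y` to the `y`-th basis vector.
  let t : Fin n → Fin n → ℂ := fun y =>
    if (y : ℕ) < r * m then fun x => b (y / m + 1) (⟨y % m, Nat.mod_lt _ hm⟩, x) else 0
  have hdiv : ∀ y : Fin n, (y : ℕ) < r * m → (y : ℕ) / m + 1 ∈ Finset.Icc 1 r := fun y hy =>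
    Finset.mem_Icc.2 ⟨Nat.succ_pos _, Nat.div_lt_of_lt_mul (by rwa [mul_comm] at hy)⟩
  obtain ⟨c, hc, htc⟩ := exists_orthonormal_of_orthogonal le_rfl t fun y z hyz => by
    simp only [t]
    split_ifs with h1 h2
    · rw [hrow _ (hdiv y h1) _ (hdiv z h2), if_neg]
      rintro ⟨e1, e2⟩
      refine hyz (Fin.ext ?_)
      rw [← Nat.div_add_mod y m, ← Nat.div_add_mod z m, Nat.add_right_cancel e1,
        Fin.mk.inj_iff.1 e2]
    all_goals simp
  set V : Matrix (Fin n) (Fin n) ℂ := of fun y x => star (c y x) with hV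
  refine ⟨V, mem_unitaryGroup_iff.2 (star_mul_self_of_orthonormal hc), fun k hk => ?_⟩
  have hk' := Finset.mem_Icc.1 hk
  rw [maxEntangledPhi_eq]
  ext ⟨i, y⟩
  have hlt : (i : ℕ) + (k - 1) * m < r * m := by
    have : (k - 1 + 1) * m ≤ r * m := Nat.mul_le_mul_right m (by omega)
    have := i.2
    rw [Nat.add_mul] at *
    omega
  let z : Fin n := ⟨i + (k - 1) * m, hlt.trans_le hrm⟩
  have hz : t z = fun x => b k (i, x) := by
    have e1 : ((i : ℕ) + (k - 1) * m) / m + 1 = k := by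
      rw [Nat.add_mul_div_right _ _ hm, Nat.div_eq_of_lt i.2]; omega
    have e2 : ((i : ℕ) + (k - 1) * m) % m = i := by
      rw [Nat.add_mul_mod_self_right, Nat.mod_eq_of_lt i.2]
    simp only [t, z, if_pos hlt, e1, e2, Fin.eta]
  have hnorm : ‖WithLp.toLp 2 (t z)‖ = 1 / √m := by
    have h1 := star_dotProduct_self (t z)
    rw [hz, hrow k hk k hk, if_pos ⟨rfl, rfl⟩, Complex.ofReal_inj, ← hz] at h1
    refine (sq_eq_sq₀ (norm_nonneg _) (by positivity)).1 ?_
    rw [← h1, div_pow, hsqrt, one_pow]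
  have hL : (((1 : Matrix (Fin m) (Fin m) ℂ) ⊗ₖ V) *ᵥ b k) (i, y) = star (c y) ⬝ᵥ t z := by
    rw [hz]
    simp [mulVec, dotProduct, Fintype.sum_prod_type, one_apply, hV]
  rw [hL, htc z, hnorm, dotProduct_smul, orthonormal_toLp_iff.1 hc, Finset.sum_apply,
    Finset.sum_eq_single i]
  · simp only [Pi.smul_apply, tensorVec, Pi.single_eq_same, one_mul, blockVec]
    congr 1
    simp [z, Fin.ext_iff]
  · intro j _ hj
    simp [tensorVec, hj.symm]
  · simp

theorem negativity_eq_iff (hm : 2 ≤ m) (hmn : m ≤ n) (W : BipartiteMatrix m n) :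
    (W ∈ normalizedDEW m n ∧ negativity W = ((m : ℝ) - 1) / 2) ↔
      ∃ U ∈ Matrix.unitaryGroup (Fin m) ℂ, ∃ V ∈ Matrix.unitaryGroup (Fin n) ℂ,
        ∃ k : ℕ, 1 ≤ k ∧ k ≤ n / m ∧
          ∃ p : ℕ → ℝ, (∀ j ∈ Finset.Icc 1 k, 0 ≤ p j) ∧ ∑ j ∈ Finset.Icc 1 k, p j = 1 ∧
            (U ⊗ₖ V) * W * (U ⊗ₖ V)ᴴ =
              ∑ j ∈ Finset.Icc 1 k,
                (p j : ℂ) • partialTranspose (ketbra (maxEntangledPhi m n j)) := by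
  constructor
  · rintro ⟨hW, hneg⟩
    obtain ⟨-, ⟨P, Q, hP, hQ, rfl⟩, ht⟩ := hW
    obtain ⟨b, hb, -, -, hQs⟩ := hQ.1.exists_eigenvectors card_prod_fin
    obtain ⟨rfl, hbb⟩ := eigenvectors_of_negativity_eq hm hmn hP hQ ht hneg hb hQs
    rw [zero_add] at ht ⊢
    rw [trace_partialTranspose, trace_of_eq_sum hb hQs] at ht
    have ht' : ∑ k ∈ Finset.Icc 1 (m * n), eigval Q k = 1 := by exact_mod_cast ht
    obtain ⟨r, hr1, hrN, hr, hr0⟩ :=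
      hQ.exists_last_eigval_ne_zero card_prod_fin (by rw [ht']; norm_num)
    have hsub : Finset.Icc 1 r ⊆ Finset.Icc 1 (m * n) := Finset.Icc_subset_Icc le_rfl hrN
    obtain ⟨hrn, V, hV, hVb⟩ := exists_unitary_mulVec_eq (r := r) (by omega) fun k hk l hl =>
      hbb k (hsub hk) l (hsub hl) (hr k hk) (hr l hl)
    -- A unitary of the second factor alone suffices, and it commutes with `Γ`; the `p_j` are the
    -- nonzero eigenvalues of `Q`.
    refine ⟨1, one_mem _, V, hV, r, hr1, hrn, eigval Q, fun j _ => hQ.eigval_nonneg j, ?_, ?_⟩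
    · rw [← ht']
      exact Finset.sum_subset hsub hr0
    · rw [conjTranspose_kronecker, kronecker_mul_partialTranspose_mul_kronecker,
        conjTranspose_one, transpose_one]
      nth_rewrite 1 [hQs]
      rw [← Finset.sum_subset hsub fun k hk hkr => by rw [hr0 k hk hkr]; simp]
      rw [Finset.mul_sum, Finset.sum_mul, partialTranspose_sum]
      refine Finset.sum_congr rfl fun k hk => ?_
      rw [← hVb k hk, ketbra_mulVec_eq, conjTranspose_kronecker, conjTranspose_one, Matrix.mul_smul,
        Matrix.smul_mul, partialTranspose_smul]
  · rintro ⟨U, hU, V, hV, k, -, hk, p, hp0, hp1, hW⟩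
    exact negativity_of_mixture hm hmn hU hV hk hp0 hp1 hW

end MaximalNegativity

/-! ### Assembly of the nine statements. -/

theorem mainTheorem1 (m n : ℕ) (hm : 2 ≤ m) (hmn : m ≤ n) :
    -- (i) the range of `tr (W²)`
    (∀ S : Set ℝ, S = (fun W : BipartiteMatrix m n => (W ^ 2).trace.re) '' normalizedDEW m n →
      S = Set.Ioc (1 / ((m : ℝ) * n - 1)) 1 ∧
      IsGLB S (1 / ((m : ℝ) * n - 1)) ∧ 1 / ((m : ℝ) * n - 1) ∉ S ∧
      IsLUB S 1 ∧ 1 ∈ S) ∧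
    -- (ii) the case `tr (W²) = 1`
    (∀ W : BipartiteMatrix m n,
      (W ∈ normalizedDEW m n ∧ (W ^ 2).trace.re = 1) ↔
        ∃ ψ : BipartiteVec m n, IsPureEntangled ψ ∧ W = partialTranspose (ketbra ψ)) ∧
    -- (iii) the range of the smallest eigenvalue
    (∀ S : Set ℝ, S = (fun W : BipartiteMatrix m n => eigval W (m * n)) '' normalizedDEW m n →
      S = Set.Ico (-(1 / 2)) 0 ∧
      IsGLB S (-(1 / 2)) ∧ -(1 / 2) ∈ S ∧
      IsLUB S 0 ∧ 0 ∉ S) ∧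
    -- (iv) the case of smallest eigenvalue `-1/2`
    (∀ W : BipartiteMatrix m n,
      (W ∈ normalizedDEW m n ∧ eigval W (m * n) = -(1 / 2)) ↔
        ∃ ψ : BipartiteVec m n, HasSchmidtCoeffs ψ ![√2 / 2, √2 / 2] ∧
          W = partialTranspose (ketbra ψ)) ∧
    -- (v) the range of the largest eigenvalue
    (∀ S : Set ℝ, S = (fun W : BipartiteMatrix m n => eigval W 1) '' normalizedDEW m n →
      S = Set.Ioo (1 / ((m : ℝ) * n - 1)) 1 ∧
      IsGLB S (1 / ((m : ℝ) * n - 1)) ∧ 1 / ((m : ℝ) * n - 1) ∉ S ∧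
      IsLUB S 1 ∧ 1 ∉ S) ∧
    -- (vi) the range of the negativity
    (∀ S : Set ℝ, S = (fun W : BipartiteMatrix m n => negativity W) '' normalizedDEW m n →
      S = Set.Ioc 0 (((m : ℝ) - 1) / 2) ∧
      IsGLB S 0 ∧ 0 ∉ S ∧
      IsLUB S (((m : ℝ) - 1) / 2) ∧ ((m : ℝ) - 1) / 2 ∈ S) ∧
    -- (vii) the case of maximal negativity
    (∀ W : BipartiteMatrix m n,
      (W ∈ normalizedDEW m n ∧ negativity W = ((m : ℝ) - 1) / 2) ↔
        ∃ U ∈ Matrix.unitaryGroup (Fin m) ℂ, ∃ V ∈ Matrix.unitaryGroup (Fin n) ℂ,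
          ∃ k : ℕ, 1 ≤ k ∧ k ≤ n / m ∧
            ∃ p : ℕ → ℝ, (∀ j ∈ Finset.Icc 1 k, 0 ≤ p j) ∧ ∑ j ∈ Finset.Icc 1 k, p j = 1 ∧
              (U ⊗ₖ V) * W * (U ⊗ₖ V)ᴴ =
                ∑ j ∈ Finset.Icc 1 k,
                  (p j : ℂ) • partialTranspose (ketbra (maxEntangledPhi m n j))) ∧
    -- (viii) partial sums of the smallest eigenvalues for `m = 2`
    (m = 2 →
      (IsLeast ((fun W : BipartiteMatrix m n => ∑ i ∈ Finset.Icc 3 (2 * n), eigval W i) ''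
          normalizedDEW m n) (-(1 / (2 + 2 * √2))) ∧
        (∃ x₁ x₂ : ℝ, x₁ ^ 2 + x₂ ^ 2 = 1 ∧ x₁ ^ 2 + x₁ * x₂ = 1 + 1 / (2 + 2 * √2) ∧
          |x₁ - 0.92388| < 0.000001 ∧ |x₂ - 0.382683| < 0.000001) ∧
        (∀ x₁ x₂ : ℝ, x₁ ^ 2 + x₂ ^ 2 = 1 → x₁ ^ 2 + x₁ * x₂ = 1 + 1 / (2 + 2 * √2) →
          ∀ W : BipartiteMatrix m n,
            W = partialTranspose (ketbra ((x₁ : ℂ) • basisKet 1 1 + (x₂ : ℂ) • basisKet 2 2)) →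
            W ∈ normalizedDEW m n ∧
              ∑ i ∈ Finset.Icc 3 (2 * n), eigval W i = -(1 / (2 + 2 * √2)))) ∧
      (∀ k : ℕ, 4 ≤ k → k ≤ 2 * n →
        IsLeast ((fun W : BipartiteMatrix m n => ∑ i ∈ Finset.Icc k (2 * n), eigval W i) ''
          normalizedDEW m n) (-(1 / 2)) ∧
        (∀ ψ : BipartiteVec m n, HasSchmidtCoeffs ψ (fun _ : Fin m => 1 / √(m : ℝ)) →
          ∀ W : BipartiteMatrix m n, W = partialTranspose (ketbra ψ) →
            W ∈ normalizedDEW m n ∧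
              ∑ i ∈ Finset.Icc k (2 * n), eigval W i = -(1 / 2)))) ∧
    -- (ix) sums of the two and of the three smallest eigenvalues for `m ≥ 3`
    (3 ≤ m →
      (IsLeast ((fun W : BipartiteMatrix m n => eigval W (m * n) + eigval W (m * n - 1)) ''
          normalizedDEW m n) (-(√2 / 2)) ∧
        (∀ ψ : BipartiteVec m n, HasSchmidtCoeffs ψ ![√2 / 2, 1 / 2, 1 / 2] →
          ∀ W : BipartiteMatrix m n, W = partialTranspose (ketbra ψ) →
            W ∈ normalizedDEW m n ∧
              eigval W (m * n) + eigval W (m * n - 1) = -(√2 / 2))) ∧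
      (IsLeast ((fun W : BipartiteMatrix m n =>
            eigval W (m * n) + eigval W (m * n - 1) + eigval W (m * n - 2)) ''
          normalizedDEW m n) (-1) ∧
        (∀ ψ : BipartiteVec m n, HasSchmidtCoeffs ψ (fun _ : Fin 3 => 1 / √3) →
          ∀ W : BipartiteMatrix m n, W = partialTranspose (ketbra ψ) →
            W ∈ normalizedDEW m n ∧
              eigval W (m * n) + eigval W (m * n - 1) + eigval W (m * n - 2) = -1))) := by
  obtain ⟨-, hK⟩ := cast_mul_sub_one hm hmn
  have hK3 : 1 / ((m : ℝ) * n - 1) < 1 := by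
    have h : 2 * 2 ≤ m * n := Nat.mul_le_mul hm (hm.trans hmn)
    have h' : ((2 * 2 : ℕ) : ℝ) ≤ ((m * n : ℕ) : ℝ) := Nat.cast_le.2 h
    push_cast at h'
    rw [div_lt_one hK]
    linarith
  have hm2 : (2 : ℝ) ≤ m := by exact_mod_cast hm
  refine ⟨?_, fun W => trace_sq_eq_one_iff hm hmn, ?_, eigval_last_eq_iff hm hmn, ?_, ?_,
    negativity_eq_iff hm hmn, ?_, fun hm3 => isLeast_sum_eigval_of_three_le hm3 hmn⟩
  · rintro S rfl
    have hS : (fun W : BipartiteMatrix m n => (W ^ 2).trace.re) '' normalizedDEW m n =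
        Set.Ioc (1 / ((m : ℝ) * n - 1)) 1 := by
      refine Set.Subset.antisymm ?_ fun y hy => exists_mem_trace_sq_eq hm hmn hy.1 hy.2
      rintro _ ⟨W, hW, rfl⟩
      exact ⟨lt_trace_sq_of_mem hm hmn hW, trace_sq_le_one_of_mem hW⟩
    rw [hS]
    exact ⟨rfl, isGLB_Ioc hK3, fun h => lt_irrefl _ h.1, isLUB_Ioc hK3, hK3, le_rfl⟩
  · rintro S rfl
    have hS : (fun W : BipartiteMatrix m n => eigval W (m * n)) '' normalizedDEW m n =
        Set.Ico (-(1 / 2)) 0 := by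
      refine Set.Subset.antisymm ?_ fun y hy => exists_mem_eigval_last_eq hm hmn hy.2 hy.1
      rintro _ ⟨W, hW, rfl⟩
      refine ⟨?_, eigval_last_neg hW⟩
      have := (hW.2.1.neg_sum_eigval_le hW.2.2 (by omega) hmn (T := {m * n})
        (Finset.singleton_subset_iff.2 (Finset.mem_Icc.2
          ⟨one_le_mul_of_two_le hm hmn, le_rfl⟩))).2.1 (by simp)
      rw [Finset.sum_singleton] at this
      linarith
    have hlt : (-(1 / 2) : ℝ) < 0 := by norm_num
    rw [hS]
    exact ⟨rfl, isGLB_Ico hlt, ⟨le_rfl, hlt⟩, isLUB_Ico hlt, fun h => lt_irrefl _ h.2⟩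
  · rintro S rfl
    have hS : (fun W : BipartiteMatrix m n => eigval W 1) '' normalizedDEW m n =
        Set.Ioo (1 / ((m : ℝ) * n - 1)) 1 := by
      refine Set.Subset.antisymm ?_ fun y hy => exists_mem_eigval_one_eq hm hmn hy.1 hy.2
      rintro _ ⟨W, hW, rfl⟩
      exact ⟨lt_eigval_one_of_mem hm hmn hW, eigval_one_lt_one_of_mem hm hmn hW⟩
    rw [hS]
    exact ⟨rfl, isGLB_Ioo hK3, fun h => lt_irrefl _ h.1, isLUB_Ioo hK3, fun h => lt_irrefl _ h.2⟩
  · rintro S rfl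
    have hS : (fun W : BipartiteMatrix m n => negativity W) '' normalizedDEW m n =
        Set.Ioc 0 (((m : ℝ) - 1) / 2) := by
      refine Set.Subset.antisymm ?_ fun y hy => exists_mem_negativity_eq hm hmn hy.1 hy.2
      rintro _ ⟨W, hW, rfl⟩
      exact ⟨negativity_pos_of_mem hm hmn hW, negativity_le_of_mem hW (by omega) hmn⟩
    have hlt : 0 < ((m : ℝ) - 1) / 2 := by linarith
    rw [hS]
    exact ⟨rfl, isGLB_Ioc hlt, fun h => lt_irrefl _ h.1, isLUB_Ioc hlt, hlt, le_rfl⟩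
  · rintro rfl
    exact isLeast_sum_eigval_two n hmn
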